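/- Let $0<\zeta<\pi/2$, $\eta=i\zeta$, $q=e^{\eta}$. **Notation (finite chain).** Let $N\ge 1$, $L=2N$, $\xi_1,\dots,\xi_N\in\mathbb R$, and put $w_{2b-1}=\xi_b$, $w_{2b}=\xi_b-\eta$. On $(\mathbb C^2)^{\otimes L}$, with basis $|0\rangle$ (up), $|1\rangle$ (down) of $\mathbb C^2$, let $e_j^{a,c}$ be the $2\times2$ matrix unit with entry $1$ at $(a,c)$ acting on site $j$. Let $R(u)$ and $R^{+}(u)$ be the $4\times4$ matrices, in the basis $00,01,10,11$, with diagonal $(1,b,b,1)$, $b=\sinh u/\sinh(u+\eta)$, whose only other non-zero entries are those at $(01,10)$ and $(10,01)$: both are $\sinh\eta/\sinh(u+\eta)$ for $R$, and they are $e^{-u}\sinh\eta/\sinh(u+\eta)$ and $e^{u}\sinh\eta/\sinh(u+\eta)$, respectively, for $R^+$. Write $$R_{0L}(\lambda-w_L)\cdots R_{01}(\lambda-w_1)=\begin{pmatrix}A(\lambda)&B(\lambda)\\ C(\lambda)&D(\lambda)\end{pmatrix}$$ over the auxiliary space $0$, and similarly $A^+,B^+,C^+,D^+$ with $R^+$.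 On two sites let $\|2,0\rangle^{\sim}=|00\rangle$, $\|2,1\rangle^{\sim}=\frac{[2]_q}{2q}(|01\rangle+q|10\rangle)$, $\|2,2\rangle^{\sim}=|11\rangle$, and $\langle2,0\|=\langle00|$, $\langle2,1\|=\frac{q}{[2]_q}(\langle01|+q^{-1}\langle10|)$, $\langle2,2\|=\langle11|$, where $[2]_q=q+q^{-1}$. Let $\widetilde E^{n,n\,(2p)}=\|2,n\rangle^{\sim}\langle2,n\|$, let $\widetilde P$ be the tensor product of the projectors $\sum_{n}\widetilde E^{n,n\,(2p)}$ over the $N$ pairs of sites $(2b-1,2b)$, let $\widetilde E^{11\,(2p)}_1$ be $\widetilde E^{1,1\,(2p)}$ acting on the first pair, and let $\chi$ be the diagonal matrix multiplying a basis vector with $n_b$ down spins on pair $b$ by $\exp\sum_b n_b(\xi_b-\eta/2)$. Put $\widetilde B(\lambda)=e^{\lambda}\chi^{-1}\widetilde PB^+(\lambda)\widetilde P\chi$ and $\widetilde C(\lambda)=e^{-\lambda}\chi^{-1}\widetilde PC^+(\lambda)\widetilde P\chi$. With the all-up vector $|0\rangle$ and for $\lambda_1,\dots,\lambda_N\in\mathbb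 C$ with $\sinh(\lambda_\gamma-w_j+\eta)\ne0$ for all $\gamma,j$, let $$|\psi^{(0)}\rangle=\prod_\gamma B(\lambda_\gamma)|0\rangle,\quad \langle\psi^{(0)}|=\langle0|\prod_\gamma C(\lambda_\gamma),\quad|\psi\rangle=\prod_\gamma\widetilde B(\lambda_\gamma)|0\rangle,\quad\langle\psi|=\langle0|\prod_\gamma\widetilde C(\lambda_\gamma),$$ and $\langle\widetilde E^{11(2p)}\rangle=\langle\psi|\widetilde E_1^{11\,(2p)}|\psi\rangle/\langle\psi|\psi\rangle$, $\langle e_1^{a,c}e_2^{a',c'}\rangle=\langle\psi^{(0)}|e_1^{a,c}e_2^{a',c'}|\psi^{(0)}\rangle/\langle\psi^{(0)}|\psi^{(0)}\rangle$ (with the convention $x/0=0$). **(1) Symmetry relations.** Suppose that $|\psi^{(0)}\rangle$ has the spin-inversion symmetry $U|\psi^{(0)}\rangle=\pm|\psi^{(0)}\rangle$, $U=\prod_{j=1}^L\sigma_j^x$ (as is assumed of the ground state, with $\lambda_\gamma$ its Bethe roots). Then $$\langle\widetilde E^{11(2p)}\rangle=2\langle e_1^{00}e_2^{11}\rangle=2\langle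 e_1^{11}e_2^{00}\rangle=2\langle e_1^{01}e_2^{10}\rangle=2\langle e_1^{10}e_2^{01}\rangle ,$$ and the same equalities hold between the unnormalized matrix elements $\langle\psi|\widetilde E_1^{11\,(2p)}|\psi\rangle$ and $2\langle\psi^{(0)}|e_1^{a,c}e_2^{1-a,1-c}|\psi^{(0)}\rangle$. **(2) Double integrals of the thermodynamic limit.** Let $\xi_1\in\mathbb R$, $w_1=\xi_1$, $w_2=\xi_1-\eta$, $\rho(x)=\dfrac1{2\zeta\cosh(\pi x/\zeta)}$. For $a,c\in\{0,1\}$ let $j=2$ if $a=0$ and $j=1$ if $a=1$, let $j'=c+1$, and for $\varepsilon>0$ put $$I_\varepsilon(a,c)=\sum_{g_1,g_2\in\{1,2\}}\ \int_{\mathbb R-(g_1-1)\eta+i\varepsilon}d\lambda_1\int_{\mathbb R-(g_2-1)\eta-i\varepsilon}d\lambda_2\;Q(\lambda_1,\lambda_2)\,\det\bigl[\rho(\lambda_i-w_k+\eta/2)\,\delta_{g_i,k}\bigr]_{i,k=1,2},$$ $$Q(\lambda_1,\lambda_2)=-\frac{\prod_{k<j}\sinh(\lambda_2-w_k+\eta)\prod_{k>j}\sinh(\lambda_2-w_k)\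 \prod_{k<j'}\sinh(\lambda_1-w_k-\eta)\prod_{k>j'}\sinh(\lambda_1-w_k)}{\sinh(\lambda_2-\lambda_1+\eta+\varepsilon_{21})\,\sinh(w_1-w_2)},$$ with $k\in\{1,2\}$, and $\varepsilon_{21}=i\varepsilon$ if $\operatorname{Im}(\lambda_2-\lambda_1)>0$, $\varepsilon_{21}=-i\varepsilon$ otherwise; $I_{0^+}(a,c)=\lim_{\varepsilon\to0^+}I_\varepsilon(a,c)$ is the double integral representing $\langle e_1^{a,c}e_2^{1-a,1-c}\rangle$ in the thermodynamic limit of the ground state, and $I_{0^+}(a,0)+I_{0^+}(a,1)$ (for either choice of $a$) the one representing $\langle\widetilde E^{11(2p)}\rangle$. For all sufficiently small $\varepsilon>0$ all integrands are absolutely integrable, the limits exist, and for all $a,c\in\{0,1\}$ $$I_{0^+}(a,0)+I_{0^+}(a,1)=2\,I_{0^+}(a,c)=\frac{\cos\zeta\,(\sin\zeta-\zeta\cos\zeta)}{\zeta\sin^2\zeta}.$$ In particular the double integrals for $\langle e_1^{11}e_2^{00}\rangle$ and $\langle e_1^{01}e_2^{10}\rangle$ have the same value, half of $\langle E^{11}\rangle$.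 -/

import Mathlib

open Filter Topology MeasureTheory
open scoped Matrix

noncomputable section

namespace XXZ

/-! ### The finite chain

Spin-1/2 states are labelled by `Fin 2`, with `0` = up and `1` = down. The spin-1 chain with `N`
sites is built on `2 N` spin-1/2 sites; the `b`-th spin-1 site consists of the spin-1/2 sites
`(b, 0)` and `(b, 1)`, in this order. -/

/-- Configurations of `2 N` spins 1/2, the labels of the standard basis of the quantum space. -/
abbrev Conf (N : ℕ) : Type := Fin N × Fin 2 → Fin 2

/-- Operators on the tensor product of `2 N` two-dimensional spaces. -/
abbrev Op (N : ℕ) : Type := Matrix (Conf N) (Conf N) ℂ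

/-- `4 × 4` matrices acting on the tensor product of two spins 1/2. -/
abbrev TwoSite : Type := Matrix (Fin 2 × Fin 2) (Fin 2 × Fin 2) ℂ

/-- The crossing parameter `η = i ζ` of the massless regime. -/
def eta (ζ : ℝ) : ℂ := Complex.I * ζ

/-- The deformation parameter `q = exp η`. -/
def q (ζ : ℝ) : ℂ := Complex.exp (eta ζ)

/-- The `q`-integer `[n]_q`. -/
def qInt (ζ : ℝ) (n : ℕ) : ℂ := (q ζ ^ n - (q ζ)⁻¹ ^ n) / (q ζ - (q ζ)⁻¹)

/-- A `2 × 2` matrix acting on the spin-1/2 site `j`, and the identity elsewhere. -/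
def siteOp {N : ℕ} (j : Fin N × Fin 2) (A : Matrix (Fin 2) (Fin 2) ℂ) : Op N :=
  Matrix.of fun σ τ => if ∀ k, k ≠ j → σ k = τ k then A (σ j) (τ j) else 0

/-- A `4 × 4` matrix acting on the spin-1/2 sites `(b, 0)`, `(b, 1)`, and the identity elsewhere. -/
def pairOp {N : ℕ} (b : Fin N) (A : TwoSite) : Op N :=
  Matrix.of fun σ τ =>
    if ∀ k : Fin N × Fin 2, k.1 ≠ b → σ k = τ k then
      A (σ (b, 0), σ (b, 1)) (τ (b, 0), τ (b, 1)) else 0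

/-- The spin-1/2 elementary matrix `e_j^{a, c}`. -/
def elem {N : ℕ} (j : Fin N × Fin 2) (a c : Fin 2) : Op N := siteOp j (Matrix.single a c 1)

/-- The six-vertex matrix, in the basis `00, 01, 10, 11`, with diagonal entries `1, b, b, 1`, the
entry `cm` at `(01, 10)` and the entry `cp` at `(10, 01)`. -/
def sixVertex (b cm cp : ℂ) : TwoSite :=
  Matrix.of fun x y =>
    if x = y then (if x.1 = x.2 then 1 else b)
    else if x = (0, 1) ∧ y = (1, 0) then cm
    else if x = (1, 0) ∧ y = (0, 1) then cp
    else 0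

/-- The symmetric `R`-matrix `R^{(p)}(u)` (principal grading). -/
def RPrincipal (ζ : ℝ) (u : ℂ) : TwoSite :=
  sixVertex (Complex.sinh u / Complex.sinh (u + eta ζ))
    (Complex.sinh (eta ζ) / Complex.sinh (u + eta ζ))
    (Complex.sinh (eta ζ) / Complex.sinh (u + eta ζ))

/-- The asymmetric `R`-matrix `R^{+}(u)` (homogeneous grading). -/
def RHomogeneous (ζ : ℝ) (u : ℂ) : TwoSite :=
  sixVertex (Complex.sinh u / Complex.sinh (u + eta ζ))
    (Complex.exp (-u) * Complex.sinh (eta ζ) / Complex.sinh (u + eta ζ))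
    (Complex.exp u * Complex.sinh (eta ζ) / Complex.sinh (u + eta ζ))

/-- The inhomogeneity parameters, forming complete 2-strings: `w_{(b, β)} = ξ_b - β η`,
`β = 0, 1`. -/
def w {N : ℕ} (ζ : ℝ) (ξ : Fin N → ℝ) (j : Fin N × Fin 2) : ℂ :=
  ξ j.1 - ((j.2 : ℕ) : ℂ) * eta ζ

/-- A `4 × 4` matrix acting on (auxiliary space) ⊗ (site `j`), as a `2 × 2` matrix over the
auxiliary space whose entries are operators on the quantum space. -/
def lax {N : ℕ} (R : TwoSite) (j : Fin N × Fin 2) : Matrix (Fin 2) (Fin 2) (Op N) :=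
  Matrix.of fun a c => siteOp j (Matrix.of fun b d => R (a, b) (c, d))

/-- The spin-1/2 monodromy matrix `R_{0 L}(lam - w_L) ⋯ R_{0 1}(lam - w_1)`, `L = 2 N`. -/
def monodromy {N : ℕ} (ζ : ℝ) (ξ : Fin N → ℝ) (R : ℂ → TwoSite) (lam : ℂ) :
    Matrix (Fin 2) (Fin 2) (Op N) :=
  ((List.finRange N).reverse.map fun b =>
    lax (R (lam - w ζ ξ (b, 1))) (b, 1) * lax (R (lam - w ζ ξ (b, 0))) (b, 0)).prod

/-- The reference vector `|0⟩`, all spins up (also used as the covector `⟨0|`). -/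
def vac (N : ℕ) : Conf N → ℂ := Pi.single 0 1

/-- `|ψ^{(0)}⟩ = B(lam_1) ⋯ B(lam_M) |0⟩`, with the spin-1/2 operators `B` (entry `(0, 1)` of the
monodromy matrix) in the principal grading. -/
def ketHalf {N M : ℕ} (ζ : ℝ) (ξ : Fin N → ℝ) (lam : Fin M → ℂ) : Conf N → ℂ :=
  (List.ofFn fun γ => monodromy ζ ξ (RPrincipal ζ) (lam γ) 0 1).prod *ᵥ vac N

/-- `⟨ψ^{(0)}| = ⟨0| C(lam_1) ⋯ C(lam_M)`, with the spin-1/2 operators `C` (entry `(1, 0)` of the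
monodromy matrix) in the principal grading. -/
def braHalf {N M : ℕ} (ζ : ℝ) (ξ : Fin N → ℝ) (lam : Fin M → ℂ) : Conf N → ℂ :=
  vac N ᵥ* (List.ofFn fun γ => monodromy ζ ξ (RPrincipal ζ) (lam γ) 1 0).prod

/-- The covectors `⟨2, n||`: `⟨++|`, `(q / [2]_q) (⟨+-| + q⁻¹ ⟨-+|)`, `⟨--|`. -/
def bra2 (ζ : ℝ) (n : Fin 3) : Fin 2 × Fin 2 → ℂ :=
  ![Pi.single (0, 0) 1,
    (q ζ / qInt ζ 2) • (Pi.single (0, 1) 1 + (q ζ)⁻¹ • Pi.single (1, 0) 1),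
    Pi.single (1, 1) 1] n

/-- The vectors `||2, n⟩~`, Hermitian conjugate to the `⟨2, n||` up to normalization:
`|++⟩`, `([2]_q / (2 q)) (|+-⟩ + q |-+⟩)`, `|--⟩`. -/
def ketTilde2 (ζ : ℝ) (n : Fin 3) : Fin 2 × Fin 2 → ℂ :=
  ![Pi.single (0, 0) 1,
    (qInt ζ 2 / (2 * q ζ)) • (Pi.single (0, 1) 1 + q ζ • Pi.single (1, 0) 1),
    Pi.single (1, 1) 1] n

/-- The diagonal spin-1 elementary matrix `Ẽ^{n, n (2 p)} = ||2, n⟩~ ⟨2, n||`. -/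
def ETilde (ζ : ℝ) (n : Fin 3) : TwoSite := Matrix.vecMulVec (ketTilde2 ζ n) (bra2 ζ n)

/-- The two-site projector `P̃^{(2)} = ∑ₙ ||2, n⟩~ ⟨2, n||`. -/
def PTilde2 (ζ : ℝ) : TwoSite := ∑ n, Matrix.vecMulVec (ketTilde2 ζ n) (bra2 ζ n)

/-- The projector `P̃` on the whole chain: the tensor product of the `P̃^{(2)}` over the spin-1
sites. -/
def PTilde (N : ℕ) (ζ : ℝ) : Op N :=
  Matrix.of fun σ τ => ∏ b, PTilde2 ζ (σ (b, 0), σ (b, 1)) (τ (b, 0), τ (b, 1))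

/-- The spin-1 gauge transformation: the tensor product over `b` of the diagonal matrices which
multiply a vector with `n` down spins on the spin-1 site `b` by `exp (n Λ_b)`, where
`Λ_b = ξ_b - η / 2` is the center of the string of inhomogeneities. -/
def gauge {N : ℕ} (ζ : ℝ) (ξ : Fin N → ℝ) : Op N :=
  Matrix.diagonal fun σ =>
    Complex.exp (∑ b, (((σ (b, 0) : ℕ) : ℂ) + ((σ (b, 1) : ℕ) : ℂ)) * (ξ b - eta ζ / 2))

/-- The spin-1 monodromy matrix `T̃^{(1, 2 p)}` in the principal grading: the spin-1/2 monodromy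
matrix in the homogeneous grading is projected by `P̃` on both sides, and conjugated by the inverse
of the gauge transformation `diag(1, exp lam) ⊗ gauge`. -/
def fusedMonodromy {N : ℕ} (ζ : ℝ) (ξ : Fin N → ℝ) (lam : ℂ) : Matrix (Fin 2) (Fin 2) (Op N) :=
  Matrix.of fun a c =>
    (Complex.exp (((c : ℕ) : ℂ) * lam) * Complex.exp (-(((a : ℕ) : ℂ) * lam))) •
      ((gauge ζ ξ)⁻¹ *
        (PTilde N ζ * monodromy ζ ξ (RHomogeneous ζ) lam a c * PTilde N ζ) * gauge ζ ξ)

/-- The spin-1 vector `|ψ^{(2 p)}⟩ = B̃(lam_1) ⋯ B̃(lam_M) |0⟩`. -/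
def ketOne {N M : ℕ} (ζ : ℝ) (ξ : Fin N → ℝ) (lam : Fin M → ℂ) : Conf N → ℂ :=
  (List.ofFn fun γ => fusedMonodromy ζ ξ (lam γ) 0 1).prod *ᵥ vac N

/-- The spin-1 covector `⟨ψ^{(2 p)}| = ⟨0| C̃(lam_1) ⋯ C̃(lam_M)`. -/
def braOne {N M : ℕ} (ζ : ℝ) (ξ : Fin N → ℝ) (lam : Fin M → ℂ) : Conf N → ℂ :=
  vac N ᵥ* (List.ofFn fun γ => fusedMonodromy ζ ξ (lam γ) 1 0).prod

/-- The spin inversion operator `U = ∏_j σ_j^x`. -/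
def spinInversion (N : ℕ) : Op N :=
  Matrix.of fun σ τ => ∏ k, (!![0, 1; 1, 0] : Matrix (Fin 2) (Fin 2) ℂ) (σ k) (τ k)

/-- The matrix element `⟨bra| A |ket⟩`. -/
def matrixElement {N : ℕ} (bra ket : Conf N → ℂ) (A : Op N) : ℂ := bra ⬝ᵥ (A *ᵥ ket)

/-- The expectation value `⟨bra| A |ket⟩ / ⟨bra|ket⟩`. -/
def expectation {N : ℕ} (bra ket : Conf N → ℂ) (A : Op N) : ℂ :=
  matrixElement bra ket A / (bra ⬝ᵥ ket)

/-! ### The double integrals of the thermodynamic limit -/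

/-- The density of string centers. -/
def rho (ζ : ℝ) (x : ℂ) : ℂ := 1 / (2 * ζ * Complex.cosh (Real.pi * x / ζ))

/-- The two inhomogeneity parameters of the first spin-1 site, `ξ₁` and `ξ₁ - η`. -/
def w1 (ζ ξ₁ : ℝ) (k : Fin 2) : ℂ := ξ₁ - ((k : ℕ) : ℂ) * eta ζ

/-- The infinitesimal shift `ε_{2 1}`: it is `i ε` or `-i ε` according to the sign of
`Im (l2 - l1)`. -/
def epsShift (ε : ℝ) (l1 l2 : ℂ) : ℂ :=
  if 0 < (l2 - l1).im then Complex.I * ε else -(Complex.I * ε)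

/-- The function `Q` of the double integral, when the set `α⁺` (sites whose column index is `0`)
is `{j'}` and the set `α⁻` (sites whose row index is `1`) is `{j}`; then `l1` is the variable
attached to `j'` and `l2` the one attached to `j`. -/
def Q (ζ ξ₁ ε : ℝ) (j' j : Fin 2) (l1 l2 : ℂ) : ℂ :=
  (-1) *
    (((∏ k ∈ Finset.Iio j, Complex.sinh (l2 - w1 ζ ξ₁ k + eta ζ)) *
        ∏ k ∈ Finset.Ioi j, Complex.sinh (l2 - w1 ζ ξ₁ k)) /
      Complex.sinh (l2 - l1 + eta ζ + epsShift ε l1 l2)) *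
    (((∏ k ∈ Finset.Iio j', Complex.sinh (l1 - w1 ζ ξ₁ k - eta ζ)) *
        ∏ k ∈ Finset.Ioi j', Complex.sinh (l1 - w1 ζ ξ₁ k)) /
      Complex.sinh (w1 ζ ξ₁ 0 - w1 ζ ξ₁ 1))

/-- The matrix `S`, for variables `l i` on the contour labelled by `g i`. -/
def S (ζ ξ₁ : ℝ) (g : Fin 2 → Fin 2) (l : Fin 2 → ℂ) : Matrix (Fin 2) (Fin 2) ℂ :=
  Matrix.of fun i k => if g i = k then rho ζ (l i - w1 ζ ξ₁ k + eta ζ / 2) else 0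

/-- The integrand for `⟨e_1^{a, c} e_2^{1 - a, 1 - c}⟩`, for which `α⁺ = {c}` and `α⁻ = {1 - a}`,
on the product of contours `ℝ - g₀ η + i ε` (first variable) and `ℝ - g₁ η - i ε` (second variable),
parametrized by their real parts. -/
def integrand (ζ ξ₁ : ℝ) (a c : Fin 2) (ε : ℝ) (g : Fin 2 → Fin 2) (x : ℝ × ℝ) : ℂ :=
  let l1 : ℂ := x.1 - ((g 0 : ℕ) : ℂ) * eta ζ + Complex.I * ε
  let l2 : ℂ := x.2 - ((g 1 : ℕ) : ℂ) * eta ζ - Complex.I * ε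
  Q ζ ξ₁ ε c (1 - a) l1 l2 * (S ζ ξ₁ g ![l1, l2]).det

/-- The regularized double integral for `⟨e_1^{a, c} e_2^{1 - a, 1 - c}⟩`: the sum over the choices
of one of the two contours for each of the two variables. -/
def doubleIntegral (ζ ξ₁ : ℝ) (a c : Fin 2) (ε : ℝ) : ℂ :=
  ∑ g : Fin 2 → Fin 2, ∫ x : ℝ × ℝ, integrand ζ ξ₁ a c ε g x

/-- The closed form of the spin-1 one-point function `⟨E^{11}⟩`. -/
def onePoint (ζ : ℝ) : ℝ :=
  Real.cos ζ * (Real.sin ζ - ζ * Real.cos ζ) / (ζ * Real.sin ζ ^ 2)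

end XXZ

end

/-! ### Integrals over horizontal lines: moving the line, and residues in a strip -/

section

open Set

/-! The symmetry relations and the double integrals are independent of each other.

Finite chain. The asymmetric R-matrix, the projector and the gauge factor are diagonal conjugates of
the symmetric R-matrix and of the plain symmetrizer S of the pairs. The diagonal factors combine
into a single one, W, and each fused operator equals W S T S W⁻¹ with T an entry of the principal
monodromy matrix (`fusedMonodromy_eq`). Since the inhomogeneities form complete 2-strings, T maps
vectors antisymmetric in a pair to such vectors, that is S T S = S T
(`blockSym_mul_monodromy_mul_blockSym`). The projectors then telescope: the spin-1 ket is W S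
applied to the spin-1/2 ket, the spin-1 bra is the spin-1/2 bra times W⁻¹, and the spin-1/2 bra is
symmetric in each pair. Hence the norms agree, and the element of Ẽ¹¹ is half the sum of the four
elements of e^{a,c} e^{1-a,1-c} (`matrixElement_ETilde`). These four are equal: symmetry of the bra
exchanges the row indices of the two sites, and spin inversion exchanges up and down everywhere.
Spin inversion is assumed for the ket only. It passes to the bra because transposition turns C into
B on the chain read backwards, and products of R-matrices, which commute with the inversion and fix
the vacuum, intertwine the two orders (`exists_braHalf_eq_mulVec_ketHalf`); the commutativity of the
B's follows from the RTT relation.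

Double integrals. The determinant kills the terms with g₁ = g₂. In the other two, after removal of
the shifts by ξ₁ and η, the integrand is a product of one function of each variable and a kernel in
their difference, on the lines Im = ε and Im = -ε (`integrand_id`, `integrand_swap`); a has dropped
out. No pole obstructs the move to the lines Im = ζ/2 and Im = -ζ/2, on which the densities are real
and nothing is singular, so ε may be set to 0 under the integral. Negating both variables then
exchanges the values for c = 0 and c = 1. Their sum has an elementary numerator
(`pairIntegrand_sum`) and reduces to a real double integral, whose inner integral is a residue
computation (`integral_inv_cosh_div`) and whose outer integrals are those of 1/cosh, 1/cosh² and
cosh(2t)/cosh² (`integral_realIntegrand`). -/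

theorem integrable_exp_neg_mul_abs {κ : ℝ} (hκ : 0 < κ) :
    Integrable fun x : ℝ => Real.exp (-κ * |x|) := by
  have h : IntegrableOn (fun x : ℝ => Real.exp (-κ * |x|)) (Ioi 0) :=
    (integrableOn_exp_mul_Ioi (neg_lt_zero.2 hκ) 0).congr_fun
      (fun x hx => by simp only [abs_of_pos (mem_Ioi.1 hx)]) measurableSet_Ioi
  have h' : IntegrableOn (fun x : ℝ => Real.exp (-κ * |x|)) (Iic 0) :=
    (integrableOn_exp_mul_Iic hκ 0).congr_fun
      (fun x hx => by simp only [abs_of_nonpos (mem_Iic.1 hx)]; ring_nf) measurableSet_Iic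
  rw [← integrableOn_univ, ← Iic_union_Ioi (a := (0 : ℝ))]
  exact h'.union h

theorem continuous_comp_line {f : ℂ → ℂ} {s : Set ℝ} {y : ℝ}
    (hf : ContinuousOn f {z | z.im ∈ s}) (hy : y ∈ s) :
    Continuous fun x : ℝ => f (x + y * Complex.I) :=
  hf.comp_continuous (by fun_prop) fun x => by simpa using hy

theorem integrable_comp_line {f : ℂ → ℂ} {s : Set ℝ} {y C κ : ℝ} (hκ : 0 < κ)
    (hf : ContinuousOn f {z | z.im ∈ s}) (hy : y ∈ s)
    (hb : ∀ z : ℂ, z.im ∈ s → ‖f z‖ ≤ C * Real.exp (-κ * |z.re|)) :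
    Integrable fun x : ℝ => f (x + y * Complex.I) := by
  refine ((integrable_exp_neg_mul_abs hκ).const_mul C).mono'
    (continuous_comp_line hf hy).aestronglyMeasurable (Eventually.of_forall fun x => ?_)
  simpa using hb (x + y * Complex.I) (by simpa using hy)

/-- The integral of a holomorphic function over a horizontal line does not change when the line is
moved inside a strip on which the function decays exponentially. -/
theorem integral_line_eq_of_differentiableOn {f : ℂ → ℂ} {a b C κ : ℝ} (hab : a ≤ b) (hκ : 0 < κ)
    (hf : DifferentiableOn ℂ f {z | z.im ∈ Icc a b})
    (hb : ∀ z : ℂ, z.im ∈ Icc a b → ‖f z‖ ≤ C * Real.exp (-κ * |z.re|)) :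
    ∫ x : ℝ, f (x + a * Complex.I) = ∫ x : ℝ, f (x + b * Complex.I) := by
  have hia := integrable_comp_line hκ hf.continuousOn (left_mem_Icc.2 hab) hb
  have hib := integrable_comp_line hκ hf.continuousOn (right_mem_Icc.2 hab) hb
  have la := intervalIntegral_tendsto_integral hia tendsto_neg_atTop_atBot tendsto_id
  have lb := intervalIntegral_tendsto_integral hib tendsto_neg_atTop_atBot tendsto_id
  -- Cauchy's theorem on the rectangle with |Re z| ≤ T: the two truncated line integrals differ by
  -- the vertical sides, each of length b - a with integrand at most C exp (-κ T).
  have key : ∀ T : ℝ, 0 ≤ T → ‖(∫ x in (-T)..T, f (x + a * Complex.I)) -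
      ∫ x in (-T)..T, f (x + b * Complex.I)‖ ≤ 2 * (C * Real.exp (-κ * T) * |b - a|) := by
    intro T hT
    have h := Complex.integral_boundary_rect_eq_zero_of_differentiableOn f
      (⟨-T, a⟩ : ℂ) (⟨T, b⟩ : ℂ) (hf.mono fun z hz => by
        have := hz.2
        rw [mem_preimage, uIcc_of_le hab] at this
        exact this)
    simp only [] at h
    have e1 : ‖∫ y : ℝ in a..b, f ((T : ℝ) + y * Complex.I)‖ ≤ C * Real.exp (-κ * T) * |b - a| := by
      refine intervalIntegral.norm_integral_le_of_norm_le_const fun y hy => ?_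
      rw [uIoc_of_le hab] at hy
      simpa [abs_of_nonneg hT] using hb (T + y * Complex.I) (by simpa using ⟨hy.1.le, hy.2⟩)
    have e2 : ‖∫ y : ℝ in a..b, f ((-T : ℝ) + y * Complex.I)‖ ≤
        C * Real.exp (-κ * T) * |b - a| := by
      refine intervalIntegral.norm_integral_le_of_norm_le_const fun y hy => ?_
      rw [uIoc_of_le hab] at hy
      simpa [abs_of_nonneg hT] using hb ((-T : ℝ) + y * Complex.I) (by simpa using ⟨hy.1.le, hy.2⟩)
    have h2 : (∫ x in (-T)..T, f (x + a * Complex.I)) - ∫ x in (-T)..T, f (x + b * Complex.I) =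
        Complex.I • (∫ y : ℝ in a..b, f ((-T : ℝ) + y * Complex.I)) -
        Complex.I • (∫ y : ℝ in a..b, f ((T : ℝ) + y * Complex.I)) := by
      linear_combination h
    rw [h2]
    refine (norm_sub_le _ _).trans ?_
    rw [norm_smul, norm_smul, Complex.norm_I]
    linarith
  refine sub_eq_zero.1 (tendsto_nhds_unique (la.sub lb) (squeeze_zero_norm'
    ((eventually_ge_atTop 0).mono fun T hT => key T hT) ?_))
  have : Tendsto (fun T : ℝ => Real.exp (-κ * T)) atTop (𝓝 0) :=
    Real.tendsto_exp_atBot.comp (tendsto_id.const_mul_atTop_of_neg (neg_lt_zero.2 hκ))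
  simpa using ((this.const_mul C).mul_const |b - a|).const_mul 2

theorem cosh_le_exp_abs (x : ℝ) : Real.cosh x ≤ Real.exp |x| := by
  rw [← Real.cosh_abs, Real.cosh_eq]
  have : Real.exp (-|x|) ≤ Real.exp |x| := Real.exp_le_exp.2 (by linarith [abs_nonneg x])
  linarith

theorem exp_abs_le_two_mul_cosh (x : ℝ) : Real.exp |x| ≤ 2 * Real.cosh x := by
  rw [← Real.cosh_abs, Real.cosh_eq]
  have := Real.exp_pos (-|x|)
  linarith

theorem exp_abs_le_four_mul_abs_sinh {x : ℝ} (hx : 1 ≤ |x|) : Real.exp |x| ≤ 4 * |Real.sinh x| := by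
  rw [Real.abs_sinh, Real.sinh_eq]
  have h1 : Real.exp (-|x|) ≤ 1 := Real.exp_le_one_iff.2 (by linarith)
  have h2 := Real.add_one_le_exp |x|
  linarith

/-- The bounds below on sinh all come from this: dropping either square bounds the modulus from
below, through the real part alone or uniformly away from the zeros of the sine. -/
theorem Complex.normSq_sinh (z : ℂ) :
    ‖Complex.sinh z‖ ^ 2 = Real.sinh z.re ^ 2 + Real.sin z.im ^ 2 := by
  conv_lhs => rw [← Complex.re_add_im z, Complex.sinh_add, Complex.sinh_mul_I, Complex.cosh_mul_I,
    ← Complex.ofReal_sinh, ← Complex.ofReal_cosh, ← Complex.ofReal_sin, ← Complex.ofReal_cos]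
  rw [← Complex.normSq_eq_norm_sq, Complex.normSq_apply]
  simp only [Complex.add_re, Complex.add_im, Complex.mul_re, Complex.mul_im, Complex.ofReal_re,
    Complex.ofReal_im, Complex.I_re, Complex.I_im]
  linear_combination Real.sinh z.re ^ 2 * Real.sin_sq_add_cos_sq z.im +
    Real.sin z.im ^ 2 * Real.cosh_sq z.re

theorem Complex.normSq_cosh (z : ℂ) :
    ‖Complex.cosh z‖ ^ 2 = Real.sinh z.re ^ 2 + Real.cos z.im ^ 2 := by
  conv_lhs => rw [← Complex.re_add_im z, Complex.cosh_add, Complex.sinh_mul_I, Complex.cosh_mul_I,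
    ← Complex.ofReal_sinh, ← Complex.ofReal_cosh, ← Complex.ofReal_sin, ← Complex.ofReal_cos]
  rw [← Complex.normSq_eq_norm_sq, Complex.normSq_apply]
  simp only [Complex.add_re, Complex.add_im, Complex.mul_re, Complex.mul_im, Complex.ofReal_re,
    Complex.ofReal_im, Complex.I_re, Complex.I_im]
  linear_combination Real.sinh z.re ^ 2 * Real.sin_sq_add_cos_sq z.im +
    Real.cos z.im ^ 2 * Real.cosh_sq z.re

theorem abs_sin_mul_cosh_le_norm_sinh (z : ℂ) :
    |Real.sin z.im| * Real.cosh z.re ≤ ‖Complex.sinh z‖ := by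
  refine abs_le_of_sq_le_sq' ?_ (norm_nonneg _) |>.2
  rw [Complex.normSq_sinh, mul_pow, sq_abs, Real.cosh_sq]
  nlinarith [Real.sin_sq_add_cos_sq z.im, sq_nonneg (Real.cos z.im * Real.sinh z.re)]

theorem abs_sinh_le_norm_sinh (z : ℂ) : |Real.sinh z.re| ≤ ‖Complex.sinh z‖ := by
  refine abs_le_of_sq_le_sq' ?_ (norm_nonneg _) |>.2
  rw [Complex.normSq_sinh, sq_abs]
  nlinarith [sq_nonneg (Real.sin z.im)]

theorem abs_sinh_le_norm_cosh (z : ℂ) : |Real.sinh z.re| ≤ ‖Complex.cosh z‖ := by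
  refine abs_le_of_sq_le_sq' ?_ (norm_nonneg _) |>.2
  rw [Complex.normSq_cosh, sq_abs]
  nlinarith [sq_nonneg (Real.cos z.im)]

theorem norm_sinh_le_exp_abs (z : ℂ) : ‖Complex.sinh z‖ ≤ Real.exp |z.re| := by
  have h : ‖Complex.sinh z‖ ≤ Real.cosh z.re := by
    refine abs_le_of_sq_le_sq' ?_ (Real.cosh_pos _).le |>.2
    rw [Complex.normSq_sinh, Real.cosh_sq]
    nlinarith [Real.sin_sq_add_cos_sq z.im, sq_nonneg (Real.cos z.im)]
  exact h.trans (cosh_le_exp_abs _)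

theorem norm_cosh_le_exp_abs (z : ℂ) : ‖Complex.cosh z‖ ≤ Real.exp |z.re| := by
  have h : ‖Complex.cosh z‖ ≤ Real.cosh z.re := by
    refine abs_le_of_sq_le_sq' ?_ (Real.cosh_pos _).le |>.2
    rw [Complex.normSq_cosh, Real.cosh_sq]
    nlinarith [Real.sin_sq_add_cos_sq z.im, sq_nonneg (Real.sin z.im)]
  exact h.trans (cosh_le_exp_abs _)

theorem sinh_ne_zero_of_sin_ne_zero {z : ℂ} (hz : Real.sin z.im ≠ 0) : Complex.sinh z ≠ 0 := by
  intro h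
  have := abs_sin_mul_cosh_le_norm_sinh z
  rw [h, norm_zero] at this
  exact this.not_gt (mul_pos (abs_pos.2 hz) (Real.cosh_pos _))

theorem sinh_ne_zero_of_re_ne_zero {z : ℂ} (hz : z.re ≠ 0) : Complex.sinh z ≠ 0 := by
  intro h
  have := abs_sinh_le_norm_sinh z
  rw [h, norm_zero] at this
  exact this.not_gt (abs_pos.2 (by simpa using hz))

theorem norm_inv_sinh_le {z : ℂ} {s : ℝ} (hs : 0 < s) (hz : s ≤ |Real.sin z.im|) :
    ‖(Complex.sinh z)⁻¹‖ ≤ 2 / s * Real.exp (-|z.re|) := by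
  rw [norm_inv, Real.exp_neg, ← div_eq_mul_inv, div_div, ← one_div,
    div_le_div_iff₀ (norm_pos_iff.2 (sinh_ne_zero_of_sin_ne_zero (abs_pos.1 (hs.trans_le hz))))
      (by positivity), one_mul]
  have h1 := abs_sin_mul_cosh_le_norm_sinh z
  have h2 := exp_abs_le_two_mul_cosh z.re
  have h3 := Real.cosh_pos z.re
  nlinarith [mul_le_mul_of_nonneg_right hz h3.le, Real.exp_pos |z.re|]

theorem integrable_inv_cosh : Integrable fun t : ℝ => (Real.cosh t)⁻¹ := by
  refine ((integrable_exp_neg_mul_abs one_pos).const_mul 2).mono' (by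
    have : Continuous fun t : ℝ => (Real.cosh t)⁻¹ :=
      Real.continuous_cosh.inv₀ fun t => (Real.cosh_pos t).ne'
    exact this.aestronglyMeasurable) (Eventually.of_forall fun x => ?_)
  rw [Real.norm_of_nonneg (inv_nonneg.2 (Real.cosh_pos x).le), neg_one_mul, Real.exp_neg,
    ← div_eq_mul_inv, inv_eq_one_div, div_le_div_iff₀ (Real.cosh_pos x) (Real.exp_pos _)]
  linarith [exp_abs_le_two_mul_cosh x]

/-- A primitive is the Gudermannian function arctan ∘ sinh, which runs from -π/2 to π/2. -/
theorem integral_inv_cosh : ∫ t : ℝ, (Real.cosh t)⁻¹ = Real.pi := by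
  have h : ∀ x : ℝ, HasDerivAt (fun t => Real.arctan (Real.sinh t)) (Real.cosh x)⁻¹ x := by
    intro x
    convert (Real.hasDerivAt_sinh x).arctan using 1
    rw [add_comm, ← Real.cosh_sq]
    field_simp [(Real.cosh_pos x).ne']
  have htop : Tendsto Real.sinh atTop atTop := Real.sinh_strictMono.monotone.tendsto_atTop_atTop
    fun b => ⟨Real.arsinh b, by simp⟩
  have hbot : Tendsto Real.sinh atBot atBot := Real.sinh_strictMono.monotone.tendsto_atBot_atBot
    fun b => ⟨Real.arsinh b, by simp⟩
  rw [integral_of_hasDerivAt_of_tendsto h integrable_inv_cosh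
    ((tendsto_nhds_of_tendsto_nhdsWithin Real.tendsto_arctan_atBot).comp hbot)
    ((tendsto_nhds_of_tendsto_nhdsWithin Real.tendsto_arctan_atTop).comp htop)]
  ring

/-- For 0 < y < π the line can be moved to Im = π/2, where sinh (x + iπ/2) = i cosh x. Together with
its mirror image for negative y, this is the model for a simple pole: the two values differ by 2πi.
-/
theorem integral_inv_sinh_of_pos {y : ℝ} (hy0 : 0 < y) (hy : y < Real.pi) :
    ∫ x : ℝ, (Complex.sinh (x + y * Complex.I))⁻¹ = -(Real.pi * Complex.I) := by
  have hs0 := Real.sin_pos_of_pos_of_lt_pi hy0 hy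
  have hmid : ∫ x : ℝ, (Complex.sinh (x + (Real.pi / 2 : ℝ) * Complex.I))⁻¹ =
      -(Real.pi * Complex.I) := by
    have hpi : (Real.pi : ℂ) = ∫ t : ℝ, (((Real.cosh t)⁻¹ : ℝ) : ℂ) := by
      rw [integral_complex_ofReal, integral_inv_cosh]
    rw [hpi, ← integral_mul_const, ← integral_neg]
    congr 1 with x
    rw [Complex.sinh_add, Complex.sinh_mul_I, Complex.cosh_mul_I, ← Complex.ofReal_cos,
      ← Complex.ofReal_sin, Real.cos_pi_div_two, Real.sin_pi_div_two]
    simp [Complex.inv_I, mul_comm]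
  have hsin : ∀ t ∈ uIcc y (Real.pi / 2), Real.sin y ≤ |Real.sin t| := by
    intro t ht
    refine le_trans ?_ (le_abs_self _)
    rcases le_total y (Real.pi / 2) with h | h
    · rw [uIcc_of_le h] at ht
      exact Real.sin_le_sin_of_le_of_le_pi_div_two (by linarith) ht.2 ht.1
    · rw [uIcc_of_ge h] at ht
      rw [← Real.sin_pi_sub y, ← Real.sin_pi_sub t]
      exact Real.sin_le_sin_of_le_of_le_pi_div_two (by linarith) (by linarith [ht.1])
        (by linarith [ht.2])
  have hd : DifferentiableOn ℂ (fun z => (Complex.sinh z)⁻¹) {z | z.im ∈ uIcc y (Real.pi / 2)} :=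
    Complex.differentiable_sinh.differentiableOn.inv fun z hz =>
      sinh_ne_zero_of_sin_ne_zero (abs_pos.1 (hs0.trans_le (hsin _ hz)))
  have hb : ∀ z : ℂ, z.im ∈ uIcc y (Real.pi / 2) →
      ‖(Complex.sinh z)⁻¹‖ ≤ 2 / Real.sin y * Real.exp (-1 * |z.re|) := fun z hz => by
    rw [neg_one_mul]
    exact norm_inv_sinh_le hs0 (hsin _ hz)
  rcases le_total y (Real.pi / 2) with h | h
  · rw [uIcc_of_le h] at hd hb
    rw [← hmid, integral_line_eq_of_differentiableOn h one_pos hd hb]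
  · rw [uIcc_of_ge h] at hd hb
    rw [← hmid, integral_line_eq_of_differentiableOn h one_pos hd hb]

theorem integral_inv_sinh_of_neg {y : ℝ} (hy0 : y < 0) (hy : -Real.pi < y) :
    ∫ x : ℝ, (Complex.sinh (x + y * Complex.I))⁻¹ = Real.pi * Complex.I := by
  have h := integral_inv_sinh_of_pos (y := -y) (by linarith) (by linarith)
  rw [← integral_neg_eq_self, ← neg_inj, ← h, ← integral_neg]
  congr 1 with x
  rw [← inv_neg, ← Complex.sinh_neg]
  congr 2
  push_cast
  ring

/-- A function which decays exponentially at the two ends of a strip, and is continuous on it,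
is bounded by an exponential on the whole strip. -/
theorem exists_exp_bound_of_continuousOn {f : ℂ → ℂ} {a b C κ R : ℝ}
    (hf : ContinuousOn f {z | z.im ∈ Icc a b})
    (hb : ∀ z : ℂ, z.im ∈ Icc a b → R ≤ |z.re| → ‖f z‖ ≤ C * Real.exp (-κ * |z.re|)) :
    ∃ C', ∀ z : ℂ, z.im ∈ Icc a b → ‖f z‖ ≤ C' * Real.exp (-κ * |z.re|) := by
  have hK : IsCompact (Icc (-R) R ×ℂ Icc a b) := isCompact_Icc.reProdIm isCompact_Icc
  obtain ⟨M, hM⟩ := hK.exists_bound_of_continuousOn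
    (f := fun z : ℂ => f z * (Real.exp (κ * |z.re|) : ℂ))
    ((hf.mono fun z hz => hz.2).mul (by fun_prop))
  refine ⟨max C M, fun z hz => ?_⟩
  rcases le_or_gt R |z.re| with h | h
  · exact (hb z hz h).trans (by gcongr; exact le_max_left _ _)
  · have := hM z ⟨⟨(abs_lt.1 h).1.le, (abs_lt.1 h).2.le⟩, hz⟩
    rw [norm_mul, Complex.norm_real, Real.norm_of_nonneg (Real.exp_pos _).le] at this
    calc ‖f z‖ = ‖f z‖ * Real.exp (κ * |z.re|) * Real.exp (-κ * |z.re|) := by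
          rw [mul_assoc, ← Real.exp_add]; simp
      _ ≤ M * Real.exp (-κ * |z.re|) := by gcongr
      _ ≤ _ := by gcongr; exact le_max_right _ _

theorem tendsto_sub_mul_div_of_hasDerivAt {g h : ℂ → ℂ} {c d : ℂ} (hg : ContinuousAt g c)
    (hh : HasDerivAt h d c) (h0 : h c = 0) (hd : d ≠ 0) :
    Tendsto (fun z => (z - c) * (g z / h z)) (𝓝[≠] c) (𝓝 (g c / d)) := by
  have h2 := (hg.mono_left nhdsWithin_le_nhds).mul (hh.tendsto_slope.inv₀ hd)
  refine (h2.congr fun z => ?_ : Tendsto _ (𝓝[≠] c) (𝓝 (g c * d⁻¹)))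
  rw [slope_def_field, h0, sub_zero, inv_div]
  ring

/-- The residue theorem for an infinite horizontal strip and one simple pole. -/
theorem integral_line_sub_integral_line_eq {f : ℂ → ℂ} {c r : ℂ} {a b C κ R : ℝ}
    (hac : a < c.im) (hcb : c.im < b) (hκ : 0 < κ)
    (hf : DifferentiableOn ℂ f ({z | z.im ∈ Icc a b} \ {c}))
    (hr : Tendsto (fun z => (z - c) * f z) (𝓝[≠] c) (𝓝 r))
    (hb : ∀ z : ℂ, z.im ∈ Icc a b → R ≤ |z.re| → ‖f z‖ ≤ C * Real.exp (-κ * |z.re|)) :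
    (∫ x : ℝ, f (x + a * Complex.I)) - ∫ x : ℝ, f (x + b * Complex.I) =
      2 * Real.pi * Complex.I * r := by
  -- With this k the function sinh (k (z - c)) has no zero but c in the strip, since k |Im (z - c)|
  -- < π/2 there. The pole is removed by subtracting m = r k / sinh (k (z - c)), which decays
  -- exponentially and whose line integrals are known.
  set k : ℝ := Real.pi / (2 * (b - a)) with hk
  have hba : 0 < b - a := by linarith
  have hk0 : 0 < k := by positivity
  have hkba : k * (b - a) = Real.pi / 2 := by rw [hk]; field_simp
  have hre : ∀ z : ℂ, (k * (z - c)).re = k * (z.re - c.re) := fun z => by simp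
  have him : ∀ z : ℂ, (k * (z - c)).im = k * (z.im - c.im) := fun z => by simp
  have hne : ∀ z : ℂ, z.im ∈ Icc a b → z ≠ c → Complex.sinh (k * (z - c)) ≠ 0 := by
    intro z hz hzc
    by_cases h : z.re = c.re
    · have h' : z.im - c.im ≠ 0 := fun h' => hzc (Complex.ext h (by linarith))
      refine sinh_ne_zero_of_sin_ne_zero ?_
      rw [him, Ne, Real.sin_eq_zero_iff_of_lt_of_lt]
      · exact mul_ne_zero hk0.ne' h'
      · nlinarith [hz.1, hz.2, Real.pi_pos]
      · nlinarith [hz.1, hz.2, Real.pi_pos]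
    · refine sinh_ne_zero_of_re_ne_zero ?_
      rw [hre]
      exact mul_ne_zero hk0.ne' (sub_ne_zero.2 h)
  set m : ℂ → ℂ := fun z => r * (k / Complex.sinh (k * (z - c))) with hm
  have hmd : DifferentiableOn ℂ m ({z | z.im ∈ Icc a b} \ {c}) := by
    refine DifferentiableOn.const_mul (DifferentiableOn.div (by fun_prop) ?_ fun z hz =>
      hne z hz.1 hz.2) _
    exact (Complex.differentiable_sinh.comp (by fun_prop :
      Differentiable ℂ fun z : ℂ => (k : ℂ) * (z - c))).differentiableOn
  have hmb : ∀ z : ℂ, |c.re| + 1 / k ≤ |z.re| →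
      ‖m z‖ ≤ ‖r‖ * (k * (4 * Real.exp (k * |c.re|))) * Real.exp (-k * |z.re|) := by
    intro z hz
    have h1 : |z.re| - |c.re| ≤ |z.re - c.re| := abs_sub_abs_le_abs_sub _ _
    have h2 : |(k * (z - c)).re| = k * |z.re - c.re| := by rw [hre, abs_mul, abs_of_pos hk0]
    have h3 : 1 ≤ |(k * (z - c)).re| := by
      rw [h2, ← div_le_iff₀' hk0]
      linarith
    have h4 := (exp_abs_le_four_mul_abs_sinh h3).trans
      (mul_le_mul_of_nonneg_left (abs_sinh_le_norm_sinh _) (by norm_num))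
    have h5 : 0 < ‖Complex.sinh (k * (z - c))‖ := by
      have := Real.exp_pos |(k * (z - c)).re|
      linarith
    rw [hm]
    simp only [norm_mul, norm_div, Complex.norm_real, Real.norm_of_nonneg hk0.le]
    rw [mul_assoc]
    refine mul_le_mul_of_nonneg_left ?_ (norm_nonneg _)
    rw [mul_assoc, div_eq_mul_inv]
    refine mul_le_mul_of_nonneg_left ?_ hk0.le
    rw [inv_le_iff_one_le_mul₀' h5, mul_assoc, ← Real.exp_add]
    have h6 : 1 ≤ Real.exp |(k * (z - c)).re| * Real.exp (k * |c.re| + -k * |z.re|) := by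
      rw [← Real.exp_add]
      refine Real.one_le_exp ?_
      rw [h2]
      nlinarith
    refine h6.trans ?_
    rw [← mul_assoc, mul_comm _ (4 : ℝ)]
    gcongr
  have hrm : Tendsto (fun z => (z - c) * m z) (𝓝[≠] c) (𝓝 r) := by
    have hd : HasDerivAt (fun z => Complex.sinh (k * (z - c))) k c := by
      simpa using ((((hasDerivAt_id c).sub_const c).const_mul (k : ℂ)).csinh)
    have := (tendsto_sub_mul_div_of_hasDerivAt (g := fun _ => k) continuousAt_const hd (by simp)
      (Complex.ofReal_ne_zero.2 hk0.ne')).const_mul r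
    rw [div_self (Complex.ofReal_ne_zero.2 hk0.ne'), mul_one] at this
    refine this.congr fun z => ?_
    rw [hm]
    ring
  set F : ℂ → ℂ := fun z => f z - m z with hF
  have hnhds : {z : ℂ | z.im ∈ Icc a b} ∈ 𝓝 c :=
    Complex.continuous_im.continuousAt.preimage_mem_nhds (Icc_mem_nhds hac hcb)
  -- Removable singularity: (z - c) (f - m) tends to r - r = 0 at c, so f - m extends
  -- holomorphically to the whole strip.
  have hG := Complex.differentiableOn_update_limUnder_of_isLittleO hnhds (hf.sub hmd) (by
    rw [Asymptotics.isLittleO_iff_tendsto']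
    · have h0 : Tendsto (fun z => (z - c) * (f z - m z) - (z - c) * (f c - m c)) (𝓝[≠] c)
          (𝓝 (r - r - (c - c) * (f c - m c))) := by
        refine Tendsto.sub ((hr.sub hrm).congr fun z => by ring) ?_
        exact ((continuous_id.sub continuous_const).mul continuous_const).continuousAt.mono_left
          nhdsWithin_le_nhds
      simp only [sub_self, zero_mul] at h0
      refine h0.congr fun z => ?_
      simp only [Pi.sub_apply, div_inv_eq_mul]
      ring
    · filter_upwards [self_mem_nhdsWithin] with z hz h
      exact absurd (inv_eq_zero.1 h) (sub_ne_zero.2 hz))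
  set G := Function.update (f - m) c (limUnder (𝓝[≠] c) (f - m)) with hGdef
  have hGF : ∀ z, z ≠ c → G z = f z - m z := fun z hz => by
    rw [hGdef, Function.update_of_ne hz]; rfl
  -- A common decay rate: f decays at the rate κ and m at the rate k.
  set κ' := min κ k
  have hκ' : 0 < κ' := lt_min hκ hk0
  have hexp : ∀ z : ℂ, ∀ l, κ' ≤ l → Real.exp (-l * |z.re|) ≤ Real.exp (-κ' * |z.re|) :=
    fun z l hl => Real.exp_le_exp.2 (by nlinarith [abs_nonneg z.re])
  set C₂ := ‖r‖ * (k * (4 * Real.exp (k * |c.re|)))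
  set R' := max R (|c.re| + 1 / k)
  have hfb' : ∀ z : ℂ, z.im ∈ Icc a b → R' ≤ |z.re| → ‖f z‖ ≤ |C| * Real.exp (-κ' * |z.re|) :=
    fun z hz hR => (hb z hz ((le_max_left _ _).trans hR)).trans
      (mul_le_mul (le_abs_self C) (hexp z κ (min_le_left _ _)) (Real.exp_pos _).le (abs_nonneg _))
  have hmb' : ∀ z : ℂ, R' ≤ |z.re| → ‖m z‖ ≤ C₂ * Real.exp (-κ' * |z.re|) :=
    fun z hR => (hmb z ((le_max_right _ _).trans hR)).trans
      (mul_le_mul_of_nonneg_left (hexp z k (min_le_right _ _)) (by positivity))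
  have hRc : ∀ z : ℂ, R' ≤ |z.re| → z ≠ c := by
    rintro z hR rfl
    have : 0 < 1 / k := by positivity
    linarith [le_max_right R (|z.re| + 1 / k)]
  obtain ⟨C', hC'⟩ := exists_exp_bound_of_continuousOn hG.continuousOn
    (C := |C| + C₂) (κ := κ') (R := R') (fun z hz hR => by
      rw [hGF z (hRc z hR), add_mul]
      exact (norm_sub_le _ _).trans (add_le_add (hfb' z hz hR) (hmb' z hR)))
  have hline := integral_line_eq_of_differentiableOn (hac.trans hcb).le hκ' hG hC'
  have hsplit : ∀ y ∈ Icc a b, y ≠ c.im → ∫ x : ℝ, f (x + y * Complex.I) =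
      (∫ x : ℝ, G (x + y * Complex.I)) + ∫ x : ℝ, m (x + y * Complex.I) := by
    intro y hy hyc
    have hc : ∀ x : ℝ, (x + y * Complex.I : ℂ) ≠ c := fun x h => hyc (by rw [← h]; simp)
    have hmc : ContinuousOn m {z | z.im ∈ ({y} : Set ℝ)} :=
      hmd.continuousOn.mono fun z hz => by
        have hz' : z.im = y := hz
        exact ⟨by rw [mem_ofPred_eq, hz']; exact hy, fun h => hyc (by rw [← hz', h])⟩
    obtain ⟨C₃, hC₃⟩ := exists_exp_bound_of_continuousOn (a := y) (b := y) (f := m) (C := C₂)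
      (κ := κ') (R := R') (by rwa [Icc_self]) (fun z _ hR => hmb' z hR)
    rw [← integral_add (integrable_comp_line hκ' hG.continuousOn hy hC')
      (integrable_comp_line hκ' hmc rfl fun z hz => hC₃ z (by rwa [Icc_self]))]
    congr 1 with x
    rw [hGF _ (hc x)]
    ring
  -- The substitution by k (x - Re c) absorbs the factor k and puts the line at height k (y - Im c),
  -- below or above 0 according to the side of the pole.
  have hmint : ∀ y : ℝ, ∫ x : ℝ, m (x + y * Complex.I) =
      r * ∫ x : ℝ, (Complex.sinh (x + (k * (y - c.im) : ℝ) * Complex.I))⁻¹ := by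
    intro y
    have h1 := Measure.integral_comp_mul_left
      (fun x : ℝ => (Complex.sinh (x + (k * (y - c.im) : ℝ) * Complex.I))⁻¹) k
    have h2 := integral_sub_right_eq_self (μ := volume) (fun x : ℝ =>
      (Complex.sinh ((k * x : ℝ) + (k * (y - c.im) : ℝ) * Complex.I))⁻¹) c.re
    rw [h1, abs_inv, abs_of_pos hk0] at h2
    rw [hm, integral_const_mul]
    congr 1
    simp only [div_eq_mul_inv]
    rw [integral_const_mul]
    have h3 : ∀ x : ℝ, (k : ℂ) * (x + y * Complex.I - c) =
        ((k * (x - c.re) : ℝ) + (k * (y - c.im) : ℝ) * Complex.I) := by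
      intro x
      conv_lhs => rw [← Complex.re_add_im c]
      push_cast
      ring
    simp only [h3]
    rw [h2, Complex.real_smul, ← mul_assoc]
    push_cast
    rw [mul_inv_cancel₀ (Complex.ofReal_ne_zero.2 hk0.ne'), one_mul]
  have hab := hac.trans hcb
  rw [hsplit a (left_mem_Icc.2 hab.le) hac.ne, hsplit b (right_mem_Icc.2 hab.le) hcb.ne', hline,
    hmint, hmint, integral_inv_sinh_of_neg, integral_inv_sinh_of_pos]
  · ring
  all_goals nlinarith [Real.pi_pos]

end

/-! ### One-dimensional integrals with 1/cosh (π t / ζ) -/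

section

open Set

theorem norm_inv_cosh_le {z : ℂ} (hz : 1 ≤ |z.re|) :
    ‖(Complex.cosh z)⁻¹‖ ≤ 4 * Real.exp (-|z.re|) := by
  have h := (exp_abs_le_four_mul_abs_sinh hz).trans
    (mul_le_mul_of_nonneg_left (abs_sinh_le_norm_cosh z) (by norm_num))
  have h0 := Real.exp_pos |z.re|
  rw [norm_inv, Real.exp_neg, ← div_eq_mul_inv, ← one_div,
    div_le_div_iff₀ (by linarith) h0]
  linarith

theorem norm_cosh_div_sinh_le {z : ℂ} (hz : 1 ≤ |z.re|) :
    ‖Complex.cosh z / Complex.sinh z‖ ≤ 4 := by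
  have h := (exp_abs_le_four_mul_abs_sinh hz).trans
    (mul_le_mul_of_nonneg_left (abs_sinh_le_norm_sinh z) (by norm_num))
  have h0 := Real.exp_pos |z.re|
  rw [norm_div, div_le_iff₀ (by linarith)]
  exact (norm_cosh_le_exp_abs z).trans h

theorem cosh_ne_zero_of_cos_ne_zero {z : ℂ} (hz : Real.cos z.im ≠ 0) : Complex.cosh z ≠ 0 := by
  intro h
  have := Complex.normSq_cosh z
  rw [h, norm_zero] at this
  have := pow_pos (abs_pos.2 hz) 2
  rw [sq_abs] at this
  nlinarith [sq_nonneg (Real.sinh z.re)]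

theorem cosh_ne_zero_of_re_ne_zero {z : ℂ} (hz : z.re ≠ 0) : Complex.cosh z ≠ 0 := by
  intro h
  have := abs_sinh_le_norm_cosh z
  rw [h, norm_zero] at this
  exact this.not_gt (abs_pos.2 (by simpa using hz))

theorem integral_inv_cosh_mul {p : ℝ} (hp : 0 < p) :
    ∫ t : ℝ, (Real.cosh (p * t))⁻¹ = Real.pi / p := by
  rw [Measure.integral_comp_mul_left (fun t => (Real.cosh t)⁻¹) p, integral_inv_cosh,
    abs_of_pos (inv_pos.2 hp), smul_eq_mul, div_eq_inv_mul]

theorem integrable_inv_cosh_mul {p : ℝ} (hp : 0 < p) :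
    Integrable fun t : ℝ => (Real.cosh (p * t))⁻¹ :=
  integrable_inv_cosh.comp_mul_left' hp.ne'

theorem inv_cosh_le (x : ℝ) : (Real.cosh x)⁻¹ ≤ 2 * Real.exp (-|x|) := by
  rw [Real.exp_neg, ← div_eq_mul_inv, inv_eq_one_div,
    div_le_div_iff₀ (Real.cosh_pos x) (Real.exp_pos _)]
  linarith [exp_abs_le_two_mul_cosh x]

theorem integral_inv_cosh_sq {p : ℝ} (hp : 0 < p) :
    ∫ t : ℝ, ((Real.cosh (p * t))⁻¹) ^ 2 = 2 / p := by
  -- The primitive of 1/cosh² is tanh; this form makes its limit at infinity visible.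
  have h1 : ∀ x : ℝ, Real.tanh x = 1 - 2 * (Real.exp (2 * x) + 1)⁻¹ := by
    intro x
    rw [Real.tanh_eq_sinh_div_cosh, Real.sinh_eq, Real.cosh_eq, Real.exp_neg, two_mul x,
      Real.exp_add]
    have := Real.exp_pos x
    field_simp
    ring
  have htop : Tendsto Real.tanh atTop (𝓝 1) := by
    have : Tendsto (fun x : ℝ => 1 - 2 * (Real.exp (2 * x) + 1)⁻¹) atTop (𝓝 (1 - 2 * 0)) :=
      (((tendsto_atTop_add_const_right _ _ (Real.tendsto_exp_atTop.comp
        (tendsto_id.const_mul_atTop two_pos))).inv_tendsto_atTop).const_mul 2).const_sub 1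
    simpa [← h1] using this
  have hbot : Tendsto Real.tanh atBot (𝓝 (-1)) := by
    have := (htop.comp tendsto_neg_atBot_atTop).neg
    refine this.congr fun x => ?_
    simp
  have hd : ∀ x : ℝ, HasDerivAt Real.tanh (((Real.cosh x)⁻¹) ^ 2) x := by
    intro x
    have := (Real.hasDerivAt_sinh x).div (Real.hasDerivAt_cosh x) (Real.cosh_pos x).ne'
    have e1 : Real.tanh = Real.sinh / Real.cosh := funext Real.tanh_eq_sinh_div_cosh
    have e2 : ((Real.cosh x)⁻¹) ^ 2 =
        (Real.cosh x * Real.cosh x - Real.sinh x * Real.sinh x) / Real.cosh x ^ 2 := by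
      rw [inv_pow, inv_eq_one_div]
      congr 1
      linear_combination -Real.cosh_sq x
    rwa [e1, e2]
  have hi : Integrable fun x : ℝ => ((Real.cosh x)⁻¹) ^ 2 := by
    refine integrable_inv_cosh.mono ?_ (Eventually.of_forall fun x => ?_)
    · exact ((Real.continuous_cosh.inv₀ fun t => (Real.cosh_pos t).ne').pow 2).aestronglyMeasurable
    · rw [norm_pow, sq]
      refine mul_le_of_le_one_left (norm_nonneg _) ?_
      rw [Real.norm_of_nonneg (inv_nonneg.2 (Real.cosh_pos x).le)]
      exact inv_le_one_of_one_le₀ (Real.one_le_cosh x)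
  rw [Measure.integral_comp_mul_left (fun t => ((Real.cosh t)⁻¹) ^ 2) p,
    integral_of_hasDerivAt_of_tendsto hd hi hbot htop, abs_of_pos (inv_pos.2 hp), smul_eq_mul]
  ring

theorem cosh_pi_div_mul_ne_zero {ζ : ℝ} (h0 : 0 < ζ) {z : ℂ} (hz : z.im ∈ Icc 0 ζ)
    (hne : z ≠ (ζ / 2 : ℝ) * Complex.I) : Complex.cosh ((Real.pi / ζ : ℝ) * z) ≠ 0 := by
  have hp : 0 < Real.pi / ζ := by positivity
  by_cases h : z.re = 0
  · refine cosh_ne_zero_of_cos_ne_zero fun hc => hne (Complex.ext (by simpa using h) ?_)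
    rw [Complex.im_ofReal_mul, ← Real.cos_pi_div_two] at hc
    have := Real.injOn_cos (by
      refine ⟨mul_nonneg hp.le hz.1, ?_⟩
      rw [div_mul_eq_mul_div, div_le_iff₀ h0]
      exact mul_le_mul_of_nonneg_left hz.2 Real.pi_pos.le) (by
      constructor <;> linarith [Real.pi_pos]) hc
    field_simp at this
    simp
    linarith
  · refine cosh_ne_zero_of_re_ne_zero ?_
    rw [Complex.re_ofReal_mul]
    exact mul_ne_zero hp.ne' h

theorem hasDerivAt_cosh_mul (p : ℝ) (c : ℂ) :
    HasDerivAt (fun z => Complex.cosh (p * z)) (p * Complex.sinh (p * c)) c := by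
  simpa [mul_comm] using ((hasDerivAt_id c).const_mul (p : ℂ)).ccosh

theorem norm_exp_div_cosh_le {p : ℝ} (hp : 2 < p) (t : ℝ) :
    ‖Real.exp ((2 - p) * t) / Real.cosh (p * t)‖ ≤ 2 * Real.exp (-2 * |t|) := by
  rw [norm_div, Real.norm_of_nonneg (Real.exp_pos _).le, Real.norm_of_nonneg (Real.cosh_pos _).le,
    div_eq_mul_inv]
  calc _ ≤ Real.exp ((p - 2) * |t|) * (2 * Real.exp (-|p * t|)) := by
        refine mul_le_mul (Real.exp_le_exp.2 ?_) (inv_cosh_le _)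
          (inv_nonneg.2 (Real.cosh_pos _).le) (Real.exp_pos _).le
        nlinarith [neg_abs_le t]
    _ = _ := by
        rw [mul_left_comm, ← Real.exp_add, abs_mul, abs_of_pos (by linarith : 0 < p)]
        ring_nf

theorem integrable_exp_div_cosh {p : ℝ} (hp : 2 < p) :
    Integrable fun t : ℝ => Real.exp ((2 - p) * t) / Real.cosh (p * t) :=
  ((integrable_exp_neg_mul_abs two_pos).const_mul 2).mono' (Continuous.aestronglyMeasurable
    (Continuous.div (by fun_prop) (by fun_prop) fun t => (Real.cosh_pos _).ne'))
    (Eventually.of_forall (norm_exp_div_cosh_le hp))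

/-- With p = π/ζ the translation by iζ changes the sign of cosh (p z) and multiplies the integrand
by exp (2iζ), so the residue at iζ/2, the only pole with 0 ≤ Im z ≤ ζ, determines the integral. The
exponent 2 - p, and not 2, is chosen for the next integral, of which this function is nearly a
primitive. -/
theorem integral_exp_div_cosh {ζ : ℝ} (h0 : 0 < ζ) (h1 : ζ < Real.pi / 2) :
    ∫ t : ℝ, Real.exp ((2 - Real.pi / ζ) * t) / Real.cosh (Real.pi / ζ * t) = ζ / Real.sin ζ := by
  set p := Real.pi / ζ with hp
  have hp2 : 2 < p := by rw [hp, lt_div_iff₀ h0]; linarith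
  have hpζ : p * ζ = Real.pi := by rw [hp]; field_simp
  have hs : 0 < Real.sin ζ := Real.sin_pos_of_pos_of_lt_pi h0 (by linarith [Real.pi_pos])
  set f : ℂ → ℂ := fun z => Complex.exp ((2 - p) * z) / Complex.cosh (p * z) with hf
  have hperiod : ∀ z, f (z + ζ * Complex.I) =
      Complex.exp (ζ * Complex.I) * Complex.exp (ζ * Complex.I) * f z := by
    intro z
    have e : (p * (z + ζ * Complex.I) : ℂ) = p * z + Real.pi * Complex.I := by
      rw [← hpζ]; push_cast; ring
    have e' : ((2 - p) * (z + ζ * Complex.I) : ℂ) =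
        ζ * Complex.I + ζ * Complex.I + (2 - p) * z - Real.pi * Complex.I := by
      rw [← hpζ]; push_cast; ring
    simp only [hf]
    rw [e, e', Complex.cosh_add, Complex.cosh_mul_I, Complex.sinh_mul_I, Complex.exp_sub,
      Complex.exp_pi_mul_I, Complex.exp_add, Complex.exp_add]
    simp
    ring
  have hc : (p * ((ζ / 2 : ℝ) * Complex.I) : ℂ) = (Real.pi / 2 : ℝ) * Complex.I := by
    rw [← hpζ]; push_cast; ring
  have hs1 : Complex.sinh (p * ((ζ / 2 : ℝ) * Complex.I)) = Complex.I := by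
    rw [hc, Complex.sinh_mul_I, ← Complex.ofReal_sin, Real.sin_pi_div_two]; simp
  have hc1 : Complex.cosh (p * ((ζ / 2 : ℝ) * Complex.I)) = 0 := by
    rw [hc, Complex.cosh_mul_I, ← Complex.ofReal_cos, Real.cos_pi_div_two]; simp
  have hp0 : (p : ℂ) ≠ 0 := Complex.ofReal_ne_zero.2 (by linarith)
  have hres := integral_line_sub_integral_line_eq (f := f) (c := (ζ / 2 : ℝ) * Complex.I)
    (r := -Complex.exp (ζ * Complex.I) / p) (a := 0) (b := ζ) (C := 4) (κ := 2) (R := 1)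
    (by simp; linarith) (by simp; linarith) (by norm_num) ?_ ?_ ?_
  · have e1 : ∀ x : ℝ, f (x + (0 : ℝ) * Complex.I) =
        ((Real.exp ((2 - p) * x) / Real.cosh (p * x) : ℝ) : ℂ) := by
      intro x; simp [hf]
    simp only [hperiod, integral_const_mul] at hres
    have e2 : ∀ x : ℝ, f x = ((Real.exp ((2 - p) * x) / Real.cosh (p * x) : ℝ) : ℂ) := by
      intro x; simp [hf]
    simp only [e1, e2, integral_complex_ofReal] at hres
    rw [eq_div_iff hs.ne', ← Complex.ofReal_inj]
    set E := Complex.exp (ζ * Complex.I) with hE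
    have hE0 : E ≠ 0 := Complex.exp_ne_zero _
    have hsin : ((Real.sin ζ : ℝ) : ℂ) = (E⁻¹ - E) * Complex.I / 2 := by
      rw [Complex.ofReal_sin, Complex.sin, hE, ← Complex.exp_neg, neg_mul]
    have hpi : (Real.pi : ℂ) = p * ζ := by rw [← hpζ]; push_cast; ring
    rw [Complex.ofReal_mul, hsin]
    rw [hpi] at hres
    field_simp at hres ⊢
    linear_combination (Complex.I) * hres - 2 * ζ * E * Complex.I_sq
  · refine DifferentiableOn.div (by fun_prop) (fun z _ =>
      (hasDerivAt_cosh_mul p z).differentiableAt.differentiableWithinAt) fun z hz => ?_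
    exact cosh_pi_div_mul_ne_zero h0 hz.1 hz.2
  · have := tendsto_sub_mul_div_of_hasDerivAt (c := (ζ / 2 : ℝ) * Complex.I)
      (g := fun z => Complex.exp ((2 - p) * z)) (by fun_prop)
      (hasDerivAt_cosh_mul p _) hc1 (by rw [hs1]; exact mul_ne_zero hp0 Complex.I_ne_zero)
    convert this using 2
    have e : ((2 - p) * ((ζ / 2 : ℝ) * Complex.I) : ℂ) =
        ζ * Complex.I - (Real.pi / 2 : ℝ) * Complex.I := by
      rw [← hpζ]; push_cast; ring
    rw [hs1, e, Complex.exp_sub, Complex.exp_mul_I ((Real.pi / 2 : ℝ) : ℂ), ← Complex.ofReal_cos,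
      ← Complex.ofReal_sin, Real.cos_pi_div_two, Real.sin_pi_div_two]
    have := Complex.I_ne_zero
    simp
    field_simp
  · intro z _ hz
    have h3 : |((p : ℂ) * z).re| = p * |z.re| := by
      rw [Complex.re_ofReal_mul, abs_mul, abs_of_pos (by linarith)]
    have h4 := norm_inv_cosh_le (z := (p : ℂ) * z) (by rw [h3]; nlinarith)
    rw [hf]
    simp only []
    rw [div_eq_mul_inv, norm_mul, Complex.norm_exp]
    calc _ ≤ Real.exp ((p - 2) * |z.re|) * (4 * Real.exp (-(p * |z.re|))) := by
          rw [h3] at h4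
          refine mul_le_mul (Real.exp_le_exp.2 ?_) h4 (norm_nonneg _) (Real.exp_pos _).le
          have : ((2 - p : ℂ) * z).re = (2 - p) * z.re := by
            rw [← Complex.re_ofReal_mul]; simp
          rw [this]
          nlinarith [neg_abs_le z.re]
      _ = _ := by
          rw [mul_left_comm, ← Real.exp_add]
          ring_nf

theorem integrable_exp_mul_inv_cosh_sq {p : ℝ} (hp : 2 < p) :
    Integrable fun t : ℝ => Real.exp (2 * t) * ((Real.cosh (p * t))⁻¹) ^ 2 := by
  refine ((integrable_exp_neg_mul_abs two_pos).const_mul 4).mono' (Continuous.aestronglyMeasurable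
    (Continuous.mul (by fun_prop) (Continuous.pow (Continuous.inv₀ (by fun_prop)
      fun t => (Real.cosh_pos _).ne') 2))) (Eventually.of_forall fun t => ?_)
  rw [Real.norm_of_nonneg (by positivity)]
  have h := inv_cosh_le (p * t)
  rw [abs_mul, abs_of_pos (by linarith : 0 < p)] at h
  calc _ ≤ Real.exp (2 * |t|) * (2 * Real.exp (-(p * |t|))) ^ 2 := by
        gcongr
        · exact le_abs_self t
    _ = 4 * Real.exp (2 * |t| + (-(p * |t|) + -(p * |t|))) := by
        rw [Real.exp_add, Real.exp_add]; ring
    _ ≤ _ := by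
        gcongr
        nlinarith [abs_nonneg t]

/-- Let F be the integrand of `integral_exp_div_cosh`. As cosh + sinh = exp, its derivative is 2 F -
p exp (2t) / cosh² (p t). Since F vanishes at both ends, the integral sought is 2/p times that of F.
-/
theorem integral_exp_mul_inv_cosh_sq {ζ : ℝ} (h0 : 0 < ζ) (h1 : ζ < Real.pi / 2) :
    ∫ t : ℝ, Real.exp (2 * t) * ((Real.cosh (Real.pi / ζ * t))⁻¹) ^ 2 =
      2 * ζ ^ 2 / (Real.pi * Real.sin ζ) := by
  have hF := integral_exp_div_cosh h0 h1
  set p := Real.pi / ζ with hp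
  have hp2 : 2 < p := by rw [hp, lt_div_iff₀ h0]; linarith
  have hi := integrable_exp_div_cosh hp2
  have hj := integrable_exp_mul_inv_cosh_sq hp2
  have hd : ∀ x : ℝ, HasDerivAt (fun t => Real.exp ((2 - p) * t) / Real.cosh (p * t))
      (2 * (Real.exp ((2 - p) * x) / Real.cosh (p * x)) -
        p * (Real.exp (2 * x) * ((Real.cosh (p * x))⁻¹) ^ 2)) x := by
    intro x
    have hc := (Real.cosh_pos (p * x)).ne'
    have := (((hasDerivAt_id x).const_mul (2 - p)).exp).div
      (((hasDerivAt_id x).const_mul p).cosh) hc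
    refine this.congr_deriv ?_
    simp only [id, mul_one]
    have e : Real.exp (2 * x) = Real.exp ((2 - p) * x) *
        (Real.cosh (p * x) + Real.sinh (p * x)) := by
      rw [Real.cosh_add_sinh, ← Real.exp_add]; ring_nf
    rw [e]
    field_simp
    ring
  have hl : Tendsto (fun r : ℝ => 2 * Real.exp (-2 * r)) atTop (𝓝 0) := by
    have : Tendsto (fun T : ℝ => Real.exp (-2 * T)) atTop (𝓝 0) :=
      Real.tendsto_exp_atBot.comp (tendsto_id.const_mul_atTop_of_neg (by norm_num))
    simpa using this.const_mul 2
  have hlb := squeeze_zero_norm (norm_exp_div_cosh_le hp2) (hl.comp tendsto_abs_atBot_atTop)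
  have hlt := squeeze_zero_norm (norm_exp_div_cosh_le hp2) (hl.comp tendsto_abs_atTop_atTop)
  have key := integral_of_hasDerivAt_of_tendsto hd ((hi.const_mul 2).sub (hj.const_mul p)) hlb hlt
  rw [integral_sub (hi.const_mul 2) (hj.const_mul p), integral_const_mul, integral_const_mul,
    hF] at key
  have hs : 0 < Real.sin ζ := Real.sin_pos_of_pos_of_lt_pi h0 (by linarith [Real.pi_pos])
  have hp0 : p ≠ 0 := by linarith
  have : ∫ t : ℝ, Real.exp (2 * t) * ((Real.cosh (p * t))⁻¹) ^ 2 = 2 * (ζ / Real.sin ζ) / p := by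
    rw [eq_div_iff hp0]
    linarith
  rw [this, hp]
  field_simp

theorem integral_cosh_mul_inv_cosh_sq {ζ : ℝ} (h0 : 0 < ζ) (h1 : ζ < Real.pi / 2) :
    Integrable (fun t : ℝ => Real.cosh (2 * t) * ((Real.cosh (Real.pi / ζ * t))⁻¹) ^ 2) ∧
    ∫ t : ℝ, Real.cosh (2 * t) * ((Real.cosh (Real.pi / ζ * t))⁻¹) ^ 2 =
      2 * ζ ^ 2 / (Real.pi * Real.sin ζ) := by
  have hF := integral_exp_mul_inv_cosh_sq h0 h1
  have hp2 : 2 < Real.pi / ζ := by rw [lt_div_iff₀ h0]; linarith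
  have hi := integrable_exp_mul_inv_cosh_sq hp2
  have hi' := hi.comp_neg
  have hF' := hF
  rw [← integral_neg_eq_self] at hF'
  have e : ∀ t : ℝ, Real.cosh (2 * t) * ((Real.cosh (Real.pi / ζ * t))⁻¹) ^ 2 =
      (Real.exp (2 * t) * ((Real.cosh (Real.pi / ζ * t))⁻¹) ^ 2) / 2 +
      (Real.exp (2 * -t) * ((Real.cosh (Real.pi / ζ * -t))⁻¹) ^ 2) / 2 := by
    intro t
    rw [mul_neg, mul_neg, Real.cosh_neg, Real.cosh_eq (2 * t)]
    ring
  simp only [e]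
  refine ⟨(hi.div_const 2).add (hi'.div_const 2), ?_⟩
  rw [integral_add (hi.div_const 2) (hi'.div_const 2), integral_div, integral_div, hF, hF']
  ring

theorem coth_sub_coth {z w : ℂ} (hz : Complex.sinh z ≠ 0) (hw : Complex.sinh w ≠ 0) :
    Complex.cosh z / Complex.sinh z - Complex.cosh w / Complex.sinh w =
      Complex.sinh (w - z) / (Complex.sinh z * Complex.sinh w) := by
  rw [div_sub_div _ _ hz hw, Complex.sinh_sub]
  ring

theorem sinh_sub_mul_sinh_add (x y : ℝ) :
    Complex.sinh (x - y * Complex.I) * Complex.sinh (x + y * Complex.I) =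
      ((Real.sinh x ^ 2 + Real.sin y ^ 2 : ℝ) : ℂ) := by
  rw [Complex.sinh_sub, Complex.sinh_add, Complex.sinh_mul_I, Complex.cosh_mul_I]
  push_cast
  linear_combination (Complex.sinh x ^ 2) * Complex.sin_sq_add_cos_sq (y : ℂ) +
    Complex.sin y ^ 2 * Complex.cosh_sq (x : ℂ) -
      (Complex.cosh x ^ 2 * Complex.sin y ^ 2) * Complex.I_sq

/-- This writes the kernel 1 / (sinh² + sin²) as a jump of coth between two conjugate lines, which
opens it to contour integration. -/
theorem coth_sub_coth_add {x y : ℝ} (hy : Real.sin y ≠ 0) :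
    Complex.cosh (x - y * Complex.I) / Complex.sinh (x - y * Complex.I) -
      Complex.cosh (x + y * Complex.I) / Complex.sinh (x + y * Complex.I) =
      Complex.I * ((Real.sin (2 * y) / (Real.sinh x ^ 2 + Real.sin y ^ 2) : ℝ) : ℂ) := by
  rw [coth_sub_coth (sinh_ne_zero_of_sin_ne_zero (by simpa using hy))
    (sinh_ne_zero_of_sin_ne_zero (by simpa using hy)), sinh_sub_mul_sinh_add]
  have : (x + y * Complex.I - (x - y * Complex.I) : ℂ) = ((2 * y : ℝ) : ℂ) * Complex.I := by
    push_cast; ring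
  rw [this, Complex.sinh_mul_I, ← Complex.ofReal_sin, Complex.ofReal_div]
  ring

/-- The integral of `coth (t - z) / cosh (π z / ζ)` over the boundary of `|Im z| ≤ ζ`. -/
theorem integral_coth_div_cosh {ζ : ℝ} (h0 : 0 < ζ) (h1 : ζ < Real.pi / 2) (t : ℝ) :
    (∫ s : ℝ, (fun z : ℂ => Complex.cosh (t - z) / Complex.sinh (t - z) /
        Complex.cosh ((Real.pi / ζ : ℝ) * z)) (s + (-ζ : ℝ) * Complex.I)) -
      ∫ s : ℝ, (fun z : ℂ => Complex.cosh (t - z) / Complex.sinh (t - z) /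
        Complex.cosh ((Real.pi / ζ : ℝ) * z)) (s + (ζ : ℝ) * Complex.I) =
    2 * Complex.I * ((ζ * Real.sin ζ / (Real.sinh t ^ 2 + Real.sin (ζ / 2) ^ 2) -
      Real.pi / Real.cosh (Real.pi / ζ * t) : ℝ) : ℂ) := by
  set p := Real.pi / ζ with hp
  have hp2 : 2 < p := by rw [hp, lt_div_iff₀ h0]; linarith
  have hp1 : 0 < p := by linarith
  have hp0 : (p : ℂ) ≠ 0 := Complex.ofReal_ne_zero.2 hp1.ne'
  have hpζ : p * ζ = Real.pi := by rw [hp]; field_simp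
  have hs2 : 0 < Real.sin (ζ / 2) :=
    Real.sin_pos_of_pos_of_lt_pi (by linarith) (by linarith [Real.pi_pos])
  set g : ℂ → ℂ := fun z => Complex.cosh (t - z) / Complex.sinh (t - z) with hg
  set f : ℂ → ℂ := fun z => g z / Complex.cosh (p * z) with hf
  have hsd : ∀ z, HasDerivAt (fun z : ℂ => Complex.sinh (t - z)) (-Complex.cosh (t - z)) z := by
    intro z
    simpa using ((hasDerivAt_id z).const_sub (t : ℂ)).csinh
  have hgd : ∀ z, Complex.sinh (t - z) ≠ 0 → DifferentiableAt ℂ g z := fun z hz =>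
    DifferentiableAt.div (by
      simpa using (((hasDerivAt_id z).const_sub (t : ℂ)).ccosh).differentiableAt)
      (hsd z).differentiableAt hz
  have hfd : ∀ z, Complex.sinh (t - z) ≠ 0 → Complex.cosh (p * z) ≠ 0 → DifferentiableAt ℂ f z :=
    fun z hz hz' => (hgd z hz).div (hasDerivAt_cosh_mul p z).differentiableAt hz'
  have hsne : ∀ z : ℂ, z.im ∈ Icc (-ζ) ζ → z ≠ t → Complex.sinh (t - z) ≠ 0 := by
    intro z hz hne
    by_cases h : z.re = t
    · refine sinh_ne_zero_of_sin_ne_zero ?_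
      have h' : z.im ≠ 0 := fun h' => hne (Complex.ext (by simpa using h) (by simpa using h'))
      have e : ((t : ℂ) - z).im = -z.im := by simp
      rw [e, Ne, Real.sin_eq_zero_iff_of_lt_of_lt (by linarith [hz.2]) (by linarith [hz.1])]
      exact neg_ne_zero.2 h'
    · refine sinh_ne_zero_of_re_ne_zero ?_
      simpa [sub_eq_zero] using Ne.symm h
  have hcne : ∀ z : ℂ, z.im ∈ Icc (-ζ) ζ → z ≠ (ζ / 2 : ℝ) * Complex.I →
      z ≠ -((ζ / 2 : ℝ) * Complex.I) → Complex.cosh (p * z) ≠ 0 := by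
    intro z hz hne hne'
    rcases le_total 0 z.im with h | h
    · exact cosh_pi_div_mul_ne_zero h0 ⟨h, hz.2⟩ hne
    · have := cosh_pi_div_mul_ne_zero h0 (z := -z) (by
        rw [Complex.neg_im]; exact ⟨by linarith, by linarith [hz.1]⟩)
        fun h => hne' (by rw [← h, neg_neg])
      rwa [mul_neg, Complex.cosh_neg] at this
  have hb : ∀ z : ℂ, |t| + 1 ≤ |z.re| → ‖f z‖ ≤ 16 * Real.exp (-p * |z.re|) := by
    intro z hz
    have h3 : |((p : ℂ) * z).re| = p * |z.re| := by
      rw [Complex.re_ofReal_mul, abs_mul, abs_of_pos hp1]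
    have h4 := norm_inv_cosh_le (z := (p : ℂ) * z) (by rw [h3]; nlinarith [abs_nonneg t])
    have h5 := norm_cosh_div_sinh_le (z := (t : ℂ) - z) (by
      have := abs_sub_abs_le_abs_sub z.re t
      rw [abs_sub_comm] at this
      simp only [Complex.sub_re, Complex.ofReal_re]
      linarith)
    rw [h3] at h4
    simp only [hf, hg]
    rw [div_eq_mul_inv, norm_mul, neg_mul]
    refine (mul_le_mul h5 h4 (norm_nonneg _) (by norm_num)).trans (le_of_eq (by ring))
  have hpos : (p * ((ζ / 2 : ℝ) * Complex.I) : ℂ) = (Real.pi / 2 : ℝ) * Complex.I := by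
    rw [← hpζ]; push_cast; ring
  have hs1 : Complex.sinh (p * ((ζ / 2 : ℝ) * Complex.I)) = Complex.I := by
    rw [hpos, Complex.sinh_mul_I, ← Complex.ofReal_sin, Real.sin_pi_div_two]; simp
  have hc1 : Complex.cosh (p * ((ζ / 2 : ℝ) * Complex.I)) = 0 := by
    rw [hpos, Complex.cosh_mul_I, ← Complex.ofReal_cos, Real.cos_pi_div_two]; simp
  -- The strip is cut at the heights -ζ/4 and ζ/4, so that each piece holds exactly one pole: -iζ/2
  -- and iζ/2 from the hyperbolic cosine, t from coth.
  have I1 := integral_line_sub_integral_line_eq (f := f) (c := -((ζ / 2 : ℝ) * Complex.I))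
    (r := g (-((ζ / 2 : ℝ) * Complex.I)) / (p * -Complex.I)) (a := -ζ) (b := -(ζ / 4)) (C := 16)
    (κ := p) (R := |t| + 1) (by simp; linarith) (by simp; linarith) hp1
    (fun z hz => (hfd z (hsne z ⟨hz.1.1, by linarith [hz.1.2]⟩ (by
        rintro rfl; have := hz.1.2; simp at this; linarith))
      (hcne z ⟨hz.1.1, by linarith [hz.1.2]⟩ (by
        rintro rfl; have := hz.1.2; simp at this; linarith) hz.2)).differentiableWithinAt)
    (by
      have := tendsto_sub_mul_div_of_hasDerivAt (c := -((ζ / 2 : ℝ) * Complex.I)) (g := g)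
        (hgd _ (hsne _ (by simp; constructor <;> linarith) (by
          intro h; have := congrArg Complex.im h; simp at this; linarith))).continuousAt
        (hasDerivAt_cosh_mul p _) (by rw [mul_neg, Complex.cosh_neg, hc1]) (by
          rw [mul_neg, Complex.sinh_neg, hs1]
          exact mul_ne_zero hp0 (neg_ne_zero.2 Complex.I_ne_zero))
      rwa [mul_neg (p : ℂ), Complex.sinh_neg, hs1] at this)
    (fun z _ hz => hb z hz)
  have I2 := integral_line_sub_integral_line_eq (f := f) (c := t)
    (r := -(1 / Complex.cosh (p * t))) (a := -(ζ / 4)) (b := ζ / 4) (C := 16)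
    (κ := p) (R := |t| + 1) (by simp; linarith) (by simp; linarith) hp1
    (fun z hz => (hfd z (hsne z ⟨by linarith [hz.1.1], by linarith [hz.1.2]⟩ hz.2)
      (hcne z ⟨by linarith [hz.1.1], by linarith [hz.1.2]⟩ (by
        rintro rfl; have := hz.1.2; simp at this; linarith) (by
        rintro rfl; have := hz.1.1; simp at this; linarith))).differentiableWithinAt)
    (by
      have hct : Complex.cosh (p * t) ≠ 0 := hcne _ (by simp; linarith) (by
          intro h; have := congrArg Complex.im h; simp at this; linarith) (by
          intro h; have := congrArg Complex.im h; simp at this; linarith)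
      have := tendsto_sub_mul_div_of_hasDerivAt (c := (t : ℂ))
        (g := fun z => Complex.cosh (t - z) / Complex.cosh (p * z))
        (ContinuousAt.div (by fun_prop) (by fun_prop) hct) (hsd t) (by simp) (by simp)
      simp only [sub_self, Complex.cosh_zero] at this
      rw [div_neg, div_one] at this
      refine this.congr fun z => ?_
      simp only [hf, hg]
      ring)
    (fun z _ hz => hb z hz)
  have I3 := integral_line_sub_integral_line_eq (f := f) (c := (ζ / 2 : ℝ) * Complex.I)
    (r := g ((ζ / 2 : ℝ) * Complex.I) / (p * Complex.I)) (a := ζ / 4) (b := ζ) (C := 16)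
    (κ := p) (R := |t| + 1) (by simp; linarith) (by simp; linarith) hp1
    (fun z hz => (hfd z (hsne z ⟨by linarith [hz.1.1], hz.1.2⟩ (by
        rintro rfl; have := hz.1.1; simp at this; linarith))
      (hcne z ⟨by linarith [hz.1.1], hz.1.2⟩ hz.2 (by
        rintro rfl; have := hz.1.1; simp at this; linarith))).differentiableWithinAt)
    (by
      have := tendsto_sub_mul_div_of_hasDerivAt (c := (ζ / 2 : ℝ) * Complex.I) (g := g)
        (hgd _ (hsne _ (by simp; constructor <;> linarith) (by
          intro h; have := congrArg Complex.im h; simp at this; linarith))).continuousAt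
        (hasDerivAt_cosh_mul p _) hc1 (by rw [hs1]; exact mul_ne_zero hp0 Complex.I_ne_zero)
      rwa [hs1] at this)
    (fun z _ hz => hb z hz)
  have hdiff : g ((ζ / 2 : ℝ) * Complex.I) - g (-((ζ / 2 : ℝ) * Complex.I)) =
      Complex.I * ((Real.sin ζ / (Real.sinh t ^ 2 + Real.sin (ζ / 2) ^ 2) : ℝ) : ℂ) := by
    have := coth_sub_coth_add (x := t) hs2.ne'
    rw [mul_div_cancel₀ ζ (two_ne_zero' ℝ)] at this
    rw [← this]
    simp only [hg, sub_neg_eq_add]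
  have hζ : (Real.pi : ℂ) = p * ζ := by rw [← hpζ]; push_cast; ring
  have hfin := congrArg₂ (· + ·) (congrArg₂ (· + ·) I1 I2) I3
  have htot : (∫ s : ℝ, f (s + (-ζ : ℝ) * Complex.I)) - ∫ s : ℝ, f (s + (ζ : ℝ) * Complex.I) =
      2 * Real.pi * Complex.I * ((g ((ζ / 2 : ℝ) * Complex.I) - g (-((ζ / 2 : ℝ) * Complex.I))) /
        (p * Complex.I) - 1 / Complex.cosh (p * t)) := by
    linear_combination hfin
  rw [htot, hdiff, Complex.ofReal_sub, Complex.ofReal_div Real.pi (Real.cosh _),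
    Complex.ofReal_cosh,
    Complex.ofReal_mul p t, mul_div_assoc ζ, Complex.ofReal_mul ζ, hζ]
  have := Complex.I_ne_zero
  field_simp

theorem norm_cosh_div_sinh_le_inv {z : ℂ} (hz : Real.sin z.im ≠ 0) :
    ‖Complex.cosh z / Complex.sinh z‖ ≤ |Real.sin z.im|⁻¹ := by
  have hc := Real.cosh_pos z.re
  have h1 : ‖Complex.cosh z‖ ≤ Real.cosh z.re := by
    refine abs_le_of_sq_le_sq' ?_ hc.le |>.2
    rw [Complex.normSq_cosh, Real.cosh_sq]
    nlinarith [Real.sin_sq_add_cos_sq z.im, sq_nonneg (Real.sin z.im)]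
  have h2 := abs_sin_mul_cosh_le_norm_sinh z
  have h3 : 0 < |Real.sin z.im| := abs_pos.2 hz
  rw [norm_div, div_le_iff₀ ((mul_pos h3 hc).trans_le h2), ← div_eq_inv_mul, le_div_iff₀ h3]
  nlinarith

theorem integrable_coth_mul_inv_cosh {y p : ℝ} (hp : 0 < p) (hy : Real.sin y ≠ 0) (t : ℝ) :
    Integrable fun s : ℝ => Complex.cosh ((t - s : ℝ) + y * Complex.I) /
      Complex.sinh ((t - s : ℝ) + y * Complex.I) * ((Real.cosh (p * s))⁻¹ : ℝ) := by
  refine ((integrable_inv_cosh_mul hp).const_mul |Real.sin y|⁻¹).mono'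
    (Continuous.aestronglyMeasurable (Continuous.mul (Continuous.div (by fun_prop) (by fun_prop)
      fun s => sinh_ne_zero_of_sin_ne_zero (by simpa using hy))
      (Complex.continuous_ofReal.comp (Continuous.inv₀ (by fun_prop)
        fun t => (Real.cosh_pos _).ne')))) (Eventually.of_forall fun s => ?_)
  have h := norm_cosh_div_sinh_le_inv (z := (t - s : ℝ) + y * Complex.I) (by simpa using hy)
  rw [norm_mul, Complex.norm_real, Real.norm_of_nonneg (inv_nonneg.2 (Real.cosh_pos _).le)]
  refine mul_le_mul_of_nonneg_right ?_ (inv_nonneg.2 (Real.cosh_pos _).le)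
  simpa using h

/-- On the lines Im = ζ and Im = -ζ the factor cosh (π z / ζ) equals -cosh (π s / ζ), so the two
boundary integrals of `integral_coth_div_cosh` carry the same real weight. Their difference contains
only the jump of coth, which is i sin (2ζ) times the kernel. -/
theorem integral_inv_cosh_div {ζ : ℝ} (h0 : 0 < ζ) (h1 : ζ < Real.pi / 2) (t : ℝ) :
    ∫ s : ℝ, (Real.cosh (Real.pi / ζ * s))⁻¹ / (Real.sinh (t - s) ^ 2 + Real.sin ζ ^ 2) =
    (ζ * Real.sin ζ / (Real.sinh t ^ 2 + Real.sin (ζ / 2) ^ 2) -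
      Real.pi / Real.cosh (Real.pi / ζ * t)) / (Real.sin ζ * Real.cos ζ) := by
  have h := integral_coth_div_cosh h0 h1 t
  set p := Real.pi / ζ with hp
  have hp1 : 0 < p := by positivity
  have hpζ : p * ζ = Real.pi := by rw [hp]; field_simp
  have hs : 0 < Real.sin ζ := Real.sin_pos_of_pos_of_lt_pi h0 (by linarith [Real.pi_pos])
  have hc : 0 < Real.cos ζ := Real.cos_pos_of_mem_Ioo ⟨by linarith, h1⟩
  have e1 : ∀ s : ℝ, Complex.cosh ((p : ℝ) * (s + (ζ : ℝ) * Complex.I)) =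
      -Complex.cosh ((p * s : ℝ) : ℂ) := by
    intro s
    have : ((p : ℝ) * (s + (ζ : ℝ) * Complex.I) : ℂ) = (p * s : ℝ) + Real.pi * Complex.I := by
      rw [← hpζ]; push_cast; ring
    rw [this, Complex.cosh_add, Complex.cosh_mul_I, Complex.sinh_mul_I]
    simp
  have e2 : ∀ s : ℝ, Complex.cosh ((p : ℝ) * (s + (-ζ : ℝ) * Complex.I)) =
      -Complex.cosh ((p * s : ℝ) : ℂ) := by
    intro s
    have : ((p : ℝ) * (s + (-ζ : ℝ) * Complex.I) : ℂ) = (p * s : ℝ) - Real.pi * Complex.I := by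
      rw [← hpζ]; push_cast; ring
    rw [this, Complex.cosh_sub, Complex.cosh_mul_I, Complex.sinh_mul_I]
    simp
  have hi1 := integrable_coth_mul_inv_cosh hp1 hs.ne' t
  have hi2 := integrable_coth_mul_inv_cosh (y := -ζ) hp1 (by
    rw [Real.sin_neg]; exact neg_ne_zero.2 hs.ne') t
  have e3 : ∀ s : ℝ, Complex.cosh (t - (s + (-ζ : ℝ) * Complex.I)) /
      Complex.sinh (t - (s + (-ζ : ℝ) * Complex.I)) / Complex.cosh ((p : ℝ) *
        (s + (-ζ : ℝ) * Complex.I)) = -(Complex.cosh ((t - s : ℝ) + ζ * Complex.I) /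
      Complex.sinh ((t - s : ℝ) + ζ * Complex.I) * ((Real.cosh (p * s))⁻¹ : ℝ)) := by
    intro s
    have : (t - (s + (-ζ : ℝ) * Complex.I) : ℂ) = (t - s : ℝ) + ζ * Complex.I := by
      push_cast; ring
    rw [e2, this, Complex.ofReal_inv, Complex.ofReal_cosh, div_neg,
      div_eq_mul_inv _ (Complex.cosh (p * s : ℝ))]
  have e4 : ∀ s : ℝ, Complex.cosh (t - (s + (ζ : ℝ) * Complex.I)) /
      Complex.sinh (t - (s + (ζ : ℝ) * Complex.I)) / Complex.cosh ((p : ℝ) *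
        (s + (ζ : ℝ) * Complex.I)) = -(Complex.cosh ((t - s : ℝ) + (-ζ : ℝ) * Complex.I) /
      Complex.sinh ((t - s : ℝ) + (-ζ : ℝ) * Complex.I) * ((Real.cosh (p * s))⁻¹ : ℝ)) := by
    intro s
    have : (t - (s + (ζ : ℝ) * Complex.I) : ℂ) = (t - s : ℝ) + (-ζ : ℝ) * Complex.I := by
      push_cast; ring
    rw [e1, this, Complex.ofReal_inv, Complex.ofReal_cosh, div_neg,
      div_eq_mul_inv _ (Complex.cosh (p * s : ℝ))]
  simp only [e3, e4] at h
  rw [integral_neg, integral_neg, neg_sub_neg, ← integral_sub hi2 hi1] at h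
  have e5 : ∀ s : ℝ, Complex.cosh ((t - s : ℝ) + (-ζ : ℝ) * Complex.I) /
      Complex.sinh ((t - s : ℝ) + (-ζ : ℝ) * Complex.I) * ((Real.cosh (p * s))⁻¹ : ℝ) -
      Complex.cosh ((t - s : ℝ) + ζ * Complex.I) /
      Complex.sinh ((t - s : ℝ) + ζ * Complex.I) * ((Real.cosh (p * s))⁻¹ : ℝ) =
      Complex.I * ((Real.sin (2 * ζ) *
        ((Real.cosh (p * s))⁻¹ / (Real.sinh (t - s) ^ 2 + Real.sin ζ ^ 2)) : ℝ) : ℂ) := by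
    intro s
    rw [Complex.ofReal_neg, neg_mul, ← sub_eq_add_neg, ← sub_mul, coth_sub_coth_add hs.ne']
    push_cast
    ring
  simp only [e5] at h
  rw [integral_const_mul, integral_complex_ofReal, integral_const_mul, mul_comm 2 Complex.I,
    mul_assoc, mul_right_inj' Complex.I_ne_zero, Real.sin_two_mul] at h
  rw [eq_div_iff (mul_pos hs hc).ne']
  have h' : (2 * Real.sin ζ * Real.cos ζ) *
      ∫ s : ℝ, (Real.cosh (p * s))⁻¹ / (Real.sinh (t - s) ^ 2 + Real.sin ζ ^ 2) =
      2 * (ζ * Real.sin ζ / (Real.sinh t ^ 2 + Real.sin (ζ / 2) ^ 2) -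
      Real.pi / Real.cosh (p * t)) := by exact_mod_cast h
  linarith

end

/-! ### The regularized double integrals: moving both lines, and the limit of the shift -/

section

open Set

theorem integrable_mul_mul_kernel {A B k : ℂ → ℂ} {s t r : Set ℝ} {C D M κ α β : ℝ} (hκ : 0 < κ)
    (hA : ContinuousOn A {z | z.im ∈ s})
    (hAb : ∀ z : ℂ, z.im ∈ s → ‖A z‖ ≤ C * Real.exp (-κ * |z.re|))
    (hB : ContinuousOn B {z | z.im ∈ t})
    (hBb : ∀ z : ℂ, z.im ∈ t → ‖B z‖ ≤ D * Real.exp (-κ * |z.re|))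
    (hk : ContinuousOn k {z | z.im ∈ r}) (hkb : ∀ z : ℂ, z.im ∈ r → ‖k z‖ ≤ M)
    (hα : α ∈ s) (hβ : β ∈ t) (hr : β - α ∈ r) :
    Integrable fun x : ℝ × ℝ => A (x.1 + α * Complex.I) * B (x.2 + β * Complex.I) *
      k (x.2 + β * Complex.I - (x.1 + α * Complex.I)) := by
  refine Integrable.mul_bdd (c := M) ((integrable_comp_line hκ hA hα hAb).mul_prod
    (integrable_comp_line hκ hB hβ hBb)) ?_ (Eventually.of_forall fun x => hkb _ (by simpa using hr))
  exact (hk.comp_continuous (f := fun x : ℝ × ℝ => x.2 + β * Complex.I - (x.1 + α * Complex.I))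
    (by fun_prop) fun x => by simpa using hr).aestronglyMeasurable

/-- Moving the two lines of integration of a double integral with an exponentially decaying
holomorphic integrand. -/
theorem integral_mul_mul_kernel_eq {A B k : ℂ → ℂ} {a a' b b' C D M κ : ℝ} (hκ : 0 < κ)
    (haa : a ≤ a') (hbb : b' ≤ b)
    (hA : DifferentiableOn ℂ A {z | z.im ∈ Icc a a'})
    (hAb : ∀ z : ℂ, z.im ∈ Icc a a' → ‖A z‖ ≤ C * Real.exp (-κ * |z.re|))
    (hB : DifferentiableOn ℂ B {z | z.im ∈ Icc b' b})
    (hBb : ∀ z : ℂ, z.im ∈ Icc b' b → ‖B z‖ ≤ D * Real.exp (-κ * |z.re|))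
    (hk : DifferentiableOn ℂ k {z | z.im ∈ Icc (b' - a') (b - a)})
    (hkb : ∀ z : ℂ, z.im ∈ Icc (b' - a') (b - a) → ‖k z‖ ≤ M) :
    ∫ x : ℝ × ℝ, A (x.1 + a * Complex.I) * B (x.2 + b * Complex.I) *
      k (x.2 + b * Complex.I - (x.1 + a * Complex.I)) =
    ∫ x : ℝ × ℝ, A (x.1 + a' * Complex.I) * B (x.2 + b' * Complex.I) *
      k (x.2 + b' * Complex.I - (x.1 + a' * Complex.I)) := by
  have hM : 0 ≤ M := (norm_nonneg _).trans (hkb (((b - a : ℝ) : ℂ) * Complex.I)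
    (by simp; linarith))
  have hi := fun α (hα : α ∈ Icc a a') β (hβ : β ∈ Icc b' b) =>
    integrable_mul_mul_kernel (α := α) (β := β) hκ hA.continuousOn hAb hB.continuousOn hBb
      hk.continuousOn hkb hα hβ ⟨by linarith [hα.2, hβ.1], by linarith [hα.1, hβ.2]⟩
  -- The lines are moved one at a time, by Fubini: the second variable from b down to b', then the
  -- first from a up to a'. Throughout, the imaginary part of the difference stays in [b' - a', b -
  -- a].
  have e1 : ∫ x : ℝ × ℝ, A (x.1 + a * Complex.I) * B (x.2 + b * Complex.I) *
      k (x.2 + b * Complex.I - (x.1 + a * Complex.I)) =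
      ∫ x : ℝ × ℝ, A (x.1 + a * Complex.I) * B (x.2 + b' * Complex.I) *
      k (x.2 + b' * Complex.I - (x.1 + a * Complex.I)) := by
    rw [Measure.volume_eq_prod,
      integral_prod _ (hi a (left_mem_Icc.2 haa) b (right_mem_Icc.2 hbb)),
      integral_prod _ (hi a (left_mem_Icc.2 haa) b' (left_mem_Icc.2 hbb))]
    congr 1 with x
    simp only [mul_assoc, integral_const_mul]
    congr 1
    refine (integral_line_eq_of_differentiableOn (C := D * M) hbb hκ
      (f := fun v => B v * k (v - (x + a * Complex.I))) ?_ fun z hz => ?_).symm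
    · refine hB.mul (hk.comp (by fun_prop) fun z hz => ?_)
      simp only [mem_ofPred_eq] at hz
      simp
      constructor <;> linarith [hz.1, hz.2]
    · rw [norm_mul, mul_right_comm]
      refine mul_le_mul (hBb z hz) (hkb _ ?_) (norm_nonneg _) ((norm_nonneg _).trans (hBb z hz))
      simp
      constructor <;> linarith [hz.1, hz.2]
  rw [e1, Measure.volume_eq_prod,
    integral_prod_symm _ (hi a (left_mem_Icc.2 haa) b' (left_mem_Icc.2 hbb)),
    integral_prod_symm _ (hi a' (right_mem_Icc.2 haa) b' (left_mem_Icc.2 hbb))]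
  congr 1 with y
  simp only [mul_right_comm _ (B _), mul_assoc]
  simp only [← mul_assoc, integral_mul_const]
  congr 1
  refine (integral_line_eq_of_differentiableOn (C := C * M) haa hκ
    (f := fun u => A u * k (y + b' * Complex.I - u)) ?_ fun z hz => ?_)
  · refine hA.mul (hk.comp (by fun_prop) fun z hz => ?_)
    simp only [mem_ofPred_eq] at hz
    simp
    constructor <;> linarith [hz.1, hz.2]
  · rw [norm_mul, mul_right_comm]
    refine mul_le_mul (hAb z hz) (hkb _ ?_) (norm_nonneg _) ((norm_nonneg _).trans (hAb z hz))
    simp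
    constructor <;> linarith [hz.1, hz.2]

namespace XXZ

/-- The one-variable factor `sinh (z + i θ) / sinh (p z)` of the double integrals. -/
noncomputable def factor (p θ : ℝ) (z : ℂ) : ℂ :=
  Complex.sinh (z + θ * Complex.I) * (Complex.sinh (p * z))⁻¹

/-- The kernel `1 / sinh (z + i σ)` of the double integrals. -/
noncomputable def kernel (σ : ℝ) (z : ℂ) : ℂ := (Complex.sinh (z + σ * Complex.I))⁻¹

/-- The integrand on the lines `Im = h` and `Im = -h`. -/
noncomputable def pairIntegrand (p θ φ σ h : ℝ) (x : ℝ × ℝ) : ℂ :=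
  factor p θ (x.1 + h * Complex.I) * factor p φ (x.2 + (-h : ℝ) * Complex.I) *
    kernel σ (x.2 + (-h : ℝ) * Complex.I - (x.1 + h * Complex.I))

/-- The numerator grows like exp |x| and the denominator like exp (p |x|). For p = π/ζ the condition
p > 2 is ζ < π/2; it leaves more than the decay exp (-|x|) claimed. The kernel need then only be
bounded. -/
theorem norm_factor_le {p θ s : ℝ} (hp : 2 < p) (hs : 0 < s) {z : ℂ}
    (hz : s ≤ |Real.sin (p * z.im)|) : ‖factor p θ z‖ ≤ 2 / s * Real.exp (-1 * |z.re|) := by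
  have h1 := norm_sinh_le_exp_abs (z + θ * Complex.I)
  have h2 := norm_inv_sinh_le (z := p * z) hs (by rwa [Complex.im_ofReal_mul])
  have e1 : (z + θ * Complex.I).re = z.re := by simp
  have e2 : |((p : ℂ) * z).re| = p * |z.re| := by
    rw [Complex.re_ofReal_mul, abs_mul, abs_of_pos (by linarith)]
  rw [e1] at h1
  rw [e2] at h2
  rw [factor, norm_mul]
  calc _ ≤ Real.exp |z.re| * (2 / s * Real.exp (-(p * |z.re|))) :=
        mul_le_mul h1 h2 (norm_nonneg _) (Real.exp_pos _).le
    _ = 2 / s * Real.exp (|z.re| + -(p * |z.re|)) := by rw [Real.exp_add]; ring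
    _ ≤ _ := by
        gcongr
        nlinarith [abs_nonneg z.re]

theorem differentiableOn_factor {p θ : ℝ} {s : Set ℝ} (hs : ∀ y ∈ s, Real.sin (p * y) ≠ 0) :
    DifferentiableOn ℂ (factor p θ) {z | z.im ∈ s} := by
  have h1 : Differentiable ℂ fun z : ℂ => Complex.sinh (z + θ * Complex.I) :=
    Complex.differentiable_sinh.comp (by fun_prop : Differentiable ℂ fun z : ℂ => z + θ * Complex.I)
  have h2 : Differentiable ℂ fun z : ℂ => Complex.sinh (p * z) :=
    Complex.differentiable_sinh.comp (by fun_prop : Differentiable ℂ fun z : ℂ => p * z)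
  exact h1.differentiableOn.mul (h2.differentiableOn.inv fun z hz =>
    sinh_ne_zero_of_sin_ne_zero (by rw [Complex.im_ofReal_mul]; exact hs _ hz))

theorem differentiableOn_kernel {σ : ℝ} {s : Set ℝ} (hs : ∀ y ∈ s, Real.sin (y + σ) ≠ 0) :
    DifferentiableOn ℂ (kernel σ) {z | z.im ∈ s} := by
  have h1 : Differentiable ℂ fun z : ℂ => Complex.sinh (z + σ * Complex.I) :=
    Complex.differentiable_sinh.comp (by fun_prop : Differentiable ℂ fun z : ℂ => z + σ * Complex.I)
  exact h1.differentiableOn.inv fun z hz => sinh_ne_zero_of_sin_ne_zero (by simpa using hs _ hz)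

theorem norm_kernel_le {σ s : ℝ} (hs : 0 < s) {z : ℂ} (hz : s ≤ |Real.sin (z.im + σ)|) :
    ‖kernel σ z‖ ≤ 2 / s := by
  refine (norm_inv_sinh_le (z := z + σ * Complex.I) hs (by simpa using hz)).trans ?_
  refine mul_le_of_le_one_right (by positivity) (Real.exp_le_one_iff.2 ?_)
  exact neg_nonpos.2 (abs_nonneg _)

theorem exists_le_abs_of_ne_zero {f : ℝ → ℝ} (hf : Continuous f) {a b : ℝ}
    (h : ∀ y ∈ Icc a b, f y ≠ 0) : ∃ s > 0, ∀ y ∈ Icc a b, s ≤ |f y| := by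
  rcases (Icc a b).eq_empty_or_nonempty with he | hne
  · exact ⟨1, one_pos, by simp [he]⟩
  · obtain ⟨x, hx, hmin⟩ := isCompact_Icc.exists_isMinOn hne hf.abs.continuousOn
    exact ⟨|f x|, abs_pos.2 (h x hx), fun y hy => hmin hy⟩

theorem sin_pi_div_mul_ne_zero {ζ y : ℝ} (h0 : 0 < ζ) (hy : 0 < y) (hy' : y < ζ) :
    Real.sin (Real.pi / ζ * y) ≠ 0 := by
  refine (Real.sin_pos_of_pos_of_lt_pi (by positivity) ?_).ne'
  rw [div_mul_eq_mul_div, div_lt_iff₀ h0]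
  exact mul_lt_mul_of_pos_left hy' Real.pi_pos

theorem sin_pi_div_mul_ne_zero_of_neg {ζ y : ℝ} (h0 : 0 < ζ) (hy : y < 0) (hy' : -ζ < y) :
    Real.sin (Real.pi / ζ * y) ≠ 0 := by
  have := sin_pi_div_mul_ne_zero h0 (y := -y) (by linarith) (by linarith)
  rw [mul_neg, Real.sin_neg] at this
  exact neg_ne_zero.1 this

theorem integrable_pairIntegrand {ζ θ φ σ h : ℝ} (h0 : 0 < ζ) (h1 : ζ < Real.pi / 2) (hh : 0 < h)
    (hhζ : h < ζ) (hσ : Real.sin (-(2 * h) + σ) ≠ 0) :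
    Integrable (pairIntegrand (Real.pi / ζ) θ φ σ h) := by
  have hp2 : 2 < Real.pi / ζ := by rw [lt_div_iff₀ h0]; linarith
  have s1 := sin_pi_div_mul_ne_zero h0 hh hhζ
  have s2 := sin_pi_div_mul_ne_zero_of_neg h0 (neg_lt_zero.2 hh) (neg_lt_neg hhζ)
  refine integrable_mul_mul_kernel (s := {h}) (t := {-h}) (r := {-(2 * h)}) one_pos
    (differentiableOn_factor (by rintro _ rfl; exact s1)).continuousOn
    (fun z hz => norm_factor_le hp2 (abs_pos.2 s1) (by rw [mem_singleton_iff.1 hz]))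
    (differentiableOn_factor (by rintro _ rfl; exact s2)).continuousOn
    (fun z hz => norm_factor_le hp2 (abs_pos.2 s2) (by rw [mem_singleton_iff.1 hz]))
    (differentiableOn_kernel (by rintro _ rfl; exact hσ)).continuousOn
    (fun z hz => norm_kernel_le (abs_pos.2 hσ) (by rw [mem_singleton_iff.1 hz])) rfl rfl ?_
  rw [mem_singleton_iff]; ring

/-- The zeros of sinh (π z / ζ) lie at the heights that are multiples of ζ, so none is met between
±h and ±ζ/2. Only the kernel can obstruct the move, and `hσ` excludes its poles at all heights of
the difference. -/
theorem integral_pairIntegrand_eq {ζ θ φ σ h : ℝ} (h0 : 0 < ζ) (h1 : ζ < Real.pi / 2) (hh : 0 < h)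
    (hhζ : h ≤ ζ / 2) (hσ : ∀ y ∈ Icc (-ζ) (-(2 * h)), Real.sin (y + σ) ≠ 0) :
    ∫ x, pairIntegrand (Real.pi / ζ) θ φ σ h x =
      ∫ x, pairIntegrand (Real.pi / ζ) θ φ σ (ζ / 2) x := by
  have hp2 : 2 < Real.pi / ζ := by rw [lt_div_iff₀ h0]; linarith
  have n1 : ∀ y ∈ Icc h (ζ / 2), Real.sin (Real.pi / ζ * y) ≠ 0 := fun y hy =>
    sin_pi_div_mul_ne_zero h0 (hh.trans_le hy.1) (by linarith [hy.2])
  have n2 : ∀ y ∈ Icc (-(ζ / 2)) (-h), Real.sin (Real.pi / ζ * y) ≠ 0 := fun y hy =>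
    sin_pi_div_mul_ne_zero_of_neg h0 (by linarith [hy.2]) (by linarith [hy.1])
  obtain ⟨s1, hs1, b1⟩ := exists_le_abs_of_ne_zero (by fun_prop) n1
  obtain ⟨s2, hs2, b2⟩ := exists_le_abs_of_ne_zero (by fun_prop) n2
  have e1 : -(ζ / 2) - ζ / 2 = -ζ := by ring
  have e2 : -h - h = -(2 * h) := by ring
  rw [← e1, ← e2] at hσ
  obtain ⟨s3, hs3, b3⟩ := exists_le_abs_of_ne_zero (by fun_prop) hσ
  exact integral_mul_mul_kernel_eq one_pos hhζ (neg_le_neg hhζ) (differentiableOn_factor n1)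
    (fun z hz => norm_factor_le hp2 hs1 (b1 _ hz)) (differentiableOn_factor n2)
    (fun z hz => norm_factor_le hp2 hs2 (b2 _ hz)) (differentiableOn_kernel hσ)
    (fun z hz => norm_kernel_le hs3 (b3 _ hz))

/-- On the final lines only the kernel depends on the shift, and for shifts near `σ₀` it is bounded
by a constant; the one-variable factors supply the integrable majorant. -/
theorem tendsto_integral_pairIntegrand {ι : Type*} {l : Filter ι} [l.IsCountablyGenerated]
    {ζ θ φ σ₀ : ℝ} {σ : ι → ℝ} (h0 : 0 < ζ) (h1 : ζ < Real.pi / 2)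
    (hσ₀ : Real.sin (-ζ + σ₀) ≠ 0) (hσ : Tendsto σ l (𝓝 σ₀)) :
    Tendsto (fun i => ∫ x, pairIntegrand (Real.pi / ζ) θ φ (σ i) (ζ / 2) x) l
      (𝓝 (∫ x, pairIntegrand (Real.pi / ζ) θ φ σ₀ (ζ / 2) x)) := by
  have hp2 : 2 < Real.pi / ζ := by rw [lt_div_iff₀ h0]; linarith
  have s1 : Real.sin (Real.pi / ζ * (ζ / 2)) ≠ 0 :=
    sin_pi_div_mul_ne_zero h0 (by linarith) (by linarith)
  have s2 : Real.sin (Real.pi / ζ * (-(ζ / 2))) ≠ 0 :=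
    sin_pi_div_mul_ne_zero_of_neg h0 (by linarith) (by linarith)
  have hc : Continuous fun τ : ℝ => |Real.sin (-ζ + τ)| := by fun_prop
  have hev : ∀ᶠ i in l, |Real.sin (-ζ + σ₀)| / 2 < |Real.sin (-ζ + σ i)| :=
    ((hc.tendsto σ₀).comp hσ).eventually_const_lt (half_lt_self (abs_pos.2 hσ₀))
  have hhalf : 0 < |Real.sin (-ζ + σ₀)| / 2 := half_pos (abs_pos.2 hσ₀)
  have him : ∀ x : ℝ × ℝ, ((x.2 : ℂ) + (-(ζ / 2) : ℝ) * Complex.I -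
      (x.1 + (ζ / 2 : ℝ) * Complex.I)).im = -ζ := by
    intro x; simp; ring
  refine tendsto_integral_filter_of_dominated_convergence
    (fun x : ℝ × ℝ => (2 / |Real.sin (Real.pi / ζ * (ζ / 2))| * Real.exp (-1 * |x.1|)) *
      (2 / |Real.sin (Real.pi / ζ * (-(ζ / 2)))| * Real.exp (-1 * |x.2|)) *
      (2 / (|Real.sin (-ζ + σ₀)| / 2))) ?_ ?_ ?_ ?_
  · filter_upwards [hev] with i hi
    refine (integrable_pairIntegrand h0 h1 (by linarith) (by linarith) ?_).aestronglyMeasurable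
    rw [mul_div_cancel₀ _ (two_ne_zero' ℝ)]
    exact abs_pos.1 (hhalf.trans hi)
  · filter_upwards [hev] with i hi
    refine Eventually.of_forall fun x => ?_
    rw [pairIntegrand, norm_mul, norm_mul]
    gcongr
    · simpa using norm_factor_le (θ := θ) (z := x.1 + (ζ / 2 : ℝ) * Complex.I) hp2
        (abs_pos.2 s1) (by simp)
    · simpa using norm_factor_le (θ := φ) (z := x.2 + (-(ζ / 2) : ℝ) * Complex.I) hp2
        (abs_pos.2 s2) (by simp)
    · exact norm_kernel_le hhalf (by rw [him]; exact hi.le)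
  · exact ((((integrable_exp_neg_mul_abs one_pos).const_mul _).mul_prod
      ((integrable_exp_neg_mul_abs one_pos).const_mul _)).mul_const _)
  · refine Eventually.of_forall fun x => Tendsto.mul tendsto_const_nhds ?_
    refine Tendsto.inv₀ ?_ (sinh_ne_zero_of_sin_ne_zero (by
      rw [Complex.add_im, him]; simpa using hσ₀))
    have : Continuous fun τ : ℝ => Complex.sinh ((x.2 : ℂ) + (-(ζ / 2) : ℝ) * Complex.I -
      (x.1 + (ζ / 2 : ℝ) * Complex.I) + τ * Complex.I) := by fun_prop
    exact (this.tendsto σ₀).comp hσ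

end XXZ

end

/-! ### Evaluation of the limit -/

section

open Set

/-- With x = iζ/2, the left side is the numerator, over a common denominator, of the sum over both
values of c of the integrands on the lines at heights ±ζ/2. In exponentials it is a rational
identity. -/
theorem sinh_mul_sinh_add_sinh_identity (t s x : ℂ) :
    Complex.sinh (t - x) * (Complex.sinh (s + 3 * x) + Complex.sinh (s - x)) *
        Complex.sinh (t - s + 2 * x) -
      Complex.sinh (t + x) * (Complex.sinh (s + x) + Complex.sinh (s - 3 * x)) *
        Complex.sinh (t - s - 2 * x) =
      Complex.sinh (2 * x) * Complex.cosh (2 * x) *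
        (Complex.cosh (2 * t) + Complex.cosh (2 * s) - 2 * Complex.cosh (2 * x)) := by
  have h3 : Complex.exp (3 * x) = Complex.exp x ^ 3 := by
    rw [← Complex.exp_nat_mul]; norm_num
  have h2 : ∀ y, Complex.exp (2 * y) = Complex.exp y ^ 2 := fun y => by
    rw [← Complex.exp_nat_mul]; norm_num
  simp only [Complex.sinh, Complex.cosh, Complex.exp_neg, Complex.exp_add, Complex.exp_sub, h3, h2]
  have := Complex.exp_ne_zero t
  have := Complex.exp_ne_zero s
  have := Complex.exp_ne_zero x
  field_simp
  ring

theorem sinh_sq_add_sin_sq_pos {y : ℝ} (hy : 0 < Real.sin y) (x : ℝ) :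
    0 < Real.sinh x ^ 2 + Real.sin y ^ 2 := by positivity

theorem integrable_cosh_mul_inv_cosh {p : ℝ} (hp : 2 < p) (c : ℝ) :
    Integrable fun t : ℝ => (Real.cosh (p * t))⁻¹ * (Real.cosh (2 * t) - c) := by
  have h1 : Integrable fun t : ℝ => (Real.cosh (p * t))⁻¹ * Real.cosh (2 * t) := by
    refine ((integrable_exp_neg_mul_abs (sub_pos.2 hp)).const_mul 2).mono'
      (Continuous.aestronglyMeasurable (Continuous.mul (Continuous.inv₀ (by fun_prop)
        fun t => (Real.cosh_pos _).ne') (by fun_prop))) (Eventually.of_forall fun t => ?_)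
    have h := inv_cosh_le (p * t)
    have h' := cosh_le_exp_abs (2 * t)
    rw [abs_mul, abs_of_pos (by linarith : 0 < p)] at h
    rw [abs_mul, abs_two] at h'
    have := Real.cosh_pos (p * t)
    have := Real.cosh_pos (2 * t)
    rw [Real.norm_of_nonneg (by positivity)]
    calc _ ≤ 2 * Real.exp (-(p * |t|)) * Real.exp (2 * |t|) := by gcongr
      _ = _ := by rw [mul_assoc, ← Real.exp_add]; ring_nf
  simp only [mul_sub]
  exact h1.sub ((integrable_inv_cosh_mul (by linarith)).mul_const c)

namespace XXZ

/-- The real integrand to which the double integrals reduce. -/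
noncomputable def realIntegrand (ζ : ℝ) (x : ℝ × ℝ) : ℝ :=
  (Real.cosh (Real.pi / ζ * x.1))⁻¹ * ((Real.cosh (Real.pi / ζ * x.2))⁻¹ *
    (Real.cosh (2 * x.2) - Real.cos ζ)) * (Real.sinh (x.2 - x.1) ^ 2 + Real.sin ζ ^ 2)⁻¹

theorem integrable_realIntegrand {ζ : ℝ} (h0 : 0 < ζ) (h1 : ζ < Real.pi / 2) :
    Integrable (realIntegrand ζ) := by
  have hp2 : 2 < Real.pi / ζ := by rw [lt_div_iff₀ h0]; linarith
  have hs : 0 < Real.sin ζ := Real.sin_pos_of_pos_of_lt_pi h0 (by linarith [Real.pi_pos])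
  refine Integrable.mul_bdd (c := (Real.sin ζ ^ 2)⁻¹) ((integrable_inv_cosh_mul (by linarith)).mul_prod
    (integrable_cosh_mul_inv_cosh hp2 (Real.cos ζ))) (Continuous.aestronglyMeasurable
      (Continuous.inv₀ (by fun_prop) fun x => (sinh_sq_add_sin_sq_pos hs _).ne'))
      (Eventually.of_forall fun x => ?_)
  rw [norm_inv, Real.norm_of_nonneg (sinh_sq_add_sin_sq_pos hs _).le]
  gcongr
  linarith [sq_nonneg (Real.sinh (x.2 - x.1))]

/-- The factor cosh (2t) - cos ζ = 2 (sinh² t + sin² (ζ/2)) cancels the denominator produced by the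
inner integral, so only three elementary integrals remain. -/
theorem integral_realIntegrand {ζ : ℝ} (h0 : 0 < ζ) (h1 : ζ < Real.pi / 2) :
    ∫ x, realIntegrand ζ x = 2 * ζ * (Real.sin ζ - ζ * Real.cos ζ) / Real.sin ζ ^ 2 := by
  have hp2 : 2 < Real.pi / ζ := by rw [lt_div_iff₀ h0]; linarith
  have hp0 : 0 < Real.pi / ζ := by linarith
  have hs : 0 < Real.sin ζ := Real.sin_pos_of_pos_of_lt_pi h0 (by linarith [Real.pi_pos])
  have hs2 : 0 < Real.sin (ζ / 2) :=
    Real.sin_pos_of_pos_of_lt_pi (by linarith) (by linarith [Real.pi_pos])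
  have hc : 0 < Real.cos ζ := Real.cos_pos_of_mem_Ioo ⟨by linarith, h1⟩
  rw [Measure.volume_eq_prod, integral_prod_symm _ (integrable_realIntegrand h0 h1)]
  have e1 : ∀ t : ℝ, ∫ s : ℝ, realIntegrand ζ (s, t) = (Real.sin ζ * Real.cos ζ)⁻¹ *
      (2 * ζ * Real.sin ζ * (Real.cosh (Real.pi / ζ * t))⁻¹ -
        Real.pi * (Real.cosh (2 * t) * ((Real.cosh (Real.pi / ζ * t))⁻¹) ^ 2) +
        Real.pi * Real.cos ζ * ((Real.cosh (Real.pi / ζ * t))⁻¹) ^ 2) := by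
    intro t
    have h := integral_inv_cosh_div h0 h1 t
    have e : ∀ s : ℝ, realIntegrand ζ (s, t) = ((Real.cosh (Real.pi / ζ * t))⁻¹ *
        (Real.cosh (2 * t) - Real.cos ζ)) * ((Real.cosh (Real.pi / ζ * s))⁻¹ /
          (Real.sinh (t - s) ^ 2 + Real.sin ζ ^ 2)) := by
      intro s
      simp only [realIntegrand]
      ring
    simp only [e]
    rw [integral_const_mul, h]
    have h2 : Real.cosh (2 * t) - Real.cos ζ =
        2 * (Real.sinh t ^ 2 + Real.sin (ζ / 2) ^ 2) := by
      have := Real.cos_two_mul' (ζ / 2)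
      rw [mul_div_cancel₀ _ (two_ne_zero' ℝ)] at this
      rw [this, Real.cosh_two_mul]
      nlinarith [Real.cosh_sq t, Real.sin_sq_add_cos_sq (ζ / 2)]
    have h3 := sinh_sq_add_sin_sq_pos hs2 t
    have h4 : ζ * Real.sin ζ / (Real.sinh t ^ 2 + Real.sin (ζ / 2) ^ 2) *
        (Real.cosh (2 * t) - Real.cos ζ) = 2 * ζ * Real.sin ζ := by
      rw [h2]
      field_simp
    rw [← h4]
    ring
  simp only [e1]
  obtain ⟨i2, v2⟩ := integral_cosh_mul_inv_cosh_sq h0 h1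
  have i1 := integrable_inv_cosh_mul hp0
  have v1 := integral_inv_cosh_mul hp0
  have v3 := integral_inv_cosh_sq hp0
  have i3 : Integrable fun t : ℝ => ((Real.cosh (Real.pi / ζ * t))⁻¹) ^ 2 := by
    -- The integral of a non-integrable function is 0 by convention, so the nonzero value already
    -- found proves integrability.
    refine Integrable.of_integral_ne_zero ?_
    rw [v3]
    positivity
  have i4 : Integrable fun t : ℝ => 2 * ζ * Real.sin ζ * (Real.cosh (Real.pi / ζ * t))⁻¹ -
      Real.pi * (Real.cosh (2 * t) * ((Real.cosh (Real.pi / ζ * t))⁻¹) ^ 2) :=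
    (i1.const_mul _).sub (i2.const_mul _)
  rw [integral_const_mul, integral_add i4 (i3.const_mul _),
    integral_sub (i1.const_mul _) (i2.const_mul _), integral_const_mul, integral_const_mul,
    integral_const_mul, v1, v2, v3]
  have hpi := Real.pi_ne_zero
  field_simp
  nlinarith [Real.sin_sq_add_cos_sq ζ]

/-- Here sinh (π z / ζ) becomes ±i cosh (π x / ζ), and the two factors ±i multiply to 1. -/
theorem pairIntegrand_half {ζ θ φ σ : ℝ} (h0 : 0 < ζ) (x : ℝ × ℝ) :
    pairIntegrand (Real.pi / ζ) θ φ σ (ζ / 2) x =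
      Complex.sinh (x.1 + (θ + ζ / 2 : ℝ) * Complex.I) *
      Complex.sinh (x.2 + (φ - ζ / 2 : ℝ) * Complex.I) *
      (Complex.sinh ((x.2 - x.1 : ℝ) + (σ - ζ : ℝ) * Complex.I))⁻¹ *
      (((Real.cosh (Real.pi / ζ * x.1))⁻¹ * (Real.cosh (Real.pi / ζ * x.2))⁻¹ : ℝ) : ℂ) := by
  have hζ : (ζ : ℂ) ≠ 0 := Complex.ofReal_ne_zero.2 h0.ne'
  have e1 : ((Real.pi / ζ : ℝ) * (x.1 + (ζ / 2 : ℝ) * Complex.I) : ℂ) =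
      (Real.pi / ζ * x.1 : ℝ) + (Real.pi / 2 : ℝ) * Complex.I := by
    push_cast; field_simp
  have e2 : ((Real.pi / ζ : ℝ) * (x.2 + (-(ζ / 2) : ℝ) * Complex.I) : ℂ) =
      (Real.pi / ζ * x.2 : ℝ) - (Real.pi / 2 : ℝ) * Complex.I := by
    push_cast; field_simp; ring
  have e3 : (x.1 + (ζ / 2 : ℝ) * Complex.I + θ * Complex.I : ℂ) =
      x.1 + (θ + ζ / 2 : ℝ) * Complex.I := by push_cast; ring
  have e4 : (x.2 + (-(ζ / 2) : ℝ) * Complex.I + φ * Complex.I : ℂ) =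
      x.2 + (φ - ζ / 2 : ℝ) * Complex.I := by push_cast; ring
  have e5 : (x.2 + (-(ζ / 2) : ℝ) * Complex.I - (x.1 + (ζ / 2 : ℝ) * Complex.I) + σ * Complex.I : ℂ)
      = (x.2 - x.1 : ℝ) + (σ - ζ : ℝ) * Complex.I := by push_cast; ring
  have s1 : ∀ y : ℝ, Complex.sinh (y + (Real.pi / 2 : ℝ) * Complex.I) =
      (Real.cosh y : ℂ) * Complex.I := fun y => by
    rw [Complex.sinh_add, Complex.sinh_mul_I, Complex.cosh_mul_I, ← Complex.ofReal_cos,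
      ← Complex.ofReal_sin, Real.cos_pi_div_two, Real.sin_pi_div_two]
    simp
  have s2 : ∀ y : ℝ, Complex.sinh (y - (Real.pi / 2 : ℝ) * Complex.I) =
      -((Real.cosh y : ℂ) * Complex.I) := fun y => by
    rw [Complex.sinh_sub, Complex.sinh_mul_I, Complex.cosh_mul_I, ← Complex.ofReal_cos,
      ← Complex.ofReal_sin, Real.cos_pi_div_two, Real.sin_pi_div_two]
    simp
  rw [pairIntegrand, factor, factor, kernel, e1, e2, e3, e4, e5, s1, s2]
  have key : ((Real.cosh (Real.pi / ζ * x.1) : ℂ) * Complex.I)⁻¹ *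
      (-((Real.cosh (Real.pi / ζ * x.2) : ℂ) * Complex.I))⁻¹ =
      (((Real.cosh (Real.pi / ζ * x.1))⁻¹ * (Real.cosh (Real.pi / ζ * x.2))⁻¹ : ℝ) : ℂ) := by
    rw [← mul_inv, mul_neg, mul_mul_mul_comm, Complex.I_mul_I, mul_neg_one, neg_neg]
    push_cast
    rw [mul_inv]
  rw [← key]
  ring

/-- The reflection exchanges the shapes of the two contour terms: (ζ, 0, 0) goes to (-2ζ, ζ, 2ζ),
and (0, ζ, 2ζ) to (-ζ, 0, 0), both with a minus sign. This is the source of the equality between c =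
0 and c = 1. -/
theorem pairIntegrand_half_neg {ζ θ φ σ : ℝ} (h0 : 0 < ζ) (x : ℝ × ℝ) :
    pairIntegrand (Real.pi / ζ) θ φ σ (ζ / 2) (-x) =
      -pairIntegrand (Real.pi / ζ) (-θ - ζ) (ζ - φ) (2 * ζ - σ) (ζ / 2) x := by
  rw [pairIntegrand_half h0, pairIntegrand_half h0]
  have e1 : ((-x).1 + (θ + ζ / 2 : ℝ) * Complex.I : ℂ) =
      -(x.1 + (-θ - ζ + ζ / 2 : ℝ) * Complex.I) := by push_cast [Prod.fst_neg]; ring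
  have e2 : ((-x).2 + (φ - ζ / 2 : ℝ) * Complex.I : ℂ) =
      -(x.2 + (ζ - φ - ζ / 2 : ℝ) * Complex.I) := by push_cast [Prod.snd_neg]; ring
  have e3 : (((-x).2 - (-x).1 : ℝ) + (σ - ζ : ℝ) * Complex.I : ℂ) =
      -((x.2 - x.1 : ℝ) + (2 * ζ - σ - ζ : ℝ) * Complex.I) := by
    push_cast [Prod.snd_neg, Prod.fst_neg]; ring
  rw [e1, e2, e3, Complex.sinh_neg, Complex.sinh_neg, Complex.sinh_neg, inv_neg, Prod.fst_neg,
    Prod.snd_neg, mul_neg (Real.pi / ζ), mul_neg (Real.pi / ζ), Real.cosh_neg, Real.cosh_neg]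
  ring

/-- In the sum over the shifts ζ and -ζ the numerator contains cosh (2 x₁) + cosh (2 x₂) - 2 cos ζ.
It splits into two halves exchanged by the swap of the variables, so one real integral suffices. -/
theorem pairIntegrand_sum {ζ : ℝ} (h0 : 0 < ζ) (h1 : ζ < Real.pi / 2) (x : ℝ × ℝ) :
    (pairIntegrand (Real.pi / ζ) ζ 0 0 (ζ / 2) x -
        pairIntegrand (Real.pi / ζ) 0 ζ (2 * ζ) (ζ / 2) x) +
      (pairIntegrand (Real.pi / ζ) (-ζ) 0 0 (ζ / 2) x -
        pairIntegrand (Real.pi / ζ) (-ζ - ζ) ζ (2 * ζ) (ζ / 2) x) =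
      Complex.I * ((Real.sin ζ * Real.cos ζ *
        (realIntegrand ζ x + realIntegrand ζ x.swap) : ℝ) : ℂ) := by
  have hs : 0 < Real.sin ζ := Real.sin_pos_of_pos_of_lt_pi h0 (by linarith [Real.pi_pos])
  simp only [pairIntegrand_half h0]
  have hid := sinh_mul_sinh_add_sinh_identity x.2 x.1 ((ζ / 2 : ℝ) * Complex.I)
  have hdd := sinh_sub_mul_sinh_add (x.2 - x.1) ζ
  have hd1 : Complex.sinh ((x.2 - x.1 : ℝ) - ζ * Complex.I) ≠ 0 :=
    sinh_ne_zero_of_sin_ne_zero (by simpa using hs.ne')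
  have hd2 : Complex.sinh ((x.2 - x.1 : ℝ) + ζ * Complex.I) ≠ 0 :=
    sinh_ne_zero_of_sin_ne_zero (by simpa using hs.ne')
  set d1 := Complex.sinh ((x.2 - x.1 : ℝ) - ζ * Complex.I) with hd1'
  set d2 := Complex.sinh ((x.2 - x.1 : ℝ) + ζ * Complex.I) with hd2'
  have f1 : Complex.sinh ((x.2 - x.1 : ℝ) + (0 - ζ : ℝ) * Complex.I) = d1 := by
    rw [hd1']; congr 1; push_cast; ring
  have f2 : Complex.sinh ((x.2 - x.1 : ℝ) + (2 * ζ - ζ : ℝ) * Complex.I) = d2 := by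
    rw [hd2']; congr 1; push_cast; ring
  have f3 : Complex.sinh ((x.2 : ℂ) - x.1 + 2 * ((ζ / 2 : ℝ) * Complex.I)) = d2 := by
    rw [hd2']; congr 1; push_cast; ring
  have f4 : Complex.sinh ((x.2 : ℂ) - x.1 - 2 * ((ζ / 2 : ℝ) * Complex.I)) = d1 := by
    rw [hd1']; congr 1; push_cast; ring
  have f5 : (2 * ((ζ / 2 : ℝ) * Complex.I) : ℂ) = ζ * Complex.I := by push_cast; ring
  have f6 : Complex.sinh (2 * ((ζ / 2 : ℝ) * Complex.I)) = Real.sin ζ * Complex.I := by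
    rw [f5, Complex.sinh_mul_I, Complex.ofReal_sin]
  have f7 : Complex.cosh (2 * ((ζ / 2 : ℝ) * Complex.I)) = Real.cos ζ := by
    rw [f5, Complex.cosh_mul_I, Complex.ofReal_cos]
  have f8 : (x.1 + (ζ + ζ / 2 : ℝ) * Complex.I : ℂ) = x.1 + 3 * ((ζ / 2 : ℝ) * Complex.I) := by
    push_cast; ring
  have f9 : (x.2 + (0 - ζ / 2 : ℝ) * Complex.I : ℂ) = x.2 - (ζ / 2 : ℝ) * Complex.I := by
    push_cast; ring
  have f10 : (x.1 + (0 + ζ / 2 : ℝ) * Complex.I : ℂ) = x.1 + (ζ / 2 : ℝ) * Complex.I := by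
    push_cast; ring
  have f11 : (x.2 + (ζ - ζ / 2 : ℝ) * Complex.I : ℂ) = x.2 + (ζ / 2 : ℝ) * Complex.I := by
    push_cast; ring
  have f12 : (x.1 + (-ζ + ζ / 2 : ℝ) * Complex.I : ℂ) = x.1 - (ζ / 2 : ℝ) * Complex.I := by
    push_cast; ring
  have f13 : (x.1 + (-ζ - ζ + ζ / 2 : ℝ) * Complex.I : ℂ) = x.1 - 3 * ((ζ / 2 : ℝ) * Complex.I) := by
    push_cast; ring
  rw [f3, f4, f6, f7] at hid
  rw [f1, f2, f8, f9, f10, f11, f12, f13]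
  simp only [realIntegrand, Prod.fst_swap, Prod.snd_swap]
  have hsw : Real.sinh (x.1 - x.2) ^ 2 = Real.sinh (x.2 - x.1) ^ 2 := by
    rw [← neg_sub, Real.sinh_neg, neg_sq]
  rw [hsw]
  set w := (Real.cosh (Real.pi / ζ * x.1))⁻¹ * (Real.cosh (Real.pi / ζ * x.2))⁻¹ with hw
  have e : Real.sin ζ * Real.cos ζ * ((Real.cosh (Real.pi / ζ * x.1))⁻¹ *
      ((Real.cosh (Real.pi / ζ * x.2))⁻¹ * (Real.cosh (2 * x.2) - Real.cos ζ)) *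
      (Real.sinh (x.2 - x.1) ^ 2 + Real.sin ζ ^ 2)⁻¹ + (Real.cosh (Real.pi / ζ * x.2))⁻¹ *
      ((Real.cosh (Real.pi / ζ * x.1))⁻¹ * (Real.cosh (2 * x.1) - Real.cos ζ)) *
      (Real.sinh (x.2 - x.1) ^ 2 + Real.sin ζ ^ 2)⁻¹) =
      w * (Real.sin ζ * Real.cos ζ *
        (Real.cosh (2 * x.2) + Real.cosh (2 * x.1) - 2 * Real.cos ζ)) *
      (Real.sinh (x.2 - x.1) ^ 2 + Real.sin ζ ^ 2)⁻¹ := by rw [hw]; ring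
  rw [e, Complex.ofReal_mul (w * _), Complex.ofReal_inv, ← hdd, Complex.ofReal_mul w]
  generalize Complex.sinh (x.1 + 3 * ((ζ / 2 : ℝ) * Complex.I)) = a₁ at hid ⊢
  generalize Complex.sinh (x.1 - 3 * ((ζ / 2 : ℝ) * Complex.I)) = a₂ at hid ⊢
  generalize Complex.sinh (x.1 + (ζ / 2 : ℝ) * Complex.I) = a₃ at hid ⊢
  generalize Complex.sinh (x.1 - (ζ / 2 : ℝ) * Complex.I) = a₄ at hid ⊢
  generalize Complex.sinh (x.2 + (ζ / 2 : ℝ) * Complex.I) = a₅ at hid ⊢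
  generalize Complex.sinh (x.2 - (ζ / 2 : ℝ) * Complex.I) = a₆ at hid ⊢
  push_cast at hid ⊢
  generalize Complex.cosh (2 * x.1) = c₁ at hid ⊢
  generalize Complex.cosh (2 * x.2) = c₂ at hid ⊢
  field_simp
  linear_combination (w : ℂ) * hid

/-- The values at ζ and -ζ are equal by reflection, and their sum is known; each is half of it. -/
theorem limit_value {ζ θ : ℝ} (h0 : 0 < ζ) (h1 : ζ < Real.pi / 2) (hθ : θ = ζ ∨ θ = -ζ) :
    (∫ x, pairIntegrand (Real.pi / ζ) θ 0 0 (ζ / 2) x) -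
      ∫ x, pairIntegrand (Real.pi / ζ) (θ - ζ) ζ (2 * ζ) (ζ / 2) x =
      Complex.I * ((2 * ζ * Real.cos ζ * (Real.sin ζ - ζ * Real.cos ζ) / Real.sin ζ : ℝ) : ℂ) := by
  have hs : 0 < Real.sin ζ := Real.sin_pos_of_pos_of_lt_pi h0 (by linarith [Real.pi_pos])
  have i1 : ∀ θ, Integrable (pairIntegrand (Real.pi / ζ) θ 0 0 (ζ / 2)) := fun θ =>
    integrable_pairIntegrand h0 h1 (by linarith) (by linarith) (by
      rw [mul_div_cancel₀ _ (two_ne_zero' ℝ)]; simpa using hs.ne')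
  have i2 : ∀ θ, Integrable (pairIntegrand (Real.pi / ζ) θ ζ (2 * ζ) (ζ / 2)) := fun θ =>
    integrable_pairIntegrand h0 h1 (by linarith) (by linarith) (by
      rw [mul_div_cancel₀ _ (two_ne_zero' ℝ), neg_add_eq_sub, two_mul, add_sub_cancel_right]
      exact hs.ne')
  set Φ : ℝ → ℂ := fun θ => (∫ x, pairIntegrand (Real.pi / ζ) θ 0 0 (ζ / 2) x) -
      ∫ x, pairIntegrand (Real.pi / ζ) (θ - ζ) ζ (2 * ζ) (ζ / 2) x with hΦ
  have hsym : Φ ζ = Φ (-ζ) := by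
    simp only [hΦ]
    rw [← integral_neg_eq_self, ← integral_neg_eq_self (pairIntegrand _ (ζ - ζ) _ _ _)]
    simp only [pairIntegrand_half_neg h0]
    rw [integral_neg, integral_neg]
    simp only [sub_self, neg_zero, zero_sub, sub_zero]
    ring
  have hsum : Φ ζ + Φ (-ζ) =
      2 * (Complex.I * ((2 * ζ * Real.cos ζ * (Real.sin ζ - ζ * Real.cos ζ) / Real.sin ζ : ℝ) : ℂ)) := by
    simp only [hΦ]
    have i3 : ∀ θ θ', Integrable fun x => pairIntegrand (Real.pi / ζ) θ 0 0 (ζ / 2) x -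
        pairIntegrand (Real.pi / ζ) θ' ζ (2 * ζ) (ζ / 2) x := fun θ θ' => (i1 θ).sub (i2 θ')
    rw [← integral_sub (i1 _) (i2 _), ← integral_sub (i1 _) (i2 _),
      ← integral_add (i3 _ _) (i3 _ _), sub_self]
    simp only [pairIntegrand_sum h0 h1]
    have hi := integrable_realIntegrand h0 h1
    have hv := integral_realIntegrand h0 h1
    have hi' : Integrable fun x : ℝ × ℝ => realIntegrand ζ x.swap := hi.swap
    have hv' : ∫ x : ℝ × ℝ, realIntegrand ζ x.swap = ∫ x, realIntegrand ζ x :=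
      integral_prod_swap (realIntegrand ζ)
    rw [integral_const_mul, integral_complex_ofReal, integral_const_mul, integral_add hi hi', hv', hv]
    rw [mul_left_comm, mul_right_inj' Complex.I_ne_zero]
    norm_cast
    field_simp
    ring
  rcases hθ with rfl | rfl
  · change Φ θ = _
    linear_combination hsum / 2 + hsym / 2
  · change Φ (-ζ) = _
    linear_combination hsum / 2 - hsym / 2

end XXZ

end

/-! ### From the contour integrals to the normal form -/

section

open Set

namespace XXZ

/-- Both rows of the matrix are then supported in the same column, so the determinant vanishes. -/
theorem integrand_eq_zero {ζ ξ ε : ℝ} {a c : Fin 2} {g : Fin 2 → Fin 2} (hg : g 0 = g 1) :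
    integrand ζ ξ a c ε g = 0 := by
  ext x
  simp only [integrand, S, Matrix.det_fin_two, Matrix.of_apply, hg]
  have h : g 1 = 0 ∨ g 1 = 1 := by
    generalize g 1 = i
    fin_cases i <;> simp
  rcases h with h | h <;> simp [h]

theorem rho_add_eta_div_two {ζ : ℝ} (h0 : 0 < ζ) (z : ℂ) :
    rho ζ (z + eta ζ / 2) =
      (2 * ζ * Complex.I)⁻¹ * (Complex.sinh ((Real.pi / ζ : ℝ) * z))⁻¹ := by
  have hζ : (ζ : ℂ) ≠ 0 := Complex.ofReal_ne_zero.2 h0.ne'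
  have e : (Real.pi * (z + eta ζ / 2) / ζ : ℂ) =
      (Real.pi / ζ : ℝ) * z + (Real.pi / 2 : ℝ) * Complex.I := by
    rw [eta]; push_cast; field_simp
  rw [rho, e, Complex.cosh_add, Complex.cosh_mul_I, Complex.sinh_mul_I, ← Complex.ofReal_cos,
    ← Complex.ofReal_sin, Real.cos_pi_div_two, Real.sin_pi_div_two]
  simp only [Complex.ofReal_zero, Complex.ofReal_one, mul_zero, zero_add, one_mul, one_div, mul_inv]
  ring

/-- The shift of the first variable in the numerator of `Q`. -/
noncomputable def shift (ζ : ℝ) (c : Fin 2) : ℝ := if c = 0 then ζ else -ζ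

/-- Because w₂ = w₁ - η, the factor with k > j and the factor with k < j coincide. Hence the double
integral does not depend on a, and c enters only through the sign in `shift`. -/
theorem prod_row (ζ ξ : ℝ) (j : Fin 2) (l : ℂ) :
    (∏ k ∈ Finset.Iio j, Complex.sinh (l - w1 ζ ξ k + eta ζ)) *
      ∏ k ∈ Finset.Ioi j, Complex.sinh (l - w1 ζ ξ k) = Complex.sinh (l - ξ + eta ζ) := by
  have h1 : Finset.Iio (0 : Fin 2) = ∅ := rfl
  have h2 : Finset.Iio (1 : Fin 2) = {0} := rfl
  have h3 : Finset.Ioi (0 : Fin 2) = {1} := rfl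
  have h4 : Finset.Ioi (1 : Fin 2) = ∅ := rfl
  fin_cases j
  · simp [h1, h3, w1, sub_add]
  · simp [h2, h4, w1]

theorem prod_col (ζ ξ : ℝ) (c : Fin 2) (l : ℂ) :
    (∏ k ∈ Finset.Iio c, Complex.sinh (l - w1 ζ ξ k - eta ζ)) *
      ∏ k ∈ Finset.Ioi c, Complex.sinh (l - w1 ζ ξ k) =
        Complex.sinh (l - ξ + shift ζ c * Complex.I) := by
  have h1 : Finset.Iio (0 : Fin 2) = ∅ := rfl
  have h2 : Finset.Iio (1 : Fin 2) = {0} := rfl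
  have h3 : Finset.Ioi (0 : Fin 2) = {1} := rfl
  have h4 : Finset.Ioi (1 : Fin 2) = ∅ := rfl
  fin_cases c
  · simp [h1, h3, w1, sub_add, shift, eta, mul_comm]
  · simp [h2, h4, w1, shift, eta, mul_comm, sub_eq_add_neg]

theorem Q_eq (ζ ξ ε : ℝ) (j' j : Fin 2) (l1 l2 : ℂ) :
    Q ζ ξ ε j' j l1 l2 = -(Complex.sinh (l2 - ξ + eta ζ) *
      Complex.sinh (l1 - ξ + shift ζ j' * Complex.I) *
      (Complex.sinh (l2 - l1 + eta ζ + epsShift ε l1 l2))⁻¹ * (Complex.sinh (eta ζ))⁻¹) := by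
  rw [Q, prod_row, prod_col]
  simp [w1]
  ring

theorem integrand_id {ζ ξ ε : ℝ} (h0 : 0 < ζ) (hε : 0 < ε) (a c : Fin 2) (x : ℝ × ℝ) :
    integrand ζ ξ a c ε ![0, 1] x = (4 * ζ ^ 2 * Complex.sinh (eta ζ))⁻¹ *
      pairIntegrand (Real.pi / ζ) (shift ζ c) 0 (-ε) ε (x - (ξ, ξ)) := by
  obtain ⟨x1, x2⟩ := x
  set u : ℂ := ((x1 - ξ : ℝ) : ℂ) + ε * Complex.I with hu
  set v : ℂ := ((x2 - ξ : ℝ) : ℂ) + (-ε : ℝ) * Complex.I with hv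
  have hl1 : ((x1 : ℂ) - (((0 : Fin 2) : ℕ) : ℂ) * eta ζ + Complex.I * ε) = u + ξ := by
    rw [hu]; push_cast; simp; ring
  have hl2 : ((x2 : ℂ) - (((1 : Fin 2) : ℕ) : ℂ) * eta ζ - Complex.I * ε) = v + ξ - eta ζ := by
    rw [hv]; push_cast; simp; ring
  -- The imaginary part of λ₂ - λ₁ is -ζ - 2ε, which is negative.
  have hshift : epsShift ε (u + ξ) (v + ξ - eta ζ) = (-ε : ℝ) * Complex.I := by
    rw [epsShift, if_neg]
    · push_cast; ring
    · simp [hu, hv, eta]; linarith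
  have hr1 : (u + ξ - w1 ζ ξ 0 + eta ζ / 2 : ℂ) = u + eta ζ / 2 := by simp [w1]
  have hr2 : (v + ξ - eta ζ - w1 ζ ξ 1 + eta ζ / 2 : ℂ) = v + eta ζ / 2 := by simp [w1]
  have hk : (v + ξ - eta ζ - (u + ξ) + eta ζ + (-ε : ℝ) * Complex.I : ℂ) =
      v - u + (-ε : ℝ) * Complex.I := by ring
  have hA : (u + ξ - ξ : ℂ) = u := by ring
  have hB : (v + ξ - eta ζ - ξ + eta ζ : ℂ) = v + (0 : ℝ) * Complex.I := by push_cast; ring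
  have hS : (S ζ ξ ![0, 1] ![u + ξ, v + ξ - eta ζ]).det =
      rho ζ (u + eta ζ / 2) * rho ζ (v + eta ζ / 2) := by
    simp [S, Matrix.det_fin_two, ← hr1, ← hr2]
  simp only [integrand, Matrix.cons_val_zero, Matrix.cons_val_one, hl1, hl2]
  rw [hS, Q_eq, hshift, hk, hA, hB, rho_add_eta_div_two h0, rho_add_eta_div_two h0, pairIntegrand,
    factor, factor, kernel]
  simp only [Prod.mk_sub_mk, ← hu, ← hv]
  have hI : (2 * ζ * Complex.I : ℂ)⁻¹ * (2 * ζ * Complex.I : ℂ)⁻¹ = -(4 * (ζ : ℂ) ^ 2)⁻¹ := by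
    rw [← mul_inv, ← inv_neg]
    congr 1
    linear_combination 4 * (ζ : ℂ) ^ 2 * Complex.I_sq
  rw [mul_inv (4 * (ζ : ℂ) ^ 2)]
  linear_combination -(Complex.sinh (u + shift ζ c * Complex.I) *
    Complex.sinh (v + (0 : ℝ) * Complex.I) * (Complex.sinh (v - u + (-ε : ℝ) * Complex.I))⁻¹ *
    (Complex.sinh (eta ζ))⁻¹ * (Complex.sinh ((Real.pi / ζ : ℝ) * u))⁻¹ *
    (Complex.sinh ((Real.pi / ζ : ℝ) * v))⁻¹) * hI

theorem integrand_swap {ζ ξ ε : ℝ} (h0 : 0 < ζ) (hεζ : ε < ζ / 2) (a c : Fin 2)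
    (x : ℝ × ℝ) :
    integrand ζ ξ a c ε ![1, 0] x = -(4 * ζ ^ 2 * Complex.sinh (eta ζ))⁻¹ *
      pairIntegrand (Real.pi / ζ) (shift ζ c - ζ) ζ (2 * ζ + ε) ε (x - (ξ, ξ)) := by
  obtain ⟨x1, x2⟩ := x
  set u : ℂ := ((x1 - ξ : ℝ) : ℂ) + ε * Complex.I with hu
  set v : ℂ := ((x2 - ξ : ℝ) : ℂ) + (-ε : ℝ) * Complex.I with hv
  have hl1 : ((x1 : ℂ) - (((1 : Fin 2) : ℕ) : ℂ) * eta ζ + Complex.I * ε) = u + ξ - eta ζ := by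
    rw [hu]; push_cast; simp; ring
  have hl2 : ((x2 : ℂ) - (((0 : Fin 2) : ℕ) : ℂ) * eta ζ - Complex.I * ε) = v + ξ := by
    rw [hv]; push_cast; simp; ring
  -- The imaginary part of λ₂ - λ₁ is ζ - 2ε, which is positive because ε < ζ/2.
  have hshift : epsShift ε (u + ξ - eta ζ) (v + ξ) = ε * Complex.I := by
    rw [epsShift, if_pos]
    · ring
    · simp [hu, hv, eta]; linarith
  have hr1 : (u + ξ - eta ζ - w1 ζ ξ 1 + eta ζ / 2 : ℂ) = u + eta ζ / 2 := by simp [w1]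
  have hr2 : (v + ξ - w1 ζ ξ 0 + eta ζ / 2 : ℂ) = v + eta ζ / 2 := by simp [w1]
  have hk : (v + ξ - (u + ξ - eta ζ) + eta ζ + ε * Complex.I : ℂ) =
      v - u + (2 * ζ + ε : ℝ) * Complex.I := by rw [eta]; push_cast; ring
  have hA : (u + ξ - eta ζ - ξ + shift ζ c * Complex.I : ℂ) =
      u + (shift ζ c - ζ : ℝ) * Complex.I := by rw [eta]; push_cast; ring
  have hB : (v + ξ - ξ + eta ζ : ℂ) = v + ζ * Complex.I := by rw [eta]; ring
  have hS : (S ζ ξ ![1, 0] ![u + ξ - eta ζ, v + ξ]).det =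
      -(rho ζ (u + eta ζ / 2) * rho ζ (v + eta ζ / 2)) := by
    simp [S, Matrix.det_fin_two, ← hr1, ← hr2]
  simp only [integrand, Matrix.cons_val_zero, Matrix.cons_val_one, hl1, hl2]
  rw [hS, Q_eq, hshift, hk, hA, hB, rho_add_eta_div_two h0, rho_add_eta_div_two h0, pairIntegrand,
    factor, factor, kernel]
  simp only [Prod.mk_sub_mk, ← hu, ← hv]
  have hI : (2 * ζ * Complex.I : ℂ)⁻¹ * (2 * ζ * Complex.I : ℂ)⁻¹ = -(4 * (ζ : ℂ) ^ 2)⁻¹ := by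
    rw [← mul_inv, ← inv_neg]
    congr 1
    linear_combination 4 * (ζ : ℂ) ^ 2 * Complex.I_sq
  rw [mul_inv (4 * (ζ : ℂ) ^ 2)]
  linear_combination (Complex.sinh (u + (shift ζ c - ζ : ℝ) * Complex.I) *
    Complex.sinh (v + ζ * Complex.I) * (Complex.sinh (v - u + (2 * ζ + ε : ℝ) * Complex.I))⁻¹ *
    (Complex.sinh (eta ζ))⁻¹ * (Complex.sinh ((Real.pi / ζ : ℝ) * u))⁻¹ *
    (Complex.sinh ((Real.pi / ζ : ℝ) * v))⁻¹) * hI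

theorem doubleIntegral_eq (ζ ξ ε : ℝ) (a c : Fin 2) :
    doubleIntegral ζ ξ a c ε = (∫ x, integrand ζ ξ a c ε ![0, 1] x) +
      ∫ x, integrand ζ ξ a c ε ![1, 0] x := by
  rw [doubleIntegral, ← (finTwoArrowEquiv (Fin 2)).symm.sum_comp, Fintype.sum_prod_type]
  simp only [Fin.sum_univ_two, finTwoArrowEquiv_symm_apply]
  rw [integrand_eq_zero (g := ![0, 0]) rfl, integrand_eq_zero (g := ![1, 1]) rfl]
  simp

theorem sin_ne_zero_of_mem_Ioo_neg {y : ℝ} (h : -Real.pi < y) (h' : y < 0) : Real.sin y ≠ 0 :=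
  (Real.sin_neg_of_neg_of_neg_pi_lt h' h).ne

theorem integrable_integrand {ζ ξ ε : ℝ} (h0 : 0 < ζ) (h1 : ζ < Real.pi / 2) (hε : 0 < ε)
    (hεζ : ε < ζ / 2) (a c : Fin 2) (g : Fin 2 → Fin 2) : Integrable (integrand ζ ξ a c ε g) := by
  have hg : g = ![g 0, g 1] := by
    ext i
    fin_cases i <;> rfl
  by_cases h : g 0 = g 1
  · rw [integrand_eq_zero h]
    exact integrable_zero _ _ _
  · have h' : g = ![0, 1] ∨ g = ![1, 0] := by
      generalize g 0 = i at h hg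
      generalize g 1 = j at h hg
      fin_cases i <;> fin_cases j <;> simp_all
    rcases h' with rfl | rfl
    · rw [funext (integrand_id h0 hε a c)]
      refine ((integrable_pairIntegrand h0 h1 hε (by linarith) ?_).comp_sub_right (ξ, ξ)).const_mul _
      exact sin_ne_zero_of_mem_Ioo_neg (by linarith) (by linarith)
    · rw [funext (integrand_swap h0 hεζ a c)]
      refine ((integrable_pairIntegrand h0 h1 hε (by linarith) ?_).comp_sub_right (ξ, ξ)).const_mul _
      exact (Real.sin_pos_of_pos_of_lt_pi (by linarith) (by linarith)).ne'

/-- During the move the imaginary part of the kernel's argument runs over [-ζ - ε, -3ε] in one term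
and over [ζ + ε, 2ζ - ε] in the other. Both avoid the multiples of π, as 2ζ < π. -/
theorem doubleIntegral_eq_half {ζ ξ ε : ℝ} (h0 : 0 < ζ) (h1 : ζ < Real.pi / 2) (hε : 0 < ε)
    (hεζ : ε < ζ / 2) (a c : Fin 2) :
    doubleIntegral ζ ξ a c ε = (4 * ζ ^ 2 * Complex.sinh (eta ζ))⁻¹ *
      ((∫ x, pairIntegrand (Real.pi / ζ) (shift ζ c) 0 (-ε) (ζ / 2) x) -
        ∫ x, pairIntegrand (Real.pi / ζ) (shift ζ c - ζ) ζ (2 * ζ + ε) (ζ / 2) x) := by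
  rw [doubleIntegral_eq]
  simp only [integrand_id h0 hε, integrand_swap h0 hεζ]
  rw [integral_const_mul, integral_const_mul, integral_sub_right_eq_self
    (pairIntegrand _ _ _ _ _), integral_sub_right_eq_self (pairIntegrand _ _ _ _ _),
    integral_pairIntegrand_eq h0 h1 hε hεζ.le, integral_pairIntegrand_eq h0 h1 hε hεζ.le]
  · ring
  · intro y hy
    exact (Real.sin_pos_of_pos_of_lt_pi (by linarith [hy.1]) (by linarith [hy.2])).ne'
  · intro y hy
    exact sin_ne_zero_of_mem_Ioo_neg (by linarith [hy.1]) (by linarith [hy.2])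

theorem tendsto_doubleIntegral {ζ : ℝ} (h0 : 0 < ζ) (h1 : ζ < Real.pi / 2) (ξ : ℝ) (a c : Fin 2) :
    Tendsto (fun ε => 2 * doubleIntegral ζ ξ a c ε) (𝓝[>] 0) (𝓝 (onePoint ζ : ℂ)) := by
  have hs : 0 < Real.sin ζ := Real.sin_pos_of_pos_of_lt_pi h0 (by linarith [Real.pi_pos])
  have t1 : Tendsto (fun ε : ℝ => -ε) (𝓝[>] 0) (𝓝 0) := by
    have : Tendsto (fun ε : ℝ => -ε) (𝓝 0) (𝓝 (-0)) := tendsto_id.neg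
    rw [neg_zero] at this
    exact this.mono_left nhdsWithin_le_nhds
  have t2 : Tendsto (fun ε : ℝ => 2 * ζ + ε) (𝓝[>] 0) (𝓝 (2 * ζ)) := by
    have : Tendsto (fun ε : ℝ => 2 * ζ + ε) (𝓝 0) (𝓝 (2 * ζ + 0)) := tendsto_id.const_add _
    rw [add_zero] at this
    exact this.mono_left nhdsWithin_le_nhds
  have l1 := tendsto_integral_pairIntegrand (θ := shift ζ c) (φ := 0) h0 h1
    (sin_ne_zero_of_mem_Ioo_neg (by linarith) (by linarith)) t1
  have l2 := tendsto_integral_pairIntegrand (θ := shift ζ c - ζ) (φ := ζ) h0 h1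
    (Real.sin_pos_of_pos_of_lt_pi (by linarith) (by linarith)).ne' t2
  have l := ((l1.sub l2).const_mul (4 * (ζ : ℂ) ^ 2 * Complex.sinh (eta ζ))⁻¹).const_mul 2
  rw [limit_value h0 h1 (by unfold shift; split_ifs <;> simp)] at l
  have hv : 2 * ((4 * (ζ : ℂ) ^ 2 * Complex.sinh (eta ζ))⁻¹ * (Complex.I *
      ((2 * ζ * Real.cos ζ * (Real.sin ζ - ζ * Real.cos ζ) / Real.sin ζ : ℝ) : ℂ))) =
      onePoint ζ := by
    have hζ : (ζ : ℂ) ≠ 0 := Complex.ofReal_ne_zero.2 h0.ne'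
    have hs' : (Real.sin ζ : ℂ) ≠ 0 := Complex.ofReal_ne_zero.2 hs.ne'
    have hI := Complex.I_ne_zero
    rw [eta, mul_comm Complex.I, Complex.sinh_mul_I, ← Complex.ofReal_sin, onePoint,
      Complex.ofReal_div, Complex.ofReal_div, Complex.ofReal_mul ζ, Complex.ofReal_pow]
    simp only [Complex.ofReal_mul]
    field_simp
    norm_num
  rw [hv] at l
  refine l.congr' ?_
  filter_upwards [Ioo_mem_nhdsGT (half_pos h0)] with ε hε
  rw [doubleIntegral_eq_half h0 h1 hε.1 hε.2]

end XXZ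

end

/-! ### Operators on one and two sites, and the Yang-Baxter equation -/

section

open Set
open scoped Kronecker

namespace XXZ

variable {N : ℕ}

theorem siteOp_mul_apply (j : Fin N × Fin 2) (A : Matrix (Fin 2) (Fin 2) ℂ) (M : Op N)
    (σ τ : Conf N) :
    (siteOp j A * M) σ τ = ∑ x, A (σ j) x * M (Function.update σ j x) τ := by
  rw [Matrix.mul_apply]
  symm
  refine Finset.sum_of_injOn (fun x => Function.update σ j x) ?_ (by simp) ?_ ?_
  · intro x _ y _ h
    simpa using congrFun h j
  · intro ρ _ hρ
    simp only [siteOp, Matrix.of_apply]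
    rw [if_neg, zero_mul]
    intro h
    refine hρ ⟨ρ j, by simp, ?_⟩
    ext k
    by_cases hk : k = j
    · subst hk; simp
    · simp [hk, h k hk]
  · intro x _
    simp only [siteOp, Matrix.of_apply]
    rw [if_pos fun k hk => by simp [hk]]
    simp

/-- A `4 × 4` matrix acting on the sites `j` and `k`. -/
def twoSiteOp (j k : Fin N × Fin 2) (A : TwoSite) : Op N :=
  Matrix.of fun σ τ =>
    if ∀ m, m ≠ j → m ≠ k → σ m = τ m then A (σ j, σ k) (τ j, τ k) else 0

theorem twoSiteOp_mul_apply {j k : Fin N × Fin 2} (hjk : j ≠ k) (A : TwoSite) (M : Op N)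
    (σ τ : Conf N) :
    (twoSiteOp j k A * M) σ τ =
      ∑ x, A (σ j, σ k) x * M (Function.update (Function.update σ j x.1) k x.2) τ := by
  rw [Matrix.mul_apply]
  symm
  refine Finset.sum_of_injOn (fun x : Fin 2 × Fin 2 =>
    Function.update (Function.update σ j x.1) k x.2) ?_ (by simp) ?_ ?_
  · intro x _ y _ h
    have h1 := congrFun h j
    have h2 := congrFun h k
    simp [hjk] at h1 h2
    exact Prod.ext h1 h2
  · intro ρ _ hρ
    simp only [twoSiteOp, Matrix.of_apply]
    rw [if_neg, zero_mul]
    intro h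
    refine hρ ⟨(ρ j, ρ k), by simp, ?_⟩
    ext m
    by_cases hk : m = k
    · subst hk; simp
    · by_cases hj : m = j
      · subst hj; simp [hk]
      · simp [hk, hj, h m hj hk]
  · intro x _
    simp only [twoSiteOp, Matrix.of_apply]
    rw [if_pos fun m hj hk => by simp [hk, hj]]
    simp [hjk]

theorem twoSiteOp_mul {j k : Fin N × Fin 2} (hjk : j ≠ k) (A B : TwoSite) :
    twoSiteOp j k A * twoSiteOp j k B = twoSiteOp j k (A * B) := by
  ext σ τ
  rw [twoSiteOp_mul_apply hjk]
  simp only [twoSiteOp, Matrix.of_apply, Matrix.mul_apply]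
  by_cases h : ∀ m, m ≠ j → m ≠ k → σ m = τ m
  · rw [if_pos h]
    refine Finset.sum_congr rfl fun x _ => ?_
    rw [if_pos fun m hj hk => by simp [hk, hj, h m hj hk]]
    simp [hjk]
  · rw [if_neg h]
    refine Finset.sum_eq_zero fun x _ => ?_
    rw [if_neg, mul_zero]
    intro h'
    exact h fun m hj hk => by simpa [hk, hj] using h' m hj hk

theorem twoSiteOp_add (j k : Fin N × Fin 2) (A B : TwoSite) :
    twoSiteOp j k (A + B) = twoSiteOp j k A + twoSiteOp j k B := by
  ext σ τ
  simp only [twoSiteOp, Matrix.of_apply, Matrix.add_apply]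
  split_ifs <;> simp

theorem siteOp_add (j : Fin N × Fin 2) (A B : Matrix (Fin 2) (Fin 2) ℂ) :
    siteOp j (A + B) = siteOp j A + siteOp j B := by
  ext σ τ
  simp only [siteOp, Matrix.of_apply, Matrix.add_apply]
  split_ifs <;> simp

theorem siteOp_smul (j : Fin N × Fin 2) (r : ℂ) (A : Matrix (Fin 2) (Fin 2) ℂ) :
    siteOp j (r • A) = r • siteOp j A := by
  ext σ τ
  simp only [siteOp, Matrix.of_apply, Matrix.smul_apply]
  split_ifs <;> simp

theorem siteOp_mul (j : Fin N × Fin 2) (A B : Matrix (Fin 2) (Fin 2) ℂ) :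
    siteOp j A * siteOp j B = siteOp j (A * B) := by
  ext σ τ
  rw [siteOp_mul_apply]
  simp only [siteOp, Matrix.of_apply, Matrix.mul_apply]
  by_cases h : ∀ m, m ≠ j → σ m = τ m
  · rw [if_pos h]
    refine Finset.sum_congr rfl fun x _ => ?_
    rw [if_pos fun m hj => by simp [hj, h m hj]]
    simp
  · rw [if_neg h]
    refine Finset.sum_eq_zero fun x _ => ?_
    rw [if_neg, mul_zero]
    intro h'
    exact h fun m hj => by simpa [hj] using h' m hj

theorem siteOp_mul_siteOp {j k : Fin N × Fin 2} (hjk : j ≠ k) (A B : Matrix (Fin 2) (Fin 2) ℂ) :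
    siteOp j A * siteOp k B = twoSiteOp j k (A ⊗ₖ B) := by
  ext σ τ
  rw [siteOp_mul_apply]
  simp only [siteOp, twoSiteOp, Matrix.of_apply, Matrix.kroneckerMap_apply]
  rw [Finset.sum_eq_single (τ j)]
  · rw [Function.update_of_ne hjk.symm, mul_ite, mul_zero]
    refine if_congr ⟨fun h m hj hk => by simpa [hj] using h m hk, fun h m hk => ?_⟩ rfl rfl
    by_cases hj : m = j
    · subst hj; simp
    · simpa [hj] using h m hj hk
  · intro x _ hx
    rw [if_neg, mul_zero]
    intro h
    exact hx (by simpa using h j hjk)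
  · simp

theorem twoSiteOp_comm {j k : Fin N × Fin 2} (A B : Matrix (Fin 2) (Fin 2) ℂ) :
    twoSiteOp j k (A ⊗ₖ B) = twoSiteOp k j (B ⊗ₖ A) := by
  ext σ τ
  simp only [twoSiteOp, Matrix.of_apply, Matrix.kroneckerMap_apply]
  exact if_congr ⟨fun h m hj hk => h m hk hj, fun h m hj hk => h m hk hj⟩ (mul_comm _ _) rfl

theorem commute_siteOp {j k : Fin N × Fin 2} (hjk : j ≠ k) (A B : Matrix (Fin 2) (Fin 2) ℂ) :
    Commute (siteOp j A) (siteOp k B) := by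
  rw [Commute, SemiconjBy, siteOp_mul_siteOp hjk, siteOp_mul_siteOp hjk.symm, twoSiteOp_comm]

theorem commute_twoSiteOp_siteOp {j k m : Fin N × Fin 2} (hjk : j ≠ k) (hj : m ≠ j) (hk : m ≠ k)
    (A : TwoSite) (B : Matrix (Fin 2) (Fin 2) ℂ) :
    Commute (twoSiteOp j k A) (siteOp m B) := by
  ext σ τ
  rw [twoSiteOp_mul_apply hjk, siteOp_mul_apply]
  simp only [siteOp, twoSiteOp, Matrix.of_apply]
  rw [Finset.sum_eq_single (τ j, τ k), Finset.sum_eq_single (τ m)]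
  · simp only [Function.update_of_ne hj.symm, Function.update_of_ne hk.symm,
      Function.update_of_ne hj, Function.update_of_ne hk, mul_ite, mul_zero]
    refine if_congr ⟨fun h n hnj hnk => ?_, fun h n hnm => ?_⟩ (mul_comm _ _) rfl
    · by_cases hn : n = m
      · subst hn; simp
      · simpa [hn, hnj, hnk] using h n hn
    · by_cases hnk : n = k
      · subst hnk; simp
      · by_cases hnj : n = j
        · subst hnj; simp [hnk]
        · simpa [hnm, hnj, hnk] using h n hnj hnk
  · intro x _ hx
    rw [if_neg, mul_zero]
    intro h
    exact hx (by simpa using h m hj hk)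
  · simp
  · intro x _ hx
    rw [if_neg, mul_zero]
    intro h
    refine hx (Prod.ext ?_ ?_)
    · simpa [hjk] using h j hj.symm
    · simpa using h k hk.symm
  · simp

/-- The block of the matrix `R` at the entry `(a, c)` of its first tensor factor. -/
def laxMat (R : TwoSite) (a c : Fin 2) : Matrix (Fin 2) (Fin 2) ℂ :=
  Matrix.of fun b d => R (a, b) (c, d)

theorem lax_apply (R : TwoSite) (j : Fin N × Fin 2) (a c : Fin 2) :
    lax R j a c = siteOp j (laxMat R a c) := rfl

theorem RPrincipal_comm (ζ : ℝ) (u : ℂ) (a b c d : Fin 2) :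
    RPrincipal ζ u (a, b) (c, d) = RPrincipal ζ u (b, a) (d, c) := by
  fin_cases a <;> fin_cases b <;> fin_cases c <;> fin_cases d <;> simp [RPrincipal, sixVertex]

theorem RPrincipal_symm (ζ : ℝ) (u : ℂ) (x y : Fin 2 × Fin 2) :
    RPrincipal ζ u x y = RPrincipal ζ u y x := by
  obtain ⟨a, b⟩ := x
  obtain ⟨c, d⟩ := y
  fin_cases a <;> fin_cases b <;> fin_cases c <;> fin_cases d <;> simp [RPrincipal, sixVertex]

/-- Conservation of the number of down spins and the up-down symmetry reduce the 64 entries to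
trivial ones and three scalar relations. -/
theorem yang_baxter_sixVertex {b₁ c₁ b₂ c₂ b₃ c₃ : ℂ} (e₁ : c₂ = b₁ * c₂ * b₃ + c₁ * c₃)
    (e₂ : b₂ * c₁ = b₁ * c₂ * c₃ + c₁ * b₃) (e₃ : c₃ * b₂ = b₁ * c₃ + c₁ * c₂ * b₃)
    (a b c a' b' c' : Fin 2) :
    ∑ x, ∑ y, ∑ z, sixVertex b₁ c₁ c₁ (a, b) (x, y) * sixVertex b₂ c₂ c₂ (x, c) (a', z) *
      sixVertex b₃ c₃ c₃ (y, z) (b', c') =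
    ∑ x, ∑ y, ∑ z, sixVertex b₃ c₃ c₃ (b, c) (y, z) * sixVertex b₂ c₂ c₂ (a, z) (x, c') *
      sixVertex b₁ c₁ c₁ (x, y) (a', b') := by
  simp only [Fin.sum_univ_two]
  fin_cases a <;> fin_cases b <;> fin_cases c <;> fin_cases a' <;> fin_cases b' <;> fin_cases c' <;>
    simp [sixVertex] <;>
    first
    | ring1
    | linear_combination e₁
    | linear_combination -e₁
    | linear_combination e₂
    | linear_combination -e₂
    | linear_combination e₃
    | linear_combination -e₃

/-- The Yang-Baxter equation. -/
theorem yang_baxter {ζ : ℝ} {u v : ℂ} (hu : Complex.sinh (u + eta ζ) ≠ 0)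
    (hv : Complex.sinh (v + eta ζ) ≠ 0) (huv : Complex.sinh (v - u + eta ζ) ≠ 0)
    (a b c a' b' c' : Fin 2) :
    ∑ x, ∑ y, ∑ z, RPrincipal ζ (v - u) (a, b) (x, y) * RPrincipal ζ v (x, c) (a', z) *
      RPrincipal ζ u (y, z) (b', c') =
    ∑ x, ∑ y, ∑ z, RPrincipal ζ u (b, c) (y, z) * RPrincipal ζ v (a, z) (x, c') *
      RPrincipal ζ (v - u) (x, y) (a', b') := by
  have := Complex.exp_ne_zero u
  have := Complex.exp_ne_zero v
  have := Complex.exp_ne_zero (eta ζ)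
  refine yang_baxter_sixVertex ?_ ?_ ?_ a b c a' b' c'
  · field_simp
    simp only [Complex.sinh, Complex.exp_neg, Complex.exp_add, Complex.exp_sub]
    field_simp
    ring
  · field_simp
    simp only [Complex.sinh, Complex.exp_neg, Complex.exp_add, Complex.exp_sub]
    field_simp
    ring
  · field_simp
    simp only [Complex.sinh, Complex.exp_neg, Complex.exp_add, Complex.exp_sub]
    field_simp
    ring

end XXZ

end

/-! ### The RTT relation and the commutation of the B operators -/

section

open Set
open scoped Kronecker

namespace XXZ

variable {N : ℕ}

/-- The part of a monodromy matrix which belongs to a list of sites. -/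
noncomputable def transfer (ζ : ℝ) (ξ : Fin N → ℝ) (l : List (Fin N × Fin 2)) (lam : ℂ) :
    Matrix (Fin 2) (Fin 2) (Op N) :=
  (l.map fun j => lax (RPrincipal ζ (lam - w ζ ξ j)) j).prod

theorem transfer_nil (ζ : ℝ) (ξ : Fin N → ℝ) (lam : ℂ) : transfer ζ ξ [] lam = 1 := rfl

theorem transfer_cons (ζ : ℝ) (ξ : Fin N → ℝ) (j : Fin N × Fin 2) (l : List (Fin N × Fin 2))
    (lam : ℂ) :
    transfer ζ ξ (j :: l) lam = lax (RPrincipal ζ (lam - w ζ ξ j)) j * transfer ζ ξ l lam := by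
  rw [transfer, List.map_cons, List.prod_cons, transfer]

theorem transfer_append (ζ : ℝ) (ξ : Fin N → ℝ) (l₁ l₂ : List (Fin N × Fin 2)) (lam : ℂ) :
    transfer ζ ξ (l₁ ++ l₂) lam = transfer ζ ξ l₁ lam * transfer ζ ξ l₂ lam := by
  rw [transfer, List.map_append, List.prod_append, transfer, transfer]

theorem commute_transfer {ζ : ℝ} {ξ : Fin N → ℝ} {l : List (Fin N × Fin 2)} {V : Op N}
    (h : ∀ j ∈ l, ∀ A, Commute V (siteOp j A)) (lam : ℂ) (a c : Fin 2) :
    Commute V (transfer ζ ξ l lam a c) := by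
  induction l generalizing a c with
  | nil =>
    rw [transfer_nil, Matrix.one_apply]
    split_ifs
    · exact Commute.one_right V
    · exact Commute.zero_right V
  | cons j l ih =>
    rw [transfer_cons, Matrix.mul_apply]
    refine Commute.sum_right _ _ _ fun b _ => Commute.mul_right ?_ ?_
    · exact h j (by simp) _
    · exact ih (fun k hk => h k (by simp [hk])) b c

/-- A matrix over the first of two auxiliary spaces. -/
def auxFst (M : Matrix (Fin 2) (Fin 2) (Op N)) : Matrix (Fin 2 × Fin 2) (Fin 2 × Fin 2) (Op N) :=
  Matrix.of fun p q => if p.2 = q.2 then M p.1 q.1 else 0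

/-- A matrix over the second of two auxiliary spaces. -/
def auxSnd (M : Matrix (Fin 2) (Fin 2) (Op N)) : Matrix (Fin 2 × Fin 2) (Fin 2 × Fin 2) (Op N) :=
  Matrix.of fun p q => if p.1 = q.1 then M p.2 q.2 else 0

theorem auxFst_mul (A B : Matrix (Fin 2) (Fin 2) (Op N)) :
    auxFst (A * B) = auxFst A * auxFst B := by
  refine Matrix.ext fun p q => ?_
  rw [Matrix.mul_apply, Fintype.sum_prod_type]
  simp only [auxFst, Matrix.of_apply]
  by_cases h : p.2 = q.2
  · simp [h, Matrix.mul_apply]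
  · simp [h]

theorem auxSnd_mul (A B : Matrix (Fin 2) (Fin 2) (Op N)) :
    auxSnd (A * B) = auxSnd A * auxSnd B := by
  refine Matrix.ext fun p q => ?_
  rw [Matrix.mul_apply, Fintype.sum_prod_type_right]
  simp only [auxSnd, Matrix.of_apply]
  by_cases h : p.1 = q.1
  · simp [h, Matrix.mul_apply]
  · simp [h]

theorem auxFst_mul_auxSnd_apply (A B : Matrix (Fin 2) (Fin 2) (Op N)) (p q : Fin 2 × Fin 2) :
    (auxFst A * auxSnd B) p q = A p.1 q.1 * B p.2 q.2 := by
  simp [auxFst, auxSnd, Matrix.mul_apply, Fintype.sum_prod_type, ite_mul, mul_ite]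

theorem auxSnd_mul_auxFst_apply (A B : Matrix (Fin 2) (Fin 2) (Op N)) (p q : Fin 2 × Fin 2) :
    (auxSnd B * auxFst A) p q = B p.2 q.2 * A p.1 q.1 := by
  simp [auxFst, auxSnd, Matrix.mul_apply, Fintype.sum_prod_type_right, ite_mul, mul_ite]

theorem commute_auxFst_auxSnd {A B : Matrix (Fin 2) (Fin 2) (Op N)}
    (h : ∀ a b c d, Commute (A a b) (B c d)) : Commute (auxFst A) (auxSnd B) := by
  rw [Commute, SemiconjBy]
  ext p q : 2
  rw [auxFst_mul_auxSnd_apply, auxSnd_mul_auxFst_apply, (h _ _ _ _).eq]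

theorem siteOp_sum {ι : Type*} (s : Finset ι) (j : Fin N × Fin 2)
    (A : ι → Matrix (Fin 2) (Fin 2) ℂ) : siteOp j (∑ i ∈ s, A i) = ∑ i ∈ s, siteOp j (A i) :=
  map_sum (AddMonoidHom.mk' (siteOp j) (siteOp_add j)) A s

theorem twoSiteOp_sum {ι : Type*} (s : Finset ι) (j k : Fin N × Fin 2) (A : ι → TwoSite) :
    twoSiteOp j k (∑ i ∈ s, A i) = ∑ i ∈ s, twoSiteOp j k (A i) :=
  map_sum (AddMonoidHom.mk' (twoSiteOp j k) (twoSiteOp_add j k)) A s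

/-- The Yang-Baxter equation, with the quantum site as the third space. -/
theorem RTT_site {ζ : ℝ} {lam mu : ℂ} (j : Fin N × Fin 2)
    (hlam : Complex.sinh (lam + eta ζ) ≠ 0) (hmu : Complex.sinh (mu + eta ζ) ≠ 0)
    (hlm : Complex.sinh (lam - mu + eta ζ) ≠ 0) :
    (RPrincipal ζ (lam - mu)).map (algebraMap ℂ (Op N)) *
      (auxFst (lax (RPrincipal ζ lam) j) * auxSnd (lax (RPrincipal ζ mu) j)) =
    auxSnd (lax (RPrincipal ζ mu) j) * auxFst (lax (RPrincipal ζ lam) j) *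
      (RPrincipal ζ (lam - mu)).map (algebraMap ℂ (Op N)) := by
  ext ⟨a, b⟩ ⟨a', b'⟩ : 2
  simp only [Matrix.mul_apply (M := Matrix.map _ _), Matrix.mul_apply (N := Matrix.map _ _),
    auxFst_mul_auxSnd_apply, auxSnd_mul_auxFst_apply, Matrix.map_apply, lax_apply, siteOp_mul,
    ← Algebra.smul_def, ← Algebra.commutes, ← siteOp_smul, ← siteOp_sum]
  congr 1
  ext c c'
  have h := yang_baxter hmu hlam hlm a b c a' b' c'
  simp only [Matrix.sum_apply, Matrix.smul_apply, Matrix.mul_apply, laxMat, Matrix.of_apply,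
    Fintype.sum_prod_type, smul_eq_mul, Finset.mul_sum, ← mul_assoc]
  rw [h]
  refine Finset.sum_congr rfl fun x _ => Finset.sum_congr rfl fun y _ =>
    Finset.sum_congr rfl fun z _ => by ring

/-- The `RTT` relation. -/
theorem RTT {ζ : ℝ} {ξ : Fin N → ℝ} {l : List (Fin N × Fin 2)} (hl : l.Nodup) {lam mu : ℂ}
    (hlam : ∀ j, Complex.sinh (lam - w ζ ξ j + eta ζ) ≠ 0)
    (hmu : ∀ j, Complex.sinh (mu - w ζ ξ j + eta ζ) ≠ 0)
    (hlm : Complex.sinh (lam - mu + eta ζ) ≠ 0) :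
    (RPrincipal ζ (lam - mu)).map (algebraMap ℂ (Op N)) *
      (auxFst (transfer ζ ξ l lam) * auxSnd (transfer ζ ξ l mu)) =
    auxSnd (transfer ζ ξ l mu) * auxFst (transfer ζ ξ l lam) *
      (RPrincipal ζ (lam - mu)).map (algebraMap ℂ (Op N)) := by
  induction l with
  | nil =>
    have h1 : auxFst (1 : Matrix (Fin 2) (Fin 2) (Op N)) = 1 := by
      ext ⟨a, b⟩ ⟨c, d⟩ : 2
      simp only [auxFst, Matrix.of_apply, Matrix.one_apply, Prod.mk.injEq, ite_and]
      split_ifs <;> rfl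
    have h2 : auxSnd (1 : Matrix (Fin 2) (Fin 2) (Op N)) = 1 := by
      ext ⟨a, b⟩ ⟨c, d⟩ : 2
      simp only [auxSnd, Matrix.of_apply, Matrix.one_apply, Prod.mk.injEq, ite_and]
    simp [transfer_nil, h1, h2]
  | cons j l ih =>
    rw [List.nodup_cons] at hl
    have hs := RTT_site (N := N) (ζ := ζ) j (hlam j) (hmu j)
      (by rwa [sub_sub_sub_cancel_right])
    rw [sub_sub_sub_cancel_right] at hs
    -- The sites of the list are distinct, so the Lax operator of `j` commutes with the rest of the
    -- chain. This allows the two monodromy matrices to be interleaved site by site.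
    have hc : ∀ nu rho a b c d, Commute (lax (RPrincipal ζ (nu - w ζ ξ j)) j a b)
        (transfer ζ ξ l rho c d) := fun nu rho a b c d =>
      commute_transfer (fun k hk A => commute_siteOp (by rintro rfl; exact hl.1 hk) _ A) _ _ _
    have h1 := commute_auxFst_auxSnd fun a b c d => hc lam mu a b c d
    have h2 := commute_auxFst_auxSnd fun a b c d => (hc mu lam c d a b).symm
    simp only [transfer_cons, auxFst_mul, auxSnd_mul]
    set R := (RPrincipal ζ (lam - mu)).map (algebraMap ℂ (Op N))
    set L1 := auxFst (lax (RPrincipal ζ (lam - w ζ ξ j)) j)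
    set L2 := auxSnd (lax (RPrincipal ζ (mu - w ζ ξ j)) j)
    set T1 := auxFst (transfer ζ ξ l lam)
    set T2 := auxSnd (transfer ζ ξ l mu)
    calc R * (L1 * T1 * (L2 * T2)) = R * (L1 * (T1 * L2) * T2) := by simp only [mul_assoc]
      _ = R * (L1 * L2) * (T1 * T2) := by rw [h2.eq]; simp only [mul_assoc]
      _ = L2 * L1 * (R * (T1 * T2)) := by rw [hs]; simp only [mul_assoc]
      _ = L2 * (L1 * T2) * T1 * R := by rw [ih hl.2]; simp only [mul_assoc]
      _ = L2 * T2 * (L1 * T1) * R := by rw [h1.eq]; simp only [mul_assoc]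

theorem commute_transfer_zero_one {ζ : ℝ} (hζ : Complex.sinh (2 * eta ζ) ≠ 0) {ξ : Fin N → ℝ}
    {l : List (Fin N × Fin 2)} (hl : l.Nodup) {lam mu : ℂ}
    (hlam : ∀ j, Complex.sinh (lam - w ζ ξ j + eta ζ) ≠ 0)
    (hmu : ∀ j, Complex.sinh (mu - w ζ ξ j + eta ζ) ≠ 0) :
    Commute (transfer ζ ξ l lam 0 1) (transfer ζ ξ l mu 0 1) := by
  have key : ∀ {lam mu : ℂ}, (∀ j, Complex.sinh (lam - w ζ ξ j + eta ζ) ≠ 0) →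
      (∀ j, Complex.sinh (mu - w ζ ξ j + eta ζ) ≠ 0) → Complex.sinh (lam - mu + eta ζ) ≠ 0 →
      Commute (transfer ζ ξ l lam 0 1) (transfer ζ ξ l mu 0 1) := by
    intro lam mu hlam hmu hlm
    have h := congrFun (congrFun (RTT hl hlam hmu hlm) (0, 0)) (1, 1)
    simp only [Matrix.mul_apply (M := Matrix.map _ _), Matrix.mul_apply (N := Matrix.map _ _),
      auxFst_mul_auxSnd_apply, auxSnd_mul_auxFst_apply, Matrix.map_apply, RPrincipal, sixVertex,
      Fintype.sum_prod_type, Fin.sum_univ_two, Matrix.of_apply] at h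
    rw [Commute, SemiconjBy]
    simpa using h
  -- The R-matrix is singular at this point. The roles of `lam` and `mu` are then exchanged: both
  -- denominators cannot vanish, as their arguments add up to 2η.
  by_cases h : Complex.sinh (lam - mu + eta ζ) = 0
  · refine (key hmu hlam fun h' => hζ ?_).symm
    have e : (2 * eta ζ : ℂ) = (lam - mu + eta ζ) + (mu - lam + eta ζ) := by ring
    rw [e, Complex.sinh_add, h, h']
    ring
  · exact key hlam hmu h

/-- The intertwining of two Lax operators by the `R`-matrix of their sites. -/
theorem twoSiteOp_mul_lax {ζ : ℝ} {u v : ℂ} {j k : Fin N × Fin 2} (hkj : k ≠ j)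
    (hu : Complex.sinh (u + eta ζ) ≠ 0) (hv : Complex.sinh (v + eta ζ) ≠ 0)
    (huv : Complex.sinh (v - u + eta ζ) ≠ 0) (a c : Fin 2) :
    twoSiteOp k j (RPrincipal ζ (v - u)) *
        (lax (RPrincipal ζ v) k * lax (RPrincipal ζ u) j) a c =
      (lax (RPrincipal ζ u) j * lax (RPrincipal ζ v) k) a c *
        twoSiteOp k j (RPrincipal ζ (v - u)) := by
  simp only [Matrix.mul_apply (M := lax _ _), lax_apply, siteOp_mul_siteOp hkj,
    siteOp_mul_siteOp hkj.symm, twoSiteOp_comm (j := j), ← twoSiteOp_sum, twoSiteOp_mul hkj]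
  congr 1
  ext ⟨x, y⟩ ⟨x', y'⟩
  -- The same equation with the sites k and j as first and second spaces and the auxiliary space as
  -- the third; exchanging the tensor factors of R restores the order used by the Lax operators.
  have h := yang_baxter hu hv huv x y a x' y' c
  simp only [Matrix.mul_apply, Matrix.sum_apply, Fintype.sum_prod_type, laxMat, Matrix.of_apply,
    Matrix.kroneckerMap_apply, Finset.mul_sum, Finset.sum_mul]
  refine Eq.trans ?_ (h.trans ?_)
  · refine Finset.sum_congr rfl fun p _ => Finset.sum_congr rfl fun r _ =>
      Finset.sum_congr rfl fun z _ => ?_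
    rw [RPrincipal_comm ζ v a p z x', RPrincipal_comm ζ u z r c y']
    ring
  · refine Finset.sum_congr rfl fun p _ => Finset.sum_congr rfl fun r _ =>
      Finset.sum_congr rfl fun z _ => ?_
    rw [RPrincipal_comm ζ v x z p c, RPrincipal_comm ζ u y a r z]
    ring

end XXZ

end

/-! ### Spin inversion and the reordering of sites -/

section

open Set
open scoped Kronecker

namespace XXZ

variable {N : ℕ}

theorem mulVec_vac (M : Op N) (σ : Conf N) : (M *ᵥ vac N) σ = M σ 0 := by
  simp [vac]

/-- The configuration with all spins inverted. -/
def flip (σ : Conf N) : Conf N := fun k => 1 - σ k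

theorem flip_flip (σ : Conf N) : flip (flip σ) = σ := by
  ext k; simp [flip]

theorem spinInversion_apply (σ τ : Conf N) :
    spinInversion N σ τ = if τ = flip σ then 1 else 0 := by
  have h : ∀ x y : Fin 2, (!![0, 1; 1, 0] : Matrix (Fin 2) (Fin 2) ℂ) x y =
      if y = 1 - x then 1 else 0 := by
    intro x y
    fin_cases x <;> fin_cases y <;> simp
  simp only [spinInversion, Matrix.of_apply, h, Finset.prod_ite_zero, Finset.prod_const_one]
  refine if_congr ⟨fun h => funext fun k => h k (Finset.mem_univ k), ?_⟩ rfl rfl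
  rintro rfl k _
  rfl

theorem spinInversion_mul_apply (M : Op N) (σ τ : Conf N) :
    (spinInversion N * M) σ τ = M (flip σ) τ := by
  simp [Matrix.mul_apply, spinInversion_apply]

theorem mul_spinInversion_apply (M : Op N) (σ τ : Conf N) :
    (M * spinInversion N) σ τ = M σ (flip τ) := by
  rw [Matrix.mul_apply, Finset.sum_eq_single (flip τ)]
  · simp [spinInversion_apply, flip_flip]
  · intro ρ _ h
    rw [spinInversion_apply, if_neg, mul_zero]
    rintro rfl
    exact h (flip_flip ρ).symm
  · simp

theorem commute_twoSiteOp_spinInversion {j k : Fin N × Fin 2} {A : TwoSite}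
    (hA : ∀ a b c d, A (1 - a, 1 - b) (1 - c, 1 - d) = A (a, b) (c, d)) :
    Commute (twoSiteOp j k A) (spinInversion N) := by
  refine Matrix.ext fun σ τ => ?_
  rw [spinInversion_mul_apply, mul_spinInversion_apply]
  simp only [twoSiteOp, Matrix.of_apply]
  have e : ∀ m, (σ m = flip τ m) = (flip σ m = τ m) := fun m => by
    simp only [flip, eq_iff_iff]
    generalize σ m = x
    generalize τ m = y
    revert x y
    decide
  simp only [e]
  congr 1
  rw [← hA]
  simp [flip]

theorem RPrincipal_flip (ζ : ℝ) (u : ℂ) (a b c d : Fin 2) :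
    RPrincipal ζ u (1 - a, 1 - b) (1 - c, 1 - d) = RPrincipal ζ u (a, b) (c, d) := by
  fin_cases a <;> fin_cases b <;> fin_cases c <;> fin_cases d <;> simp [RPrincipal, sixVertex]

theorem twoSiteOp_RPrincipal_mulVec_vac {ζ : ℝ} {u : ℂ} {j k : Fin N × Fin 2} :
    twoSiteOp j k (RPrincipal ζ u) *ᵥ vac N = vac N := by
  ext σ
  rw [mulVec_vac]
  simp only [twoSiteOp, Matrix.of_apply, vac, Pi.single_apply]
  by_cases h : σ = 0
  · subst h
    simp [RPrincipal, sixVertex]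
  · rw [if_neg h]
    split_ifs with h'
    · by_cases hj : σ j = 0
      · by_cases hk : σ k = 0
        · refine absurd (funext fun m => ?_) h
          by_cases hmj : m = j
          · rw [hmj, hj]; rfl
          · by_cases hmk : m = k
            · rw [hmk, hk]; rfl
            · exact h' m hmj hmk
        · simp [RPrincipal, sixVertex, hk]
      · simp [RPrincipal, sixVertex, hj]
    · rfl

/-- The operator which permutes the sites. -/
def permOp (π : Equiv.Perm (Fin N × Fin 2)) : Op N :=
  Matrix.of fun σ τ => if τ = σ ∘ π then 1 else 0

theorem permOp_mul_apply (π : Equiv.Perm (Fin N × Fin 2)) (M : Op N) (σ τ : Conf N) :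
    (permOp π * M) σ τ = M (σ ∘ π) τ := by
  simp [Matrix.mul_apply, permOp]

theorem mul_permOp_apply (π : Equiv.Perm (Fin N × Fin 2)) (M : Op N) (σ τ : Conf N) :
    (M * permOp π) σ τ = M σ (τ ∘ π.symm) := by
  rw [Matrix.mul_apply, Finset.sum_eq_single (τ ∘ π.symm)]
  · simp [permOp, Function.comp_assoc]
  · intro ρ _ h
    rw [permOp, Matrix.of_apply, if_neg, mul_zero]
    rintro rfl
    exact h (by simp [Function.comp_assoc])
  · simp

theorem permOp_mul_siteOp (π : Equiv.Perm (Fin N × Fin 2)) (j : Fin N × Fin 2)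
    (A : Matrix (Fin 2) (Fin 2) ℂ) :
    permOp π * siteOp j A = siteOp (π j) A * permOp π := by
  refine Matrix.ext fun σ τ => ?_
  rw [permOp_mul_apply, mul_permOp_apply]
  simp only [siteOp, Matrix.of_apply, Function.comp_apply, Equiv.symm_apply_apply]
  refine if_congr ⟨fun h k hk => ?_, fun h k hk => ?_⟩ rfl rfl
  · have := h (π.symm k) (fun h' => hk (by rw [← h', Equiv.apply_symm_apply]))
    simpa using this
  · have := h (π k) (fun h' => hk (π.injective h'))
    simpa using this

/-- Two products of Lax operators are related by an operator on the quantum space which fixes the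
reference vector and commutes with the spin inversion. -/
def Intertwined (ζ : ℝ) (ξ : Fin N → ℝ) (l l' : List (Fin N × Fin 2)) : Prop :=
  ∃ V : Op N, V *ᵥ vac N = vac N ∧ Commute V (spinInversion N) ∧
    ∀ lam : ℂ, (∀ j, Complex.sinh (lam - w ζ ξ j + eta ζ) ≠ 0) → ∀ a c,
      V * transfer ζ ξ l lam a c = transfer ζ ξ l' lam a c * V

theorem Intertwined.refl (ζ : ℝ) (ξ : Fin N → ℝ) (l : List (Fin N × Fin 2)) :
    Intertwined ζ ξ l l :=
  ⟨1, by simp, Commute.one_left _, by simp⟩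

theorem Intertwined.trans {ζ : ℝ} {ξ : Fin N → ℝ} {l₁ l₂ l₃ : List (Fin N × Fin 2)}
    (h : Intertwined ζ ξ l₁ l₂) (h' : Intertwined ζ ξ l₂ l₃) : Intertwined ζ ξ l₁ l₃ := by
  obtain ⟨V, hV, hU, hT⟩ := h
  obtain ⟨V', hV', hU', hT'⟩ := h'
  refine ⟨V' * V, by rw [← Matrix.mulVec_mulVec, hV, hV'], hU'.mul_left hU, fun lam hlam a c => ?_⟩
  rw [mul_assoc, hT lam hlam, ← mul_assoc, hT' lam hlam, mul_assoc]

/-- Adjacent sites are exchanged by the R-matrix at the difference of their inhomogeneities. It need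
not be invertible: within a 2-string it is R(η), which annihilates the antisymmetric vector. This is
why intertwining is kept as a one-directional relation. -/
theorem intertwined_swap {ζ : ℝ} {ξ : Fin N → ℝ} {l₁ l₂ : List (Fin N × Fin 2)}
    {j k : Fin N × Fin 2} (hl : (l₁ ++ k :: j :: l₂).Nodup)
    (hjk : Complex.sinh (w ζ ξ j - w ζ ξ k + eta ζ) ≠ 0) :
    Intertwined ζ ξ (l₁ ++ k :: j :: l₂) (l₁ ++ j :: k :: l₂) := by
  have hkj : k ≠ j := by
    have := (List.nodup_append.1 hl).2.1
    simp at this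
    tauto
  have hm : ∀ m ∈ l₁ ++ l₂, m ≠ k ∧ m ≠ j := by
    intro m hm
    have h1 : (k :: j :: (l₁ ++ l₂)).Nodup := by
      refine (List.Perm.nodup_iff ?_).1 hl
      exact (List.perm_append_comm_assoc l₁ [k, j] l₂)
    constructor <;> rintro rfl <;> simp_all
  refine ⟨twoSiteOp k j (RPrincipal ζ (w ζ ξ j - w ζ ξ k)), twoSiteOp_RPrincipal_mulVec_vac,
    commute_twoSiteOp_spinInversion (RPrincipal_flip ζ _), fun lam hlam a c => ?_⟩
  set V := twoSiteOp k j (RPrincipal ζ (w ζ ξ j - w ζ ξ k)) with hV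
  have hc : ∀ l, (∀ m ∈ l, m ∈ l₁ ++ l₂) → ∀ a c, Commute V (transfer ζ ξ l lam a c) :=
    fun l hl => commute_transfer (fun m h A => commute_twoSiteOp_siteOp hkj (hm m (hl m h)).1
      (hm m (hl m h)).2 _ A) lam
  have h1 := hc l₁ (fun m h => by simp [h])
  have h2 := hc l₂ (fun m h => by simp [h])
  have hR := fun a c => twoSiteOp_mul_lax (ζ := ζ) hkj (hlam j) (hlam k)
    (by rwa [sub_sub_sub_cancel_left]) a c
  simp only [sub_sub_sub_cancel_left, ← hV] at hR
  simp only [transfer_append, transfer_cons, ← mul_assoc (lax _ _)]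
  have h3 : ∀ b c, V * ((lax (RPrincipal ζ (lam - w ζ ξ k)) k *
      lax (RPrincipal ζ (lam - w ζ ξ j)) j) * transfer ζ ξ l₂ lam) b c =
      ((lax (RPrincipal ζ (lam - w ζ ξ j)) j *
        lax (RPrincipal ζ (lam - w ζ ξ k)) k) * transfer ζ ξ l₂ lam) b c * V := by
    intro b c
    rw [Matrix.mul_apply, Matrix.mul_apply, Finset.mul_sum, Finset.sum_mul]
    refine Finset.sum_congr rfl fun d _ => ?_
    rw [← mul_assoc, hR, mul_assoc, (h2 d c).eq, mul_assoc]
  rw [Matrix.mul_apply, Matrix.mul_apply, Finset.mul_sum, Finset.sum_mul]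
  refine Finset.sum_congr rfl fun b _ => ?_
  rw [← mul_assoc, (h1 a b).eq, mul_assoc, h3]
  exact (mul_assoc _ _ _).symm

/-- This serves blocks with equal inhomogeneities, where the exchange by R-matrices would meet a
vanishing denominator. -/
theorem intertwined_map_perm {ζ : ℝ} {ξ : Fin N → ℝ} (l : List (Fin N × Fin 2))
    (π : Equiv.Perm (Fin N × Fin 2)) (hπ : ∀ j ∈ l, w ζ ξ (π j) = w ζ ξ j) :
    Intertwined ζ ξ l (l.map π) := by
  refine ⟨permOp π, ?_, ?_, fun lam _ => ?_⟩
  · ext σ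
    rw [mulVec_vac]
    simp only [permOp, Matrix.of_apply, vac, Pi.single_apply]
    refine if_congr ⟨fun h => ?_, ?_⟩ rfl rfl
    · ext k
      have := congrFun h (π.symm k)
      simp at this
      simp [← this]
    · rintro rfl
      rfl
  · refine Matrix.ext fun σ τ => ?_
    rw [spinInversion_mul_apply, mul_spinInversion_apply]
    simp only [permOp, Matrix.of_apply]
    refine if_congr ⟨fun h => ?_, ?_⟩ rfl rfl
    · rw [← flip_flip τ, h]
      rfl
    · rintro rfl
      ext k
      simp [flip]
  · induction l with
    | nil =>
      intro a c
      simp only [List.map_nil, transfer_nil, Matrix.one_apply]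
      split_ifs <;> simp
    | cons j l ih =>
      intro a c
      rw [List.map_cons, transfer_cons, transfer_cons, Matrix.mul_apply, Matrix.mul_apply,
        Finset.mul_sum, Finset.sum_mul]
      refine Finset.sum_congr rfl fun b _ => ?_
      rw [lax_apply, lax_apply, ← mul_assoc, permOp_mul_siteOp, hπ j (by simp), mul_assoc,
        ih (fun k hk => hπ k (by simp [hk])), mul_assoc]

/-- The sites of a list of blocks, in the order of the monodromy matrix. -/
def blocks (m : List (Fin N)) : List (Fin N × Fin 2) := m.flatMap fun b => [(b, 1), (b, 0)]

/-- The sites of a list of blocks, in the opposite order within each block. -/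
def blocks' (m : List (Fin N)) : List (Fin N × Fin 2) := m.flatMap fun b => [(b, 0), (b, 1)]

theorem mem_blocks {m : List (Fin N)} {j : Fin N × Fin 2} : j ∈ blocks m ↔ j.1 ∈ m := by
  obtain ⟨b, β⟩ := j
  fin_cases β <;> simp [blocks]

theorem mem_blocks' {m : List (Fin N)} {j : Fin N × Fin 2} : j ∈ blocks' m ↔ j.1 ∈ m := by
  obtain ⟨b, β⟩ := j
  fin_cases β <;> simp [blocks']

theorem nodup_blocks {m : List (Fin N)} (hm : m.Nodup) : (blocks m).Nodup := by
  refine List.nodup_flatMap.2 ⟨by simp, hm.imp fun h => ?_⟩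
  simp [Function.onFun, h.symm]

theorem nodup_blocks' {m : List (Fin N)} (hm : m.Nodup) : (blocks' m).Nodup := by
  refine List.nodup_flatMap.2 ⟨by simp, hm.imp fun h => ?_⟩
  simp [Function.onFun, h.symm]

end XXZ

end

/-! ### Reversal of the chain, and the bra as an image of the ket -/

section

open Set
open scoped Kronecker

namespace XXZ

variable {N : ℕ}

theorem blocks_append (m m' : List (Fin N)) : blocks (m ++ m') = blocks m ++ blocks m' :=
  List.flatMap_append

theorem blocks_cons (b : Fin N) (m : List (Fin N)) :
    blocks (b :: m) = (b, 1) :: (b, 0) :: blocks m := rfl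

theorem blocks'_append (m m' : List (Fin N)) : blocks' (m ++ m') = blocks' m ++ blocks' m' :=
  List.flatMap_append

theorem sinh_two_eta_ne_zero {ζ : ℝ} (h0 : 0 < ζ) (h1 : ζ < Real.pi / 2) :
    Complex.sinh (2 * eta ζ) ≠ 0 := by
  have e : (2 * eta ζ : ℂ) = ((2 * ζ : ℝ) : ℂ) * Complex.I := by
    rw [eta]; push_cast; ring
  rw [e, Complex.sinh_mul_I, ← Complex.ofReal_sin]
  have := Real.sin_pos_of_pos_of_lt_pi (x := 2 * ζ) (by linarith) (by linarith)
  exact mul_ne_zero (Complex.ofReal_ne_zero.2 this.ne') Complex.I_ne_zero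

theorem intertwined_swap_pairs {ζ : ℝ} {ξ : Fin N → ℝ} {l₁ l₂ : List (Fin N × Fin 2)}
    {p q r s : Fin N × Fin 2} (hd : (l₁ ++ p :: q :: r :: s :: l₂).Nodup)
    (hqr : Complex.sinh (w ζ ξ r - w ζ ξ q + eta ζ) ≠ 0)
    (hpr : Complex.sinh (w ζ ξ r - w ζ ξ p + eta ζ) ≠ 0)
    (hqs : Complex.sinh (w ζ ξ s - w ζ ξ q + eta ζ) ≠ 0)
    (hps : Complex.sinh (w ζ ξ s - w ζ ξ p + eta ζ) ≠ 0) :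
    Intertwined ζ ξ (l₁ ++ p :: q :: r :: s :: l₂) (l₁ ++ r :: s :: p :: q :: l₂) := by
  have i1 := intertwined_swap (ζ := ζ) (ξ := ξ) (l₁ := l₁ ++ [p]) (l₂ := s :: l₂)
    (by simpa using hd) hqr
  have d2 : (l₁ ++ p :: r :: q :: s :: l₂).Nodup :=
    (((List.Perm.swap r q (s :: l₂)).cons p).append_left l₁).nodup_iff.1 hd
  have i2 := intertwined_swap (ζ := ζ) (ξ := ξ) d2 hpr
  have d3 : (l₁ ++ r :: p :: q :: s :: l₂).Nodup :=
    ((List.Perm.swap r p (q :: s :: l₂)).append_left l₁).nodup_iff.1 d2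
  have i3 := intertwined_swap (ζ := ζ) (ξ := ξ) (l₁ := l₁ ++ [r, p]) (l₂ := l₂)
    (by simpa using d3) hqs
  have d4 : (l₁ ++ r :: p :: s :: q :: l₂).Nodup :=
    ((((List.Perm.swap s q l₂).cons p).cons r).append_left l₁).nodup_iff.1 d3
  have i4 := intertwined_swap (ζ := ζ) (ξ := ξ) (l₁ := l₁ ++ [r]) (l₂ := q :: l₂)
    (by simpa using d4) hps
  simp only [List.append_assoc, List.cons_append, List.nil_append] at i1 i2 i3 i4
  exact ((i1.trans i2).trans i3).trans i4

theorem intertwined_swap_blocks {ζ : ℝ} {ξ : Fin N → ℝ} {l₁ l₂ : List (Fin N)} {b c : Fin N}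
    (hl : (l₁ ++ c :: b :: l₂).Nodup) :
    Intertwined ζ ξ (blocks (l₁ ++ c :: b :: l₂)) (blocks (l₁ ++ b :: c :: l₂)) := by
  -- For equal centers the site (b, 1) would have to pass (c, 0), where the difference is -η and R
  -- is singular; permuting the two blocks does the same work. For distinct real centers all four
  -- exchanges are regular, η being purely imaginary.
  by_cases h : ξ b = ξ c
  · have hb : ∀ m ∈ l₁ ++ l₂, m ≠ b ∧ m ≠ c := by
      intro m hm
      have h1 : (c :: b :: (l₁ ++ l₂)).Nodup :=
        (List.Perm.nodup_iff (List.perm_append_comm_assoc l₁ [c, b] l₂)).1 hl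
      constructor <;> rintro rfl <;> simp_all
    let π : Equiv.Perm (Fin N × Fin 2) := Equiv.prodCongr (Equiv.swap b c) (Equiv.refl _)
    have hπ : ∀ l : List (Fin N), (∀ m ∈ l, m ∈ l₁ ++ l₂) → (blocks l).map π = blocks l := by
      intro l hl
      refine (List.map_congr_left fun j hj => ?_).trans (List.map_id _)
      have := hb j.1 (hl _ (mem_blocks.1 hj))
      exact Prod.ext (Equiv.swap_apply_of_ne_of_ne this.1 this.2) rfl
    have e : blocks (l₁ ++ b :: c :: l₂) = (blocks (l₁ ++ c :: b :: l₂)).map π := by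
      simp only [blocks_append, blocks_cons, List.map_append, List.map_cons]
      rw [hπ l₁ (by simp +contextual), hπ l₂ (by simp +contextual)]
      simp [π]
    rw [e]
    refine intertwined_map_perm _ π fun j _ => ?_
    have hξ : ξ (Equiv.swap b c j.1) = ξ j.1 := by
      rw [Equiv.swap_apply_def]
      split_ifs with h1 h2
      · rw [h1, h]
      · rw [h2, h]
      · rfl
    simp only [w, π, Equiv.prodCongr_apply, Prod.map_fst, Prod.map_snd, Equiv.refl_apply, hξ]
  · have hn : ∀ β γ : Fin 2, Complex.sinh (w ζ ξ (b, β) - w ζ ξ (c, γ) + eta ζ) ≠ 0 := by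
      intro β γ
      refine sinh_ne_zero_of_re_ne_zero ?_
      simp [w, eta]
      exact sub_ne_zero.2 h
    have hd := nodup_blocks hl
    simp only [blocks_append, blocks_cons] at hd ⊢
    exact intertwined_swap_pairs hd (hn 1 0) (hn 1 1) (hn 0 0) (hn 0 1)

theorem intertwined_blocks_perm {ζ : ℝ} {ξ : Fin N → ℝ} {m m' : List (Fin N)} (h : m.Perm m')
    (l : List (Fin N)) (hl : (l ++ m).Nodup) :
    Intertwined ζ ξ (blocks (l ++ m)) (blocks (l ++ m')) := by
  induction h generalizing l with
  | nil => exact Intertwined.refl _ _ _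
  | cons b _ ih => simpa using ih (l ++ [b]) (by simpa using hl)
  | swap b c m => exact intertwined_swap_blocks hl
  | trans h _ ih ih' =>
    exact (ih l hl).trans (ih' l (((h.append_left l).nodup_iff).1 hl))

/-- Each pair is turned over in place by R(η), whose denominator is sinh (2η). The prefix `l`
collects the pairs already turned. -/
theorem intertwined_blocks_blocks' {ζ : ℝ} (hζ : Complex.sinh (2 * eta ζ) ≠ 0) {ξ : Fin N → ℝ}
    (m l : List (Fin N)) (hl : (l ++ m).Nodup) :
    Intertwined ζ ξ (blocks' l ++ blocks m) (blocks' (l ++ m)) := by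
  induction m generalizing l with
  | nil => simpa [blocks] using Intertwined.refl ζ ξ _
  | cons b m ih =>
    have h1 := ih (l ++ [b]) (by simpa using hl)
    simp only [List.append_assoc, List.singleton_append] at h1
    refine Intertwined.trans ?_ h1
    rw [blocks'_append, List.append_assoc]
    refine intertwined_swap ?_ ?_
    · obtain ⟨h2, h3, h4⟩ := List.nodup_append.1 hl
      refine List.nodup_append.2 ⟨nodup_blocks' h2, nodup_blocks h3, fun x hx y hy => ?_⟩
      rintro rfl
      exact h4 _ (mem_blocks'.1 hx) _ (mem_blocks.1 hy) rfl
    · have e : w ζ ξ (b, 0) - w ζ ξ (b, 1) + eta ζ = 2 * eta ζ := by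
        simp [w]; ring
      rwa [e]

theorem blocks_reverse (m : List (Fin N)) : (blocks m).reverse = blocks' m.reverse := by
  induction m with
  | nil => rfl
  | cons b m ih => simp [blocks_cons, ih, blocks']

theorem intertwined_blocks_reverse {ζ : ℝ} (hζ : Complex.sinh (2 * eta ζ) ≠ 0) {ξ : Fin N → ℝ}
    {m : List (Fin N)} (hm : m.Nodup) :
    Intertwined ζ ξ (blocks m) (blocks m).reverse := by
  rw [blocks_reverse]
  refine (intertwined_blocks_perm m.reverse_perm.symm [] hm).trans ?_
  exact intertwined_blocks_blocks' hζ m.reverse [] (by simpa using hm)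

theorem monodromy_RPrincipal (ζ : ℝ) (ξ : Fin N → ℝ) (lam : ℂ) :
    monodromy ζ ξ (RPrincipal ζ) lam = transfer ζ ξ (blocks (List.finRange N).reverse) lam := by
  rw [monodromy]
  generalize (List.finRange N).reverse = m
  induction m with
  | nil => rfl
  | cons b m ih =>
    rw [List.map_cons, List.prod_cons, ih, blocks_cons, transfer_cons, transfer_cons, mul_assoc]

theorem laxMat_transpose (ζ : ℝ) (u : ℂ) (a c : Fin 2) :
    (laxMat (RPrincipal ζ u) a c)ᵀ = laxMat (RPrincipal ζ u) c a := by
  ext b d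
  exact RPrincipal_symm ζ u _ _

theorem siteOp_transpose (j : Fin N × Fin 2) (A : Matrix (Fin 2) (Fin 2) ℂ) :
    (siteOp j A)ᵀ = siteOp j Aᵀ := by
  ext σ τ
  simp only [Matrix.transpose_apply, siteOp, Matrix.of_apply]
  exact if_congr (forall₂_congr fun _ _ => eq_comm) rfl rfl

/-- As R is a symmetric matrix, transposing a Lax operator in its quantum space amounts to
exchanging its auxiliary indices, and transposition reverses the order of the factors. -/
theorem transfer_transpose (ζ : ℝ) (ξ : Fin N → ℝ) (l : List (Fin N × Fin 2)) (lam : ℂ)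
    (a c : Fin 2) : (transfer ζ ξ l lam a c)ᵀ = transfer ζ ξ l.reverse lam c a := by
  induction l generalizing a c with
  | nil =>
    simp only [List.reverse_nil, transfer_nil, Matrix.one_apply]
    by_cases h : a = c
    · simp [h]
    · simp [h, Ne.symm h]
  | cons j l ih =>
    rw [List.reverse_cons, transfer_append, transfer_cons, transfer_cons, transfer_nil, mul_one,
      Matrix.mul_apply, Matrix.mul_apply, Matrix.transpose_sum]
    refine Finset.sum_congr rfl fun b _ => ?_
    rw [Matrix.transpose_mul, ih, lax_apply, siteOp_transpose, laxMat_transpose, lax_apply]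

theorem vecMul_eq_transpose_mulVec_prod {n : Type*} [Fintype n] [DecidableEq n]
    (l : List (Matrix n n ℂ)) (v : n → ℂ) :
    v ᵥ* l.prod = (l.map Matrix.transpose).reverse.prod *ᵥ v := by
  rw [← Matrix.transpose_list_prod, Matrix.mulVec_transpose]

theorem exists_braHalf_eq_mulVec_ketHalf {ζ : ℝ} (hζ : Complex.sinh (2 * eta ζ) ≠ 0)
    {ξ : Fin N → ℝ} {M : ℕ} {lam : Fin M → ℂ}
    (hlam : ∀ γ j, Complex.sinh (lam γ - w ζ ξ j + eta ζ) ≠ 0) :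
    ∃ V : Op N, Commute V (spinInversion N) ∧ braHalf ζ ξ lam = V *ᵥ ketHalf ζ ξ lam := by
  set m := (List.finRange N).reverse
  have hm : m.Nodup := by simpa [m] using List.nodup_finRange N
  obtain ⟨V, hV, hU, hT⟩ := intertwined_blocks_reverse (ξ := ξ) hζ hm
  refine ⟨V, hU, ?_⟩
  have e1 : ∀ l : List ℂ, (∀ x ∈ l, ∀ j, Complex.sinh (x - w ζ ξ j + eta ζ) ≠ 0) →
      V * (l.map fun x => transfer ζ ξ (blocks m) x 0 1).prod =
        (l.map fun x => transfer ζ ξ (blocks m).reverse x 0 1).prod * V := by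
    intro l hl
    induction l with
    | nil => simp
    | cons x l ih =>
      rw [List.map_cons, List.prod_cons, ← mul_assoc, hT x (hl x (by simp)), mul_assoc,
        ih fun y hy => hl y (by simp [hy]), List.map_cons, List.prod_cons, mul_assoc]
  -- Transposition also reverses the product over the spectral parameters; the commutativity of the
  -- B operators restores the order.
  have e2 : (((List.ofFn lam).map fun x => transfer ζ ξ (blocks m).reverse x 0 1).reverse).prod =
      ((List.ofFn lam).map fun x => transfer ζ ξ (blocks m).reverse x 0 1).prod := by
    refine List.Perm.prod_eq' (List.reverse_perm _) ?_
    rw [List.pairwise_reverse, List.pairwise_map]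
    refine List.pairwise_of_forall_mem_list fun x hx y hy => ?_
    simp only [List.mem_ofFn] at hx hy
    obtain ⟨γ, rfl⟩ := hx
    obtain ⟨δ, rfl⟩ := hy
    exact commute_transfer_zero_one hζ (List.nodup_reverse.2 (nodup_blocks hm)) (hlam δ) (hlam γ)
  rw [braHalf, ketHalf, vecMul_eq_transpose_mulVec_prod, List.map_ofFn]
  simp only [monodromy_RPrincipal]
  have e3 := e1 (List.ofFn lam) (by simpa [List.mem_ofFn] using hlam)
  rw [← e2] at e3
  simp only [List.map_ofFn, Function.comp_def, transfer_transpose] at e3 ⊢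
  rw [Matrix.mulVec_mulVec, e3, ← Matrix.mulVec_mulVec, hV]

end XXZ

end

/-! ### The symmetrizer of the pairs and fusion -/

section

open Set
open scoped Kronecker

namespace XXZ

variable {N : ℕ}

/-- The operator which exchanges the two spin-1/2 sites of the block `b`. -/
def swapOp (b : Fin N) : Op N := permOp (Equiv.swap (b, 0) (b, 1))

theorem mul_swapOp_apply (M : Op N) (b : Fin N) (σ τ : Conf N) :
    (M * swapOp b) σ τ = M σ (τ ∘ Equiv.swap (b, 0) (b, 1)) := by
  rw [swapOp, mul_permOp_apply, Equiv.symm_swap]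

theorem swapOp_mul_apply (M : Op N) (b : Fin N) (σ τ : Conf N) :
    (swapOp b * M) σ τ = M (σ ∘ Equiv.swap (b, 0) (b, 1)) τ := by
  rw [swapOp, permOp_mul_apply]

theorem vecMul_swapOp_apply (v : Conf N → ℂ) (b : Fin N) (τ : Conf N) :
    (v ᵥ* swapOp b) τ = v (τ ∘ Equiv.swap (b, 0) (b, 1)) := by
  have := mul_swapOp_apply (Matrix.of fun _ => v) b 0 τ
  simpa [Matrix.mul_apply, Matrix.vecMul, dotProduct] using this

theorem commute_swapOp_siteOp {b : Fin N} {j : Fin N × Fin 2} (hj : j.1 ≠ b)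
    (A : Matrix (Fin 2) (Fin 2) ℂ) : Commute (swapOp b) (siteOp j A) := by
  rw [Commute, SemiconjBy, swapOp, permOp_mul_siteOp, Equiv.swap_apply_of_ne_of_ne] <;>
    rintro rfl <;> exact hj rfl

/-- The symmetrizer of each of the blocks. -/
noncomputable def blockSym (N : ℕ) : Op N :=
  Matrix.of fun σ τ => ∏ b, ((if σ (b, 0) = τ (b, 0) ∧ σ (b, 1) = τ (b, 1) then 1 else 0) +
    if σ (b, 0) = τ (b, 1) ∧ σ (b, 1) = τ (b, 0) then 1 else 0) / 2

theorem blockSym_transpose : (blockSym N)ᵀ = blockSym N := by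
  ext σ τ
  simp only [blockSym, Matrix.transpose_apply, Matrix.of_apply]
  refine Finset.prod_congr rfl fun b _ => ?_
  congr 2
  · exact if_congr (by tauto) rfl rfl
  · exact if_congr (by tauto) rfl rfl

theorem blockSym_mul_swapOp (b : Fin N) : blockSym N * swapOp b = blockSym N := by
  ext σ τ
  rw [mul_swapOp_apply]
  simp only [blockSym, Matrix.of_apply]
  refine Finset.prod_congr rfl fun c _ => ?_
  by_cases h : c = b
  · subst h
    simp [add_comm]
  · simp [Equiv.swap_apply_of_ne_of_ne, h]

/-- Induction over the blocks in which the configurations may differ, undoing one exchange at a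
time. -/
theorem eq_of_swap_invariant {f : Conf N → ℂ}
    (hf : ∀ b σ, f (σ ∘ Equiv.swap (b, 0) (b, 1)) = f σ) (s : Finset (Fin N)) {σ τ : Conf N}
    (h : ∀ b ∈ s, σ (b, 0) = τ (b, 0) ∧ σ (b, 1) = τ (b, 1) ∨
      σ (b, 0) = τ (b, 1) ∧ σ (b, 1) = τ (b, 0))
    (h' : ∀ b ∉ s, σ (b, 0) = τ (b, 0) ∧ σ (b, 1) = τ (b, 1)) : f σ = f τ := by
  induction s using Finset.induction_on generalizing σ with
  | empty =>
    congr 1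
    ext ⟨b, β⟩ : 1
    have := h' b (by simp)
    fin_cases β
    · exact this.1
    · exact this.2
  | insert b s hb ih =>
    rcases h b (by simp) with h1 | h1
    · refine ih (fun c hc => h c (by simp [hc])) fun c hc => ?_
      by_cases hcb : c = b
      · exact hcb ▸ h1
      · exact h' c (by simp [hc, hcb])
    · rw [← hf b]
      refine ih (fun c hc => ?_) fun c hc => ?_
      · have hcb : c ≠ b := by rintro rfl; exact hb hc
        simpa [Equiv.swap_apply_of_ne_of_ne, hcb] using h c (by simp [hc])
      · by_cases hcb : c = b
        · subst hcb
          simpa using h1.symm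
        · simpa [Equiv.swap_apply_of_ne_of_ne, hcb] using h' c (by simp [hc, hcb])

theorem sum_blockSym (τ : Conf N) : ∑ σ, blockSym N σ τ = 1 := by
  let e : Conf N ≃ (Fin N → Fin 2 × Fin 2) :=
    (Equiv.curry (Fin N) (Fin 2) (Fin 2)).trans
      (Equiv.piCongrRight fun _ => finTwoArrowEquiv (Fin 2))
  let F : Fin N → Fin 2 × Fin 2 → ℂ := fun b x =>
    ((if x.1 = τ (b, 0) ∧ x.2 = τ (b, 1) then 1 else 0) +
      if x.1 = τ (b, 1) ∧ x.2 = τ (b, 0) then 1 else 0) / 2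
  have h1 : ∑ σ, blockSym N σ τ = ∑ x : Fin N → Fin 2 × Fin 2, ∏ b, F b (x b) :=
    Fintype.sum_equiv e _ _ fun σ => rfl
  rw [h1, ← Fintype.prod_sum]
  refine Finset.prod_eq_one fun b _ => ?_
  simp only [F, ← Finset.sum_div, Finset.sum_add_distrib, Fintype.sum_prod_type, ite_and]
  simp

/-- On the support of a column of the symmetrizer an invariant covector is constant, and the entries
of the column sum to 1. -/
theorem vecMul_blockSym {v : Conf N → ℂ} (hv : ∀ b, v ᵥ* swapOp b = v) :
    v ᵥ* blockSym N = v := by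
  ext τ
  have hf : ∀ b σ, v (σ ∘ Equiv.swap (b, 0) (b, 1)) = v σ := fun b σ => by
    rw [← vecMul_swapOp_apply v, hv]
  have h : ∀ σ, v σ * blockSym N σ τ = v τ * blockSym N σ τ := by
    intro σ
    by_cases h0 : blockSym N σ τ = 0
    · rw [h0, mul_zero, mul_zero]
    · congr 1
      refine eq_of_swap_invariant hf Finset.univ (fun b _ => ?_) (by simp)
      rw [blockSym, Matrix.of_apply, Finset.prod_eq_zero_iff] at h0
      have := fun h => h0 ⟨b, Finset.mem_univ b, h⟩
      contrapose! this
      rw [if_neg (by tauto), if_neg (by tauto)]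
      simp
  simp only [Matrix.vecMul, dotProduct, h, ← Finset.mul_sum, sum_blockSym, mul_one]

theorem mul_blockSym {M : Op N} (hM : ∀ b, M * swapOp b = M) : M * blockSym N = M := by
  ext σ τ
  refine congrFun (vecMul_blockSym (v := M σ) fun b => ?_) τ
  exact congrFun (hM b) σ

theorem blockSym_mul_blockSym : blockSym N * blockSym N = blockSym N :=
  mul_blockSym blockSym_mul_swapOp

theorem sixVertex_fusion {b₁ c₁ b₀ c₀ : ℂ} (e₁ : b₁ * c₀ = c₁) (e₂ : b₁ = b₀ + c₁ * c₀)
    (a c x y z t : Fin 2) :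
    sixVertex b₁ c₁ c₁ (a, x) (0, t) * sixVertex b₀ c₀ c₀ (0, y) (c, z) +
          sixVertex b₁ c₁ c₁ (a, x) (1, t) * sixVertex b₀ c₀ c₀ (1, y) (c, z) +
        (sixVertex b₁ c₁ c₁ (a, y) (0, t) * sixVertex b₀ c₀ c₀ (0, x) (c, z) +
          sixVertex b₁ c₁ c₁ (a, y) (1, t) * sixVertex b₀ c₀ c₀ (1, x) (c, z)) =
      sixVertex b₁ c₁ c₁ (a, x) (0, z) * sixVertex b₀ c₀ c₀ (0, y) (c, t) +
          sixVertex b₁ c₁ c₁ (a, x) (1, z) * sixVertex b₀ c₀ c₀ (1, y) (c, t) +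
        (sixVertex b₁ c₁ c₁ (a, y) (0, z) * sixVertex b₀ c₀ c₀ (0, x) (c, t) +
          sixVertex b₁ c₁ c₁ (a, y) (1, z) * sixVertex b₀ c₀ c₀ (1, x) (c, t)) := by
  fin_cases a <;> fin_cases c <;> fin_cases x <;> fin_cases y <;> fin_cases z <;> fin_cases t <;>
    simp [sixVertex] <;>
    first
    | ring1
    | linear_combination 2 * e₁
    | linear_combination -2 * e₁
    | linear_combination e₂
    | linear_combination -e₂

/-- The fusion property: at arguments differing by η, the product of two Lax operators maps vectors
antisymmetric in the pair to such vectors. Conceptually, these form the kernel of R(η), which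
intertwines the two orders of the product. Entrywise it reduces to the two scalar relations `e₁` and
`e₂`. -/
theorem lax_mul_lax_swap {ζ : ℝ} {u : ℂ} (hu : Complex.sinh (u + eta ζ) ≠ 0)
    (hv : Complex.sinh (u + eta ζ + eta ζ) ≠ 0) (b : Fin N) (a c : Fin 2) :
    (1 + swapOp b) * (lax (RPrincipal ζ (u + eta ζ)) (b, 1) * lax (RPrincipal ζ u) (b, 0)) a c *
        swapOp b =
      (1 + swapOp b) *
        (lax (RPrincipal ζ (u + eta ζ)) (b, 1) * lax (RPrincipal ζ u) (b, 0)) a c := by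
  have hne : ((b, 1) : Fin N × Fin 2) ≠ (b, 0) := by simp
  rw [Matrix.mul_apply]
  simp only [lax_apply, siteOp_mul_siteOp hne, ← twoSiteOp_sum]
  set A : TwoSite := ∑ x, laxMat (RPrincipal ζ (u + eta ζ)) a x ⊗ₖ laxMat (RPrincipal ζ u) x c
    with hA
  have key : ∀ x y z t : Fin 2, A (x, y) (t, z) + A (y, x) (t, z) =
      A (x, y) (z, t) + A (y, x) (z, t) := by
    intro x y z t
    have e₁ : Complex.sinh (u + eta ζ) / Complex.sinh (u + eta ζ + eta ζ) *
        (Complex.sinh (eta ζ) / Complex.sinh (u + eta ζ)) =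
        Complex.sinh (eta ζ) / Complex.sinh (u + eta ζ + eta ζ) := by
      field_simp
    have e₂ : Complex.sinh (u + eta ζ) / Complex.sinh (u + eta ζ + eta ζ) =
        Complex.sinh u / Complex.sinh (u + eta ζ) +
          Complex.sinh (eta ζ) / Complex.sinh (u + eta ζ + eta ζ) *
            (Complex.sinh (eta ζ) / Complex.sinh (u + eta ζ)) := by
      have := Complex.exp_ne_zero u
      have := Complex.exp_ne_zero (eta ζ)
      field_simp
      simp only [Complex.sinh, Complex.exp_neg, Complex.exp_add]
      field_simp
      ring
    rw [hA]
    simp only [Fin.sum_univ_two, Matrix.add_apply, Matrix.kroneckerMap_apply, laxMat,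
      Matrix.of_apply]
    exact sixVertex_fusion e₁ e₂ a c x y z t
  refine Matrix.ext fun σ τ => ?_
  rw [mul_swapOp_apply]
  simp only [add_mul, one_mul, Matrix.add_apply, swapOp_mul_apply, twoSiteOp, Matrix.of_apply]
  have e1 : ∀ σ τ : Conf N, (∀ m, m ≠ (b, 1) → m ≠ (b, 0) →
      (σ ∘ Equiv.swap (b, 0) (b, 1)) m = τ m) ↔ ∀ m, m ≠ (b, 1) → m ≠ (b, 0) → σ m = τ m :=
    fun σ τ => forall₃_congr fun m h1 h0 => by simp [Equiv.swap_apply_of_ne_of_ne h0 h1]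
  have e2 : ∀ σ τ : Conf N, (∀ m, m ≠ (b, 1) → m ≠ (b, 0) →
      σ m = (τ ∘ Equiv.swap (b, 0) (b, 1)) m) ↔ ∀ m, m ≠ (b, 1) → m ≠ (b, 0) → σ m = τ m :=
    fun σ τ => forall₃_congr fun m h1 h0 => by simp [Equiv.swap_apply_of_ne_of_ne h0 h1]
  simp only [e1, e2]
  split_ifs
  · simpa using key _ _ _ _
  · rfl

end XXZ

end

/-! ### Fusion for the whole chain, and the gauge factors -/

section

open Set
open scoped Kronecker

namespace XXZ

variable {N : ℕ}

theorem commute_swapOp_transfer {ζ : ℝ} {ξ : Fin N → ℝ} {b : Fin N} {m : List (Fin N)}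
    (hb : b ∉ m) (lam : ℂ) (a c : Fin 2) :
    Commute (swapOp b) (transfer ζ ξ (blocks m) lam a c) :=
  commute_transfer (fun j hj A => commute_swapOp_siteOp
    (by rintro rfl; exact hb (mem_blocks.1 hj)) A) lam a c

theorem transfer_blocks_swap {ζ : ℝ} {ξ : Fin N → ℝ} {m : List (Fin N)} (hm : m.Nodup)
    {b : Fin N} (hb : b ∈ m) {lam : ℂ} (hlam : ∀ j, Complex.sinh (lam - w ζ ξ j + eta ζ) ≠ 0)
    (a c : Fin 2) :
    (1 + swapOp b) * transfer ζ ξ (blocks m) lam a c * swapOp b =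
      (1 + swapOp b) * transfer ζ ξ (blocks m) lam a c := by
  obtain ⟨l₁, l₂, rfl⟩ := List.append_of_mem hb
  have h1 : b ∉ l₁ ∧ b ∉ l₂ := by
    have h := (List.perm_middle.nodup_iff).1 hm
    simpa using (List.nodup_cons.1 h).1
  have c1 := fun a c => commute_swapOp_transfer (ζ := ζ) (ξ := ξ) h1.1 lam a c
  have c2 := fun a c => commute_swapOp_transfer (ζ := ζ) (ξ := ξ) h1.2 lam a c
  have e : lam - w ζ ξ (b, 1) = lam - w ζ ξ (b, 0) + eta ζ := by
    simp [w]; ring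
  have hL := fun x y => lax_mul_lax_swap (ζ := ζ) (hlam (b, 0))
    (by rw [← e]; exact hlam (b, 1)) b x y
  rw [← e] at hL
  rw [blocks_append, blocks_cons, transfer_append, transfer_cons, transfer_cons,
    ← mul_assoc (lax _ _)]
  set L := lax (RPrincipal ζ (lam - w ζ ξ (b, 1))) (b, 1) *
    lax (RPrincipal ζ (lam - w ζ ξ (b, 0))) (b, 0)
  set T₁ := transfer ζ ξ (blocks l₁) lam
  set T₂ := transfer ζ ξ (blocks l₂) lam
  have c1' := fun a c => (Commute.one_left (T₁ a c)).add_left (c1 a c)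
  simp only [Matrix.mul_apply (M := T₁), Matrix.mul_apply (M := L), Finset.mul_sum, Finset.sum_mul]
  refine Finset.sum_congr rfl fun x _ => Finset.sum_congr rfl fun y _ => ?_
  calc (1 + swapOp b) * (T₁ a x * (L x y * T₂ y c)) * swapOp b
      = (1 + swapOp b) * T₁ a x * L x y * (T₂ y c * swapOp b) := by simp only [mul_assoc]
    _ = T₁ a x * ((1 + swapOp b) * L x y * swapOp b) * T₂ y c := by
        rw [(c1' a x).eq, ← (c2 y c).eq]; simp only [mul_assoc]
    _ = (1 + swapOp b) * T₁ a x * L x y * T₂ y c := by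
        rw [hL, (c1' a x).eq]; simp only [mul_assoc]
    _ = _ := by simp only [mul_assoc]

theorem blockSym_mul_monodromy_swap {ζ : ℝ} {ξ : Fin N → ℝ} {lam : ℂ}
    (hlam : ∀ j, Complex.sinh (lam - w ζ ξ j + eta ζ) ≠ 0) (a c : Fin 2) (b : Fin N) :
    blockSym N * monodromy ζ ξ (RPrincipal ζ) lam a c * swapOp b =
      blockSym N * monodromy ζ ξ (RPrincipal ζ) lam a c := by
  rw [monodromy_RPrincipal]
  have h := transfer_blocks_swap (m := (List.finRange N).reverse)
    (by simpa using List.nodup_finRange N) (b := b) (by simp) hlam a c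
  -- Multiplied by the full symmetrizer, the factor 1 + Π of the single pair becomes 2 and cancels.
  have h2 : blockSym N * (1 + swapOp b) = (2 : ℂ) • blockSym N := by
    rw [mul_add, mul_one, blockSym_mul_swapOp, two_smul]
  have h3 := congrArg (blockSym N * ·) h
  simp only [← mul_assoc, h2, Matrix.smul_mul] at h3
  exact smul_right_injective _ two_ne_zero h3

theorem blockSym_mul_monodromy_mul_blockSym {ζ : ℝ} {ξ : Fin N → ℝ} {lam : ℂ}
    (hlam : ∀ j, Complex.sinh (lam - w ζ ξ j + eta ζ) ≠ 0) (a c : Fin 2) :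
    blockSym N * monodromy ζ ξ (RPrincipal ζ) lam a c * blockSym N =
      blockSym N * monodromy ζ ξ (RPrincipal ζ) lam a c :=
  mul_blockSym (blockSym_mul_monodromy_swap hlam a c)

/-- The diagonal operator with the entries `exp (∑ j, u j n_j)`, where `n_j` is the number of down
spins at the site `j`. -/
noncomputable def weight (u : Fin N × Fin 2 → ℂ) : Op N :=
  Matrix.diagonal fun σ => Complex.exp (∑ j, u j * (σ j : ℕ))

theorem weight_mul (u v : Fin N × Fin 2 → ℂ) : weight u * weight v = weight (u + v) := by
  simp only [weight, Matrix.diagonal_mul_diagonal, ← Complex.exp_add, ← Finset.sum_add_distrib,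
    Pi.add_apply, add_mul]

theorem weight_zero : weight (0 : Fin N × Fin 2 → ℂ) = 1 := by
  simp [weight]

theorem weight_neg_mul (u : Fin N × Fin 2 → ℂ) : weight (-u) * weight u = 1 := by
  rw [weight_mul, neg_add_cancel, weight_zero]

theorem weight_mul_neg (u : Fin N × Fin 2 → ℂ) : weight u * weight (-u) = 1 := by
  rw [weight_mul, add_neg_cancel, weight_zero]

theorem weight_mulVec_vac (u : Fin N × Fin 2 → ℂ) : weight u *ᵥ vac N = vac N := by
  ext σ
  rw [weight, Matrix.mulVec_diagonal]
  by_cases h : σ = 0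
  · subst h; simp
  · simp [vac, h]

theorem vac_vecMul_weight (u : Fin N × Fin 2 → ℂ) : vac N ᵥ* weight u = vac N := by
  ext σ
  rw [weight, Matrix.vecMul_diagonal]
  by_cases h : σ = 0
  · subst h; simp
  · simp [vac, h]

theorem weight_conj_apply (u : Fin N × Fin 2 → ℂ) (M : Op N) (σ τ : Conf N) :
    (weight u * M * weight (-u)) σ τ =
      Complex.exp (∑ j, u j * (((σ j : ℕ) : ℂ) - (τ j : ℕ))) * M σ τ := by
  rw [weight, weight, Matrix.mul_diagonal, Matrix.diagonal_mul, mul_right_comm, ← Complex.exp_add,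
    ← Finset.sum_add_distrib]
  simp only [Pi.neg_apply, neg_mul, mul_sub, ← sub_eq_add_neg]

theorem gauge_eq_weight (ζ : ℝ) (ξ : Fin N → ℝ) :
    gauge ζ ξ = weight fun j => ξ j.1 - eta ζ / 2 := by
  rw [gauge, weight]
  congr 1
  ext σ
  congr 1
  simp only [Fintype.sum_prod_type, Fin.sum_univ_two]
  exact Finset.sum_congr rfl fun b _ => by ring

theorem gauge_inv (ζ : ℝ) (ξ : Fin N → ℝ) :
    (gauge ζ ξ)⁻¹ = weight (-fun j => ξ j.1 - eta ζ / 2) := by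
  rw [gauge_eq_weight]
  exact Matrix.inv_eq_left_inv (weight_neg_mul _)

theorem siteOp_weight (u : Fin N × Fin 2 → ℂ) (j : Fin N × Fin 2) (A : Matrix (Fin 2) (Fin 2) ℂ) :
    weight u * siteOp j A * weight (-u) =
      siteOp j (Matrix.of fun x y => Complex.exp (u j * (((x : ℕ) : ℂ) - (y : ℕ))) * A x y) := by
  ext σ τ
  rw [weight_conj_apply]
  simp only [siteOp, Matrix.of_apply, mul_ite, mul_zero]
  refine ite_congr rfl (fun h => ?_) fun _ => rfl
  rw [Finset.sum_eq_single j (fun k _ hk => by rw [h k hk]; ring) (by simp)]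

theorem RHomogeneous_apply (ζ : ℝ) (u : ℂ) (a b c d : Fin 2) :
    RHomogeneous ζ u (a, b) (c, d) =
      Complex.exp (u * (((a : ℕ) : ℂ) - (c : ℕ))) * RPrincipal ζ u (a, b) (c, d) := by
  fin_cases a <;> fin_cases b <;> fin_cases c <;> fin_cases d <;>
    simp [RHomogeneous, RPrincipal, sixVertex, mul_div_assoc]

theorem RPrincipal_eq_zero (ζ : ℝ) (u : ℂ) {a b c d : Fin 2}
    (h : (a : ℕ) + b ≠ c + d) : RPrincipal ζ u (a, b) (c, d) = 0 := by
  revert h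
  fin_cases a <;> fin_cases b <;> fin_cases c <;> fin_cases d <;> simp [RPrincipal, sixVertex]

theorem lax_RHomogeneous (ζ : ℝ) (ξ : Fin N → ℝ) (lam : ℂ) (j : Fin N × Fin 2) (a c : Fin 2) :
    lax (RHomogeneous ζ (lam - w ζ ξ j)) j a c =
      Complex.exp (lam * (((a : ℕ) : ℂ) - (c : ℕ))) •
        (weight (w ζ ξ) * lax (RPrincipal ζ (lam - w ζ ξ j)) j a c * weight (-w ζ ξ)) := by
  rw [lax_apply, lax_apply, siteOp_weight, ← siteOp_smul]
  congr 1
  ext b d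
  simp only [laxMat, Matrix.of_apply, Matrix.smul_apply, smul_eq_mul, RHomogeneous_apply]
  by_cases h : (a : ℕ) + b = c + d
  · rw [← mul_assoc, ← Complex.exp_add]
    congr 2
    -- By spin conservation the dependence on w moves from the auxiliary indices to the quantum
    -- ones, so it becomes a diagonal conjugation, leaving a scalar in λ.
    have h' : (((a : ℕ) : ℂ) + (b : ℕ)) = (c : ℕ) + (d : ℕ) := by exact_mod_cast h
    linear_combination -(w ζ ξ j) * h'
  · simp [RPrincipal_eq_zero ζ _ h]

theorem mul_apply_of_conj {A B A' B' : Matrix (Fin 2) (Fin 2) (Op N)} {u : Fin N × Fin 2 → ℂ}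
    {lam : ℂ}
    (hA : ∀ a c : Fin 2, A a c = Complex.exp (lam * (((a : ℕ) : ℂ) - (c : ℕ))) •
      (weight u * A' a c * weight (-u)))
    (hB : ∀ a c : Fin 2, B a c = Complex.exp (lam * (((a : ℕ) : ℂ) - (c : ℕ))) •
      (weight u * B' a c * weight (-u))) (a c : Fin 2) :
    (A * B) a c = Complex.exp (lam * (((a : ℕ) : ℂ) - (c : ℕ))) •
      (weight u * (A' * B') a c * weight (-u)) := by
  rw [Matrix.mul_apply, Matrix.mul_apply, Finset.mul_sum, Finset.sum_mul, Finset.smul_sum]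
  refine Finset.sum_congr rfl fun b _ => ?_
  have e1 : weight u * A' a b * weight (-u) * (weight u * B' b c * weight (-u)) =
      weight u * (A' a b * B' b c) * weight (-u) := by
    calc weight u * A' a b * weight (-u) * (weight u * B' b c * weight (-u))
        = weight u * A' a b * (weight (-u) * weight u) * B' b c * weight (-u) := by
          simp only [mul_assoc]
      _ = _ := by rw [weight_neg_mul, mul_one]; simp only [mul_assoc]
  have e2 : Complex.exp (lam * (((a : ℕ) : ℂ) - (b : ℕ))) *
      Complex.exp (lam * (((b : ℕ) : ℂ) - (c : ℕ))) =
      Complex.exp (lam * (((a : ℕ) : ℂ) - (c : ℕ))) := by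
    rw [← Complex.exp_add]
    congr 1
    ring
  rw [hA, hB, Matrix.smul_mul, Matrix.mul_smul, smul_smul, e2, e1]

theorem monodromy_RHomogeneous (ζ : ℝ) (ξ : Fin N → ℝ) (lam : ℂ) (a c : Fin 2) :
    monodromy ζ ξ (RHomogeneous ζ) lam a c =
      Complex.exp (lam * (((a : ℕ) : ℂ) - (c : ℕ))) •
        (weight (w ζ ξ) * monodromy ζ ξ (RPrincipal ζ) lam a c * weight (-w ζ ξ)) := by
  rw [monodromy, monodromy]
  generalize (List.finRange N).reverse = m
  induction m generalizing a c with
  | nil =>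
    simp only [List.map_nil, List.prod_nil, Matrix.one_apply]
    split_ifs with h
    · rw [h]; simp [weight_mul_neg]
    · simp
  | cons b m ih =>
    rw [List.map_cons, List.prod_cons, List.map_cons, List.prod_cons]
    refine mul_apply_of_conj ?_ ih a c
    exact mul_apply_of_conj (lax_RHomogeneous ζ ξ lam _) (lax_RHomogeneous ζ ξ lam _)

/-- The weights of the gauge transformation from the principal to the spin-1 grading. -/
noncomputable def fusionWeight (N : ℕ) (ζ : ℝ) (j : Fin N × Fin 2) : ℂ :=
  (1 / 2 - ((j.2 : ℕ) : ℂ)) * eta ζ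

theorem qInt_two_ne_zero {ζ : ℝ} (h0 : 0 < ζ) (h1 : ζ < Real.pi / 2) : qInt ζ 2 ≠ 0 := by
  have h := sinh_two_eta_ne_zero h0 h1
  have e1 : q ζ ^ 2 - (q ζ)⁻¹ ^ 2 = 2 * Complex.sinh (2 * eta ζ) := by
    rw [q, ← Complex.exp_neg, ← Complex.exp_nat_mul, ← Complex.exp_nat_mul, Complex.sinh]
    push_cast
    rw [mul_neg]
    ring
  have e2 : q ζ - (q ζ)⁻¹ = 2 * Complex.sinh (eta ζ) := by
    rw [q, ← Complex.exp_neg, Complex.sinh]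
    ring
  rw [qInt, e1, e2]
  refine div_ne_zero (mul_ne_zero two_ne_zero h) (mul_ne_zero two_ne_zero fun h' => h ?_)
  rw [Complex.sinh_two_mul, h']
  ring

theorem q_ne_zero (ζ : ℝ) : q ζ ≠ 0 := Complex.exp_ne_zero _

/-- The normalizations of the ket and of the covector multiply to 1/2, so the projector is the
symmetrizer conjugated by the weights η/2 and -η/2. -/
theorem PTilde2_apply {ζ : ℝ} (h0 : 0 < ζ) (h1 : ζ < Real.pi / 2) (x y : Fin 2 × Fin 2) :
    PTilde2 ζ x y =
      Complex.exp (eta ζ / 2 * (((x.1 : ℕ) : ℂ) - (y.1 : ℕ)) -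
        eta ζ / 2 * (((x.2 : ℕ) : ℂ) - (y.2 : ℕ))) *
      (((if x.1 = y.1 ∧ x.2 = y.2 then 1 else 0) +
        if x.1 = y.2 ∧ x.2 = y.1 then 1 else 0) / 2) := by
  have h2 := qInt_two_ne_zero h0 h1
  have h3 := q_ne_zero ζ
  obtain ⟨a, b⟩ := x
  obtain ⟨c, d⟩ := y
  fin_cases a <;> fin_cases b <;> fin_cases c <;> fin_cases d <;>
    simp [PTilde2, Fin.sum_univ_three, ketTilde2, bra2, Matrix.vecMulVec_apply]
  · field_simp
  · have e : Complex.exp (-(eta ζ / 2) - eta ζ / 2) = (q ζ)⁻¹ := by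
      rw [q, ← Complex.exp_neg]
      congr 1
      ring
    rw [e]
    field_simp
  · change _ = q ζ * 2⁻¹
    field_simp
  · field_simp

end XXZ

end

/-! ### Spin-1 vectors in terms of spin-1/2 vectors -/

section

open Set
open scoped Kronecker

namespace XXZ

variable {N : ℕ}

theorem PTilde_eq {ζ : ℝ} (h0 : 0 < ζ) (h1 : ζ < Real.pi / 2) :
    PTilde N ζ = weight (fusionWeight N ζ) * blockSym N * weight (-fusionWeight N ζ) := by
  ext σ τ
  rw [weight_conj_apply, PTilde, blockSym, Matrix.of_apply, Matrix.of_apply]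
  simp only [PTilde2_apply h0 h1, Finset.prod_mul_distrib, ← Complex.exp_sum]
  congr 2
  simp only [Fintype.sum_prod_type, Fin.sum_univ_two, fusionWeight]
  refine Finset.sum_congr rfl fun b _ => ?_
  simp
  ring

theorem commute_weight_blockSym {u : Fin N × Fin 2 → ℂ} (hu : ∀ b, u (b, 0) = u (b, 1)) :
    Commute (weight u) (blockSym N) := by
  ext σ τ
  rw [weight, Matrix.diagonal_mul, Matrix.mul_diagonal, mul_comm]
  by_cases h0 : blockSym N σ τ = 0
  · rw [h0, zero_mul, zero_mul]
  · congr 2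
    simp only [Fintype.sum_prod_type, Fin.sum_univ_two]
    refine Finset.sum_congr rfl fun b _ => ?_
    have h : σ (b, 0) = τ (b, 0) ∧ σ (b, 1) = τ (b, 1) ∨
        σ (b, 0) = τ (b, 1) ∧ σ (b, 1) = τ (b, 0) := by
      rw [blockSym, Matrix.of_apply, Finset.prod_eq_zero_iff] at h0
      have := fun h => h0 ⟨b, Finset.mem_univ b, h⟩
      contrapose! this
      rw [if_neg (by tauto), if_neg (by tauto)]
      simp
    rcases h with h | h
    · rw [h.1, h.2]
    · rw [h.1, h.2, hu]
      ring

theorem fusedMonodromy_eq {ζ : ℝ} (h0 : 0 < ζ) (h1 : ζ < Real.pi / 2) (ξ : Fin N → ℝ) (lam : ℂ)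
    (a c : Fin 2) :
    fusedMonodromy ζ ξ lam a c = weight (fusionWeight N ζ) *
      (blockSym N * monodromy ζ ξ (RPrincipal ζ) lam a c * blockSym N) *
        weight (-fusionWeight N ζ) := by
  rw [fusedMonodromy, Matrix.of_apply, monodromy_RHomogeneous, PTilde_eq h0 h1, gauge_inv,
    gauge_eq_weight]
  set f := fusionWeight N ζ
  set g : Fin N × Fin 2 → ℂ := fun j => ξ j.1 - eta ζ / 2
  set P := blockSym N
  set T := monodromy ζ ξ (RPrincipal ζ) lam a c
  -- The inhomogeneities split into the position within the string, as in the projector, and the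
  -- center of the string, as in the gauge factor. The latter is constant on each pair, hence
  -- commutes with the symmetrizer and cancels.
  have hw : w ζ ξ = f + g := by
    ext j
    simp only [f, g, fusionWeight, w, Pi.add_apply]
    ring
  have c1 : Commute (weight (-g)) P := commute_weight_blockSym fun b => rfl
  have c2 : Commute (weight g) P := commute_weight_blockSym fun b => rfl
  have c3 : Commute (weight (-g)) (weight f) := by
    rw [Commute, SemiconjBy, weight_mul, weight_mul, add_comm]
  have e1 : weight (-f) * weight (w ζ ξ) = weight g := by
    rw [weight_mul, hw, neg_add_cancel_left]
  have e2 : weight (-w ζ ξ) * weight f = weight (-g) := by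
    rw [weight_mul, hw]
    congr 1
    abel
  have e3 : Complex.exp (((c : ℕ) : ℂ) * lam) * Complex.exp (-(((a : ℕ) : ℂ) * lam)) *
      Complex.exp (lam * (((a : ℕ) : ℂ) - (c : ℕ))) = 1 := by
    rw [← Complex.exp_add, ← Complex.exp_add, Complex.exp_eq_one_iff]
    exact ⟨0, by push_cast; ring⟩
  have e4 : weight (-g) * ((weight f * P * weight (-f)) * (weight (w ζ ξ) * T * weight (-w ζ ξ)) *
      (weight f * P * weight (-f))) * weight g = weight f * (P * T * P) * weight (-f) := by
    have c4 : weight (-f) * weight g = weight g * weight (-f) := by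
      rw [weight_mul, weight_mul, add_comm]
    calc _ = weight (-g) * weight f * P * (weight (-f) * weight (w ζ ξ)) * T *
          (weight (-w ζ ξ) * weight f) * P * (weight (-f) * weight g) := by simp only [mul_assoc]
      _ = weight f * (weight (-g) * P) * weight g * T * (weight (-g) * P) * weight g *
          weight (-f) := by
        rw [e1, e2, c3.eq, c4]; simp only [mul_assoc]
      _ = weight f * P * (weight (-g) * weight g) * T * P * (weight (-g) * weight g) *
          weight (-f) := by
        rw [c1.eq]; simp only [mul_assoc]
      _ = _ := by rw [weight_neg_mul]; simp only [mul_one, mul_assoc]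
  rw [Matrix.mul_smul, Matrix.smul_mul, Matrix.mul_smul, Matrix.smul_mul, smul_smul, e3, one_smul,
    e4]

theorem vac_vecMul_blockSym : vac N ᵥ* blockSym N = vac N := by
  refine vecMul_blockSym fun b => ?_
  ext τ
  rw [vecMul_swapOp_apply]
  simp only [vac, Pi.single_apply]
  refine if_congr ⟨fun h => ?_, ?_⟩ rfl rfl
  · ext k
    have := congrFun h (Equiv.swap (b, 0) (b, 1) k)
    simp at this
    simp [this]
  · rintro rfl
    rfl

theorem blockSym_mulVec_vac : blockSym N *ᵥ vac N = vac N := by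
  rw [← Matrix.vecMul_transpose, blockSym_transpose, vac_vecMul_blockSym]

/-- The inner factors D' D cancel, and P T P = P T lets each projector be absorbed by the one on its
left. On a ket the leftmost projector survives. -/
theorem prod_mulVec_eq {n : Type*} [Fintype n] {D D' P : Matrix n n ℂ} [DecidableEq n]
    (hD : D' * D = 1) {v : n → ℂ} (hDv : D *ᵥ v = v) (hPv : P *ᵥ v = v) (hP : P * P = P)
    (l : List (Matrix n n ℂ)) (hl : ∀ T ∈ l, P * T * P = P * T) :
    (l.map fun T => D * (P * T * P) * D').prod *ᵥ v = (D * P) *ᵥ (l.prod *ᵥ v) := by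
  induction l with
  | nil => simp [← Matrix.mulVec_mulVec, hDv, hPv]
  | cons T l ih =>
    rw [List.map_cons, List.prod_cons, ← Matrix.mulVec_mulVec, ih fun S hS => hl S (by simp [hS]),
      List.prod_cons, Matrix.mulVec_mulVec, Matrix.mulVec_mulVec, Matrix.mulVec_mulVec]
    congr 1
    calc D * (P * T * P) * D' * (D * P) * l.prod
        = D * (P * T) * P * (D' * D) * P * l.prod := by simp only [mul_assoc]
      _ = D * (P * T) * (P * P) * l.prod := by rw [hD, mul_one]; simp only [mul_assoc]
      _ = D * (P * T * P) * l.prod := by rw [hP]; simp only [mul_assoc]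
      _ = _ := by rw [hl T (by simp)]; simp only [mul_assoc]

/-- On a bra every projector disappears: if v P = v, then P T P = P T gives (v T) P = v T, so the
invariance is carried through the product. -/
theorem vecMul_prod_eq {n : Type*} [Fintype n] {D D' P : Matrix n n ℂ} [DecidableEq n]
    (hD : D' * D = 1) (l : List (Matrix n n ℂ)) (hl : ∀ T ∈ l, P * T * P = P * T)
    {v : n → ℂ} (hPv : v ᵥ* P = v) :
    (v ᵥ* D') ᵥ* (l.map fun T => D * (P * T * P) * D').prod = (v ᵥ* l.prod) ᵥ* D' ∧
      (v ᵥ* l.prod) ᵥ* P = v ᵥ* l.prod := by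
  induction l generalizing v with
  | nil => simp [hPv]
  | cons T l ih =>
    have e1 : (v ᵥ* T) ᵥ* P = v ᵥ* T := by
      have := congrArg (v ᵥ* ·) (hl T (by simp))
      simpa only [← Matrix.vecMul_vecMul, hPv] using this
    obtain ⟨i1, i2⟩ := ih (fun S hS => hl S (by simp [hS])) e1
    have e2 : (v ᵥ* D') ᵥ* (D * (P * T * P) * D') = (v ᵥ* T) ᵥ* D' := by
      rw [Matrix.vecMul_vecMul, hl T (by simp), ← mul_assoc, ← mul_assoc, hD, one_mul, mul_assoc,
        ← Matrix.vecMul_vecMul, hPv, ← Matrix.vecMul_vecMul]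
    rw [List.map_cons, List.prod_cons, ← Matrix.vecMul_vecMul, e2, i1, List.prod_cons,
      ← Matrix.vecMul_vecMul]
    exact ⟨rfl, i2⟩

section

variable {ζ : ℝ} {ξ : Fin N → ℝ} {M : ℕ} {lam : Fin M → ℂ}

theorem ketOne_eq (h0 : 0 < ζ) (h1 : ζ < Real.pi / 2)
    (hlam : ∀ γ j, Complex.sinh (lam γ - w ζ ξ j + eta ζ) ≠ 0) :
    ketOne ζ ξ lam = (weight (fusionWeight N ζ) * blockSym N) *ᵥ ketHalf ζ ξ lam := by
  rw [ketOne, ketHalf, ← prod_mulVec_eq (weight_neg_mul (fusionWeight N ζ)) (weight_mulVec_vac _)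
    blockSym_mulVec_vac blockSym_mul_blockSym, List.map_ofFn]
  · simp only [fusedMonodromy_eq h0 h1]
    rfl
  · intro T hT
    obtain ⟨γ, rfl⟩ := List.mem_ofFn.1 hT
    exact blockSym_mul_monodromy_mul_blockSym (hlam γ) 0 1

theorem braOne_eq_and (h0 : 0 < ζ) (h1 : ζ < Real.pi / 2)
    (hlam : ∀ γ j, Complex.sinh (lam γ - w ζ ξ j + eta ζ) ≠ 0) :
    braOne ζ ξ lam = braHalf ζ ξ lam ᵥ* weight (-fusionWeight N ζ) ∧
      braHalf ζ ξ lam ᵥ* blockSym N = braHalf ζ ξ lam := by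
  have h := vecMul_prod_eq (weight_neg_mul (fusionWeight N ζ))
    (List.ofFn fun γ => monodromy ζ ξ (RPrincipal ζ) (lam γ) 1 0) (fun T hT => by
      obtain ⟨γ, rfl⟩ := List.mem_ofFn.1 hT
      exact blockSym_mul_monodromy_mul_blockSym (hlam γ) 1 0) vac_vecMul_blockSym
  rw [vac_vecMul_weight, List.map_ofFn] at h
  refine ⟨?_, h.2⟩
  rw [braOne, braHalf, ← h.1]
  simp only [fusedMonodromy_eq h0 h1]
  rfl

end

end XXZ

end

/-! ### The symmetry relations -/

section

open Set
open scoped Kronecker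

namespace XXZ

variable {N : ℕ}

theorem elem_mul_elem_apply (b : Fin N) (a c a' c' : Fin 2) (σ τ : Conf N) :
    (elem (b, 0) a c * elem (b, 1) a' c' : Op N) σ τ =
      if (∀ m, m ≠ (b, 0) → m ≠ (b, 1) → σ m = τ m) ∧ (σ (b, 0) = a ∧ τ (b, 0) = c) ∧
        σ (b, 1) = a' ∧ τ (b, 1) = c' then 1 else 0 := by
  rw [elem, elem, siteOp_mul_siteOp (by simp)]
  simp only [twoSiteOp, Matrix.of_apply, Matrix.kroneckerMap_apply, Matrix.single_apply]
  split_ifs <;> simp_all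

theorem swapOp_mul_elem (b : Fin N) (a c a' c' : Fin 2) :
    swapOp b * (elem (b, 0) a c * elem (b, 1) a' c') = elem (b, 0) a' c * elem (b, 1) a c' := by
  refine Matrix.ext fun σ τ => ?_
  rw [swapOp_mul_apply, elem_mul_elem_apply, elem_mul_elem_apply]
  refine if_congr (and_congr (forall₃_congr fun m h0 h1 => ?_) ?_) rfl rfl
  · simp [Equiv.swap_apply_of_ne_of_ne h0 h1]
  · simp
    tauto

theorem elem_mul_elem_flip (b : Fin N) (a c a' c' : Fin 2) (σ τ : Conf N) :
    (elem (b, 0) a c * elem (b, 1) a' c' : Op N) (flip σ) (flip τ) =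
      (elem (b, 0) (1 - a) (1 - c) * elem (b, 1) (1 - a') (1 - c') : Op N) σ τ := by
  have e1 : ∀ x y : Fin 2, 1 - x = 1 - y ↔ x = y := by decide
  have e2 : ∀ x y : Fin 2, 1 - x = y ↔ x = 1 - y := by decide
  rw [elem_mul_elem_apply, elem_mul_elem_apply]
  simp only [flip, e1, e2]

theorem sum_flip (f : Conf N → ℂ) : ∑ σ, f (flip σ) = ∑ σ, f σ :=
  Equiv.sum_comp ⟨flip, flip, flip_flip, flip_flip⟩ f

theorem matrixElement_apply (bra ket : Conf N → ℂ) (A : Op N) :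
    matrixElement bra ket A = ∑ σ, ∑ τ, bra σ * A σ τ * ket τ := by
  simp only [matrixElement, dotProduct, Matrix.mulVec, Finset.mul_sum, mul_assoc]

theorem matrixElement_elem_flip {bra ket : Conf N → ℂ} {s : ℂ} (hs : s * s = 1)
    (hbra : ∀ σ, bra (flip σ) = s * bra σ) (hket : ∀ σ, ket (flip σ) = s * ket σ) (b : Fin N)
    (a c a' c' : Fin 2) :
    matrixElement bra ket (elem (b, 0) (1 - a) (1 - c) * elem (b, 1) (1 - a') (1 - c')) =
      matrixElement bra ket (elem (b, 0) a c * elem (b, 1) a' c') := by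
  rw [matrixElement_apply, matrixElement_apply, ← sum_flip]
  refine Finset.sum_congr rfl fun σ _ => ?_
  rw [← sum_flip]
  refine Finset.sum_congr rfl fun τ _ => ?_
  rw [elem_mul_elem_flip, hbra, hket]
  simp only [sub_sub_cancel]
  linear_combination (bra σ * (elem (b, 0) a c * elem (b, 1) a' c' : Op N) σ τ * ket τ) * hs

theorem matrixElement_elem_swap {bra ket : Conf N → ℂ} {b : Fin N} (hbra : bra ᵥ* swapOp b = bra)
    (a c a' c' : Fin 2) :
    matrixElement bra ket (elem (b, 0) a' c * elem (b, 1) a c') =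
      matrixElement bra ket (elem (b, 0) a c * elem (b, 1) a' c') := by
  rw [← swapOp_mul_elem, matrixElement, ← Matrix.mulVec_mulVec, Matrix.dotProduct_mulVec, hbra,
    matrixElement]

theorem matrixElement_elem_eq {bra ket : Conf N → ℂ} {s : ℂ} (hs : s * s = 1)
    (hbra : ∀ σ, bra (flip σ) = s * bra σ) (hket : ∀ σ, ket (flip σ) = s * ket σ) {b : Fin N}
    (hswap : bra ᵥ* swapOp b = bra) (a c : Fin 2) :
    matrixElement bra ket (elem (b, 0) a c * elem (b, 1) (1 - a) (1 - c)) =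
      matrixElement bra ket (elem (b, 0) 0 0 * elem (b, 1) 1 1) := by
  -- The exchange of sites changes a and keeps c; the spin inversion changes both. Together they
  -- reach all four pairs (a, c).
  have h1 := fun a c => matrixElement_elem_swap (ket := ket) hswap a c (1 - a) (1 - c)
  have h2 := fun a c => matrixElement_elem_flip hs hbra hket b a c (1 - a) (1 - c)
  have h10 := h1 0 0
  have h11 := h1 0 1
  have h20 := h2 0 0
  have h21 := h2 0 1
  fin_cases a <;> fin_cases c <;> simp at *
  · exact (h21.symm.trans h10)
  · exact h10
  · exact h20

theorem ETilde_one_apply {ζ : ℝ} (h0 : 0 < ζ) (h1 : ζ < Real.pi / 2) (x y : Fin 2 × Fin 2) :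
    ETilde ζ 1 x y =
      Complex.exp (eta ζ / 2 * (((x.1 : ℕ) : ℂ) - (y.1 : ℕ)) -
        eta ζ / 2 * (((x.2 : ℕ) : ℂ) - (y.2 : ℕ))) *
      if x.2 = 1 - x.1 ∧ y.2 = 1 - y.1 then 1 / 2 else 0 := by
  have h2 := qInt_two_ne_zero h0 h1
  have h3 := q_ne_zero ζ
  obtain ⟨a, b⟩ := x
  obtain ⟨c, d⟩ := y
  fin_cases a <;> fin_cases b <;> fin_cases c <;> fin_cases d <;>
    simp [ETilde, ketTilde2, bra2, Matrix.vecMulVec_apply]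
  · field_simp
  · have e : Complex.exp (-(eta ζ / 2) - eta ζ / 2) = (q ζ)⁻¹ := by
      rw [q, ← Complex.exp_neg]
      congr 1
      ring
    rw [e]
    field_simp
  · change _ = q ζ * 2⁻¹
    field_simp
  · field_simp

/-- Removing the diagonal weights makes all four nonzero entries of Ẽ¹¹ on the pair equal to 1/2. -/
theorem weight_conj_pairOp_ETilde {ζ : ℝ} (h0 : 0 < ζ) (h1 : ζ < Real.pi / 2) (b : Fin N) :
    weight (-fusionWeight N ζ) * pairOp b (ETilde ζ 1) * weight (fusionWeight N ζ) =
      (1 / 2 : ℂ) • ∑ a, ∑ c, elem (b, 0) a c * elem (b, 1) (1 - a) (1 - c) := by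
  ext σ τ
  have e := weight_conj_apply (-fusionWeight N ζ) (pairOp b (ETilde ζ 1)) σ τ
  rw [neg_neg] at e
  rw [e]
  simp only [Matrix.smul_apply, Matrix.sum_apply, elem_mul_elem_apply, pairOp, Matrix.of_apply,
    ETilde_one_apply h0 h1]
  have hc : (∀ m : Fin N × Fin 2, m ≠ (b, 0) → m ≠ (b, 1) → σ m = τ m) ↔
      ∀ m : Fin N × Fin 2, m.1 ≠ b → σ m = τ m := by
    refine ⟨fun h m hm => h m (by rintro rfl; exact hm rfl) (by rintro rfl; exact hm rfl),
      fun h m hm0 hm1 => h m ?_⟩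
    rintro rfl
    obtain ⟨b, β⟩ := m
    fin_cases β
    · exact hm0 rfl
    · exact hm1 rfl
  simp only [hc]
  by_cases h : ∀ m : Fin N × Fin 2, m.1 ≠ b → σ m = τ m
  · rw [if_pos h]
    simp only [eq_true h, true_and]
    have es : ∑ j, (-fusionWeight N ζ) j * (((σ j : ℕ) : ℂ) - (τ j : ℕ)) +
        (eta ζ / 2 * (((σ (b, 0) : ℕ) : ℂ) - (τ (b, 0) : ℕ)) -
          eta ζ / 2 * (((σ (b, 1) : ℕ) : ℂ) - (τ (b, 1) : ℕ))) = 0 := by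
      rw [Fintype.sum_prod_type, Finset.sum_eq_single b]
      · simp [fusionWeight]
        ring
      · intro c _ hc
        rw [Fin.sum_univ_two, h (c, 0) hc, h (c, 1) hc]
        ring
      · simp
    rw [← mul_assoc, ← Complex.exp_add, es, Complex.exp_zero, one_mul]
    generalize σ (b, 0) = x
    generalize σ (b, 1) = y
    generalize τ (b, 0) = z
    generalize τ (b, 1) = t
    simp only [Fin.sum_univ_two]
    fin_cases x <;> fin_cases y <;> fin_cases z <;> fin_cases t <;> simp
  · rw [if_neg h]
    simp only [eq_false h, false_and, if_false, Finset.sum_const_zero, smul_zero, mul_zero]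

theorem vecMul_swapOp_eq {v : Conf N → ℂ} (hv : v ᵥ* blockSym N = v) (b : Fin N) :
    v ᵥ* swapOp b = v := by
  rw [← hv, Matrix.vecMul_vecMul, blockSym_mul_swapOp]

theorem commute_swapOp_elem {b b' : Fin N} (h : b' ≠ b) (β a c : Fin 2) :
    Commute (swapOp b) (elem (b', β) a c) :=
  commute_swapOp_siteOp h _

theorem elem_mul_swapOp (b : Fin N) (a c a' c' : Fin 2) :
    elem (b, 0) a c * elem (b, 1) a' c' * swapOp b = elem (b, 0) a c' * elem (b, 1) a' c := by
  refine Matrix.ext fun σ τ => ?_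
  rw [mul_swapOp_apply, elem_mul_elem_apply, elem_mul_elem_apply]
  refine if_congr (and_congr (forall₃_congr fun m h0 h1 => ?_) ?_) rfl rfl
  · simp [Equiv.swap_apply_of_ne_of_ne h0 h1]
  · simp
    tauto

/-- The sum over a and c is invariant under the exchange in the pair `b` and commutes with the
exchanges in the other pairs. The symmetrizer in front of the spin-1/2 ket can thus be dropped,
although that ket itself need not be symmetric. -/
theorem vecMul_sum_elem_blockSym {v : Conf N → ℂ} (hv : v ᵥ* blockSym N = v) (b : Fin N) :
    (v ᵥ* ∑ a, ∑ c, elem (b, 0) a c * elem (b, 1) (1 - a) (1 - c)) ᵥ* blockSym N =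
      v ᵥ* ∑ a, ∑ c, elem (b, 0) a c * elem (b, 1) (1 - a) (1 - c) := by
  refine vecMul_blockSym fun b' => ?_
  by_cases h : b' = b
  · subst h
    rw [Matrix.vecMul_vecMul]
    congr 1
    simp only [Fin.sum_univ_two, add_mul, elem_mul_swapOp]
    simp
    abel
  · have hc : Commute (swapOp b')
        (∑ a, ∑ c, elem (b, 0) a c * elem (b, 1) (1 - a) (1 - c) : Op N) :=
      Commute.sum_right _ _ _ fun a _ => Commute.sum_right _ _ _ fun c _ =>
        (commute_swapOp_elem (Ne.symm h) _ _ _).mul_right (commute_swapOp_elem (Ne.symm h) _ _ _)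
    rw [Matrix.vecMul_vecMul, ← hc.eq, ← Matrix.vecMul_vecMul, vecMul_swapOp_eq hv]

variable {ζ : ℝ} {ξ : Fin N → ℝ} {M : ℕ} {lam : Fin M → ℂ}

theorem braOne_dotProduct_ketOne (h0 : 0 < ζ) (h1 : ζ < Real.pi / 2)
    (hlam : ∀ γ j, Complex.sinh (lam γ - w ζ ξ j + eta ζ) ≠ 0) :
    braOne ζ ξ lam ⬝ᵥ ketOne ζ ξ lam = braHalf ζ ξ lam ⬝ᵥ ketHalf ζ ξ lam := by
  obtain ⟨e1, e2⟩ := braOne_eq_and h0 h1 hlam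
  rw [e1, ketOne_eq h0 h1 hlam, Matrix.dotProduct_mulVec, Matrix.vecMul_vecMul, ← mul_assoc,
    weight_neg_mul, one_mul, e2]

theorem matrixElement_ETilde (h0 : 0 < ζ) (h1 : ζ < Real.pi / 2)
    (hlam : ∀ γ j, Complex.sinh (lam γ - w ζ ξ j + eta ζ) ≠ 0) (b : Fin N) :
    matrixElement (braOne ζ ξ lam) (ketOne ζ ξ lam) (pairOp b (ETilde ζ 1)) =
      1 / 2 * ∑ a, ∑ c, matrixElement (braHalf ζ ξ lam) (ketHalf ζ ξ lam)
        (elem (b, 0) a c * elem (b, 1) (1 - a) (1 - c)) := by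
  obtain ⟨e1, e2⟩ := braOne_eq_and h0 h1 hlam
  rw [matrixElement, e1, ketOne_eq h0 h1 hlam, Matrix.dotProduct_mulVec, Matrix.vecMul_vecMul,
    Matrix.dotProduct_mulVec, Matrix.vecMul_vecMul, ← mul_assoc, weight_conj_pairOp_ETilde h0 h1,
    Matrix.smul_mul, Matrix.vecMul_smul, ← Matrix.vecMul_vecMul, vecMul_sum_elem_blockSym e2,
    smul_dotProduct, smul_eq_mul, ← Matrix.dotProduct_mulVec]
  simp only [matrixElement, Matrix.sum_mulVec, dotProduct_sum]

theorem matrixElement_ETilde_eq (h0 : 0 < ζ) (h1 : ζ < Real.pi / 2)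
    (hlam : ∀ γ j, Complex.sinh (lam γ - w ζ ξ j + eta ζ) ≠ 0)
    (hU : spinInversion N *ᵥ ketHalf ζ ξ lam = ketHalf ζ ξ lam ∨
      spinInversion N *ᵥ ketHalf ζ ξ lam = -ketHalf ζ ξ lam) (b : Fin N) (a c : Fin 2) :
    matrixElement (braOne ζ ξ lam) (ketOne ζ ξ lam) (pairOp b (ETilde ζ 1)) =
      2 * matrixElement (braHalf ζ ξ lam) (ketHalf ζ ξ lam)
        (elem (b, 0) a c * elem (b, 1) (1 - a) (1 - c)) := by
  obtain ⟨V, hV, hbra⟩ := exists_braHalf_eq_mulVec_ketHalf (sinh_two_eta_ne_zero h0 h1) hlam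
  obtain ⟨s, hs, hk⟩ : ∃ s : ℂ, s * s = 1 ∧
      spinInversion N *ᵥ ketHalf ζ ξ lam = s • ketHalf ζ ξ lam := by
    rcases hU with h | h
    · exact ⟨1, by ring, by rw [h, one_smul]⟩
    · exact ⟨-1, by ring, by rw [h, neg_one_smul]⟩
  have hb : spinInversion N *ᵥ braHalf ζ ξ lam = s • braHalf ζ ξ lam := by
    rw [hbra, Matrix.mulVec_mulVec, ← hV.eq, ← Matrix.mulVec_mulVec, hk, Matrix.mulVec_smul]
  have hU' : ∀ (v : Conf N → ℂ) σ, (spinInversion N *ᵥ v) σ = v (flip σ) := by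
    intro v σ
    simp [Matrix.mulVec, dotProduct, spinInversion_apply]
  have key := matrixElement_elem_eq (ket := ketHalf ζ ξ lam) (b := b) hs
    (fun σ => by rw [← hU' (braHalf ζ ξ lam), hb]; rfl)
    (fun σ => by rw [← hU' (ketHalf ζ ξ lam), hk]; rfl)
    (vecMul_swapOp_eq (braOne_eq_and h0 h1 hlam).2 b)
  rw [matrixElement_ETilde h0 h1 hlam]
  simp only [key, Finset.sum_const, Finset.card_univ, Fintype.card_fin, nsmul_eq_mul]
  push_cast
  ring

end XXZ

end

theorem mainTheorem3 (ζ : ℝ) (hζ0 : 0 < ζ) (hζ : ζ < Real.pi / 2) :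
    -- the symmetry relations for the finite chain
    (∀ (N : ℕ) [NeZero N] (ξ : Fin N → ℝ) (lam : Fin N → ℂ),
      (∀ γ j, Complex.sinh (lam γ - XXZ.w ζ ξ j + XXZ.eta ζ) ≠ 0) →
      (XXZ.spinInversion N *ᵥ XXZ.ketHalf ζ ξ lam = XXZ.ketHalf ζ ξ lam ∨
        XXZ.spinInversion N *ᵥ XXZ.ketHalf ζ ξ lam = -XXZ.ketHalf ζ ξ lam) →
      ∀ a c : Fin 2,
        XXZ.matrixElement (XXZ.braOne ζ ξ lam) (XXZ.ketOne ζ ξ lam)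
            (XXZ.pairOp 0 (XXZ.ETilde ζ 1)) =
          2 * XXZ.matrixElement (XXZ.braHalf ζ ξ lam) (XXZ.ketHalf ζ ξ lam)
            (XXZ.elem (0, 0) a c * XXZ.elem (0, 1) (1 - a) (1 - c)) ∧
        XXZ.expectation (XXZ.braOne ζ ξ lam) (XXZ.ketOne ζ ξ lam)
            (XXZ.pairOp 0 (XXZ.ETilde ζ 1)) =
          2 * XXZ.expectation (XXZ.braHalf ζ ξ lam) (XXZ.ketHalf ζ ξ lam)
            (XXZ.elem (0, 0) a c * XXZ.elem (0, 1) (1 - a) (1 - c))) ∧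
    -- the double integrals of the thermodynamic limit
    (∀ ξ₁ : ℝ,
      (∀ a c : Fin 2,
        (∀ᶠ ε in 𝓝[>] (0 : ℝ), ∀ g : Fin 2 → Fin 2,
          Integrable (XXZ.integrand ζ ξ₁ a c ε g)) ∧
        Tendsto (fun ε => 2 * XXZ.doubleIntegral ζ ξ₁ a c ε) (𝓝[>] 0)
          (𝓝 (XXZ.onePoint ζ : ℂ))) ∧
      (∀ a : Fin 2,
        Tendsto (fun ε => ∑ c : Fin 2, XXZ.doubleIntegral ζ ξ₁ a c ε) (𝓝[>] 0)
          (𝓝 (XXZ.onePoint ζ : ℂ)))) := by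
  refine ⟨fun N _ ξ lam hlam hU a c => ?_, fun ξ₁ => ⟨fun a c => ⟨?_, ?_⟩, fun a => ?_⟩⟩
  · have h := XXZ.matrixElement_ETilde_eq hζ0 hζ hlam hU 0 a c
    refine ⟨h, ?_⟩
    -- The two norms coincide, so the relation between matrix elements passes to the quotients, even
    -- when the norm vanishes.
    rw [XXZ.expectation, XXZ.expectation, h, XXZ.braOne_dotProduct_ketOne hζ0 hζ hlam,
      mul_div_assoc]
  · filter_upwards [Ioo_mem_nhdsGT (half_pos hζ0)] with ε hε g
    exact XXZ.integrable_integrand hζ0 hζ hε.1 hε.2 a c g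
  · exact XXZ.tendsto_doubleIntegral hζ0 hζ ξ₁ a c
  · have h := ((XXZ.tendsto_doubleIntegral hζ0 hζ ξ₁ a 0).const_mul (1 / 2 : ℂ)).add
      ((XXZ.tendsto_doubleIntegral hζ0 hζ ξ₁ a 1).const_mul (1 / 2 : ℂ))
    have e : (1 / 2 : ℂ) * XXZ.onePoint ζ + 1 / 2 * XXZ.onePoint ζ = XXZ.onePoint ζ := by ring
    rw [e] at h
    refine h.congr fun ε => ?_
    rw [Fin.sum_univ_two]
    ring
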